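/- **Setting.** An instance of $mRmDc$ consists of finite sets $D$ of demands and $R\neq\emptyset$ of resource types; for each $r\in R$ a finite set $S^r$ of starting locations and numbers $l^r_s\in\mathbb Z_{\ge 0}$ of resources of type $r$ that start at $s\in S^r$; for each $d\in D$ a nonempty set $M_d\subseteq R$ of required types, a service start time $\tau_d\in\mathbb Z$, a duration $\Delta_d\in\mathbb Z_{\ge 0}$ and a reward $w_d\in\mathbb Z$; and travel times $f_{xd}\in\mathbb Z_{\ge0}$ and travel costs $c_{xd}\in\mathbb Z_{\ge 0}$ from every location $x$ (a starting location or the location of a demand) to the location of every demand $d$. Put $A_{ij}=1$ if $\tau_i+\Delta_i+f_{ij}\le\tau_j$ and $M_i\cap M_j\ne\emptyset$, and $A_{ij}=0$ otherwise; for $s\in S^r$ and $r\in M_d$ put $B_{sd}=1$ if $f_{sd}\le\tau_d$, and $B_{sd}=0$ otherwise. Travel times satisfy the triangle inequality $f_{xd}\le f_{xh}+f_{hd}$, and the digraph on $D$ with arcs $\{(i,j):A_{ij}=1\}$ is acyclic. A feasible solution is an assignment of values in $\{0,1\}$ to variables $y_d$ ($d\in D$), $x^r_{sd}$ ($s\in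 S^r$, $r\in M_d$, $B_{sd}=1$), $x^r_{ij}$ ($r\in M_i\cap M_j$, $A_{ij}=1$) and $x^r_{dt}$ ($r\in M_d$) such that (sums running over existing variables) $$\sum_{d}x^r_{sd}\le l^r_s\quad(s\in S^r,\ r\in R),\qquad \sum_{s}x^r_{si}+\sum_h x^r_{hi}=\sum_j x^r_{ij}+x^r_{it}\ \text{ and }\ \sum_{s}x^r_{si}+\sum_h x^r_{hi}\ge y_i\quad(i\in D,\ r\in M_i).$$ Its objective, to be maximized, is $\sum_d y_dw_d-\sum_r\big(\sum_{s,d}x^r_{sd}c_{sd}+\sum_{i,j}x^r_{ij}c_{ij}\big)$. **Algorithm $\mathcal A$.** Label the types $1,\dots,|R|$ so that their numbers of resources satisfy $m_1\le\dots\le m_{|R|}$. For $r=1,\dots,|R|$ let $E_r$ be the set of demands that require $r$ and none of $1,\dots,r-1$, and find an optimal solution of the one-type problem for type $r$ on $E_r$ without travel costs: a collection of paths $(s,d_1,\dots,d_q)$ with $q\ge1$, $s\in S^r$, all $d_i\in E_r$, $B_{sd_1}=1$ and $A_{d_id_{i+1}}=1$, such that no two paths share a demand and at most $l^r_s$ paths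 start at $s$, which maximizes the total reward of the demands on the paths. Among these $|R|$ solutions take one with the largest total reward (the last one, in case of ties). Output the solution in which exactly the demands on its paths are met, and every type $q$ follows these paths, skipping the demands that do not require $q$. **Theorem.** Consider the instances in which all resources, of all types, have the same starting location, and every travel cost is at most $\frac{1}{2|R|}\,w^{\min}$, where $w^{\min}=\min_{d\in D}w_d$. On these instances Algorithm $\mathcal A$ is a $2|R|$-approximation algorithm for $mRmDc$: every output of the algorithm is a feasible solution, its objective is at least $\frac1{2|R|}$ times the optimal objective, and the algorithm can be implemented to run in time polynomial in the size (binary encoding length) of the instance. Here running time is counted for programs over integer arrays with unit-cost addition, subtraction and comparison. -/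

import Mathlib

namespace MRMD

/-! ## Instances -/

/-- An instance of the heterogeneous multiple resource allocation problem with travel costs, with
demands `Fin n`, resource types `Fin k` and starting locations `Fin p`. A location is a starting
location (`Sum.inl s`) or the location of a demand (`Sum.inr d`). -/
structure Instance (n k p : ℕ) where
  /-- `startSet r` is the set `S^r` of starting locations of type `r`. -/
  startSet : Fin k → Finset (Fin p)
  /-- `count r s` is the number of resources of type `r` that start at `s`. -/
  count : Fin k → Fin p → ℕ
  /-- `req d` is the set `M_d` of resource types that demand `d` requires. -/
  req : Fin n → Finset (Fin k)
  /-- service start time -/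
  time : Fin n → ℤ
  /-- service duration -/
  dur : Fin n → ℕ
  /-- reward for meeting a demand -/
  reward : Fin n → ℤ
  /-- travel time from a location to the location of a demand -/
  travel : Fin p ⊕ Fin n → Fin n → ℕ
  /-- travel cost from a location to the location of a demand -/
  cost : Fin p ⊕ Fin n → Fin n → ℕ

variable {n k p : ℕ}

/-- `A_{ij} = 1`: demand `j` can be served by a resource immediately after demand `i`. -/
def Instance.Arc (I : Instance n k p) (i j : Fin n) : Prop :=
  I.time i + I.dur i + I.travel (Sum.inr i) j ≤ I.time j ∧ (I.req i ∩ I.req j).Nonempty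

/-- `B_{sd} = 1`, for type `r`: a resource of type `r` starting at `s` can serve `d` first. -/
def Instance.StartArc (I : Instance n k p) (r : Fin k) (s : Fin p) (d : Fin n) : Prop :=
  (I.travel (Sum.inl s) d : ℤ) ≤ I.time d ∧ s ∈ I.startSet r ∧ r ∈ I.req d

/-- The standing assumptions on instances: there is a resource type, every demand requires some
type, travel times satisfy the triangle inequality, and the digraph of arcs between demands is
acyclic. -/
structure Instance.Standing (I : Instance n k p) : Prop where
  types_pos : 0 < k
  req_nonempty : ∀ d, (I.req d).Nonempty
  triangle : ∀ x h d, I.travel x d ≤ I.travel x h + I.travel (Sum.inr h) d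
  acyclic : ∀ d, ¬ Relation.TransGen I.Arc d d

/-- All resources, of all types, have the same starting location. -/
def Instance.SameStart (I : Instance n k p) : Prop :=
  ∃ s, ∀ r, I.startSet r = {s}

/-- Every travel cost is at most `1 / (2|R|)` times the reward of every demand, that is, at most
`1 / (2|R|)` times the minimum reward. -/
def Instance.SmallCosts (I : Instance n k p) : Prop :=
  ∀ x d e, (I.cost x d : ℚ) ≤ 1 / (2 * k) * I.reward e

/-! ## The integer program with travel costs -/

/-- Values of the variables of the integer program. -/
structure Solution (n k p : ℕ) where
  /-- `y d`: demand `d` is satisfied -/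
  y : Fin n → ℤ
  /-- `xs r s d`: a resource of type `r` from `s` initially serves `d` -/
  xs : Fin k → Fin p → Fin n → ℤ
  /-- `x r i j`: a resource of type `r` serves `j` right after `i` -/
  x : Fin k → Fin n → Fin n → ℤ
  /-- `xt r d`: a resource of type `r` serves `d` last -/
  xt : Fin k → Fin n → ℤ

/-- The constraints of the integer program. All variables are binary, and variables whose index is
not in the domain of the program (missing arcs, types that are not required) are zero. -/
structure Instance.Feasible (I : Instance n k p) (z : Solution n k p) : Prop where
  supply : ∀ r, ∀ s ∈ I.startSet r, ∑ d, z.xs r s d ≤ I.count r s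
  conservation : ∀ i, ∀ r ∈ I.req i,
    ∑ s, z.xs r s i + ∑ h, z.x r h i = ∑ j, z.x r i j + z.xt r i
  service : ∀ i, ∀ r ∈ I.req i, z.y i ≤ ∑ s, z.xs r s i + ∑ h, z.x r h i
  y_binary : ∀ d, z.y d = 0 ∨ z.y d = 1
  xs_binary : ∀ r s d, z.xs r s d = 0 ∨ (z.xs r s d = 1 ∧ I.StartArc r s d)
  x_binary : ∀ r i j, z.x r i j = 0 ∨ (z.x r i j = 1 ∧ I.Arc i j ∧ r ∈ I.req i ∩ I.req j)
  xt_binary : ∀ r d, z.xt r d = 0 ∨ (z.xt r d = 1 ∧ r ∈ I.req d)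

/-- The objective: collected rewards minus travel costs. -/
def Instance.objective (I : Instance n k p) (z : Solution n k p) : ℤ :=
  ∑ d, z.y d * I.reward d -
    ∑ r, (∑ s, ∑ d, z.xs r s d * I.cost (Sum.inl s) d +
      ∑ i, ∑ j, z.x r i j * I.cost (Sum.inr i) j)

/-! ## Algorithm A -/

/-- A route of one resource: its starting location and the demands it serves, in order. -/
abbrev Route (n p : ℕ) := Fin p × List (Fin n)

/-- The demands served by a list of routes. -/
def served (W : List (Route n p)) : List (Fin n) := W.flatMap Prod.snd

/-- Feasible solutions of the one-type subproblem for type `r` and the demands `E` (all of which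
require `r`): paths from the starting locations, no two of which share a demand, at most
`count r s` of them from `s`. These are the path decompositions of the integral flows in the
minimum cost flow model of the subproblem, where each demand has capacity one and is met exactly if
it lies on a path. -/
structure Instance.RoutesFeasible (I : Instance n k p) (r : Fin k) (E : Finset (Fin n))
    (W : List (Route n p)) : Prop where
  stops_mem : ∀ d ∈ served W, d ∈ E
  first : ∀ ρ ∈ W, ∃ d, ρ.2.head? = some d ∧ I.StartArc r ρ.1 d
  chain : ∀ ρ ∈ W, ρ.2.IsChain I.Arc
  disjoint : (served W).Nodup
  supply : ∀ s, (W.map Prod.fst).count s ≤ I.count r s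

/-- The total reward of a list of routes; travel costs are ignored. -/
def Instance.routesValue (I : Instance n k p) (W : List (Route n p)) : ℤ :=
  ((served W).map I.reward).sum

/-- `W` is an optimal solution of the one-type subproblem. -/
def Instance.RoutesOptimal (I : Instance n k p) (r : Fin k) (E : Finset (Fin n))
    (W : List (Route n p)) : Prop :=
  I.RoutesFeasible r E W ∧ ∀ V, I.RoutesFeasible r E V → I.routesValue V ≤ I.routesValue W

/-- The number of resources of type `r`. -/
def Instance.numResources (I : Instance n k p) (r : Fin k) : ℕ :=
  ∑ s ∈ I.startSet r, I.count r s

/-- The demands of the subproblem of iteration `i`, when the types are processed in the order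
`σ 0, σ 1, …`: those that require type `σ i` and were not removed in an earlier iteration. -/
def Instance.remaining (I : Instance n k p) (σ : Equiv.Perm (Fin k)) (i : Fin k) :
    Finset (Fin n) :=
  Finset.univ.filter fun d => σ i ∈ I.req d ∧ ∀ j < i, σ j ∉ I.req d

/-- The part of a route that a resource of type `q` follows: it visits only the stops which
require `q`. -/
def Instance.restrict (I : Instance n k p) (q : Fin k) (ρ : Route n p) : List (Fin n) :=
  ρ.2.filter fun d => q ∈ I.req d

open Classical in
/-- The solution in which every demand on the routes `W` is met, and resources of every type that
is required by some stop follow the routes. -/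
noncomputable def Instance.follow (I : Instance n k p) (W : List (Route n p)) :
    Solution n k p where
  y d := if d ∈ served W then 1 else 0
  xs q s d := if ∃ ρ ∈ W, ρ.1 = s ∧ (I.restrict q ρ).head? = some d then 1 else 0
  x q i j := if ∃ ρ ∈ W, [i, j] <:+: I.restrict q ρ then 1 else 0
  xt q d := if ∃ ρ ∈ W, (I.restrict q ρ).getLast? = some d then 1 else 0

/-- `I.AlgorithmA z`: the solution `z` is a possible output of Algorithm A on `I`. The types are
sorted by their number of resources and processed in this order; iteration `i` solves the one-type
subproblem of type `σ i` on the remaining demands, and then removes all demands that require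
`σ i`. The best solution found (the last one, in case of ties) is used for all types. The order
among equal numbers of resources and the choice of optimal solutions are left open. -/
def Instance.AlgorithmA (I : Instance n k p) (z : Solution n k p) : Prop :=
  ∃ (σ : Equiv.Perm (Fin k)) (W : Fin k → List (Route n p)) (b : Fin k),
    (Monotone fun i => I.numResources (σ i)) ∧
    (∀ i, I.RoutesOptimal (σ i) (I.remaining σ i) (W i)) ∧
    (∀ i, I.routesValue (W i) ≤ I.routesValue (W b)) ∧
    (∀ i, b < i → I.routesValue (W i) < I.routesValue (W b)) ∧
    z = I.follow (W b)

/-! ## Machine model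

Random access programs over three-dimensional arrays of integers, with unit cost. The only
arithmetic operations are addition and subtraction, so that the bit length of the numbers grows by
at most a constant in each step, and polynomial time here is polynomial time on a Turing machine. -/

/-- The content of the memory: `s a i j l` is the entry `(i, j, l)` of array number `a`. -/
abbrev Store := ℕ → ℕ → ℕ → ℕ → ℤ

/-- Integer expressions. -/
inductive Expr where
  | const (c : ℤ)
  | read (a : ℕ) (e₁ e₂ e₃ : Expr)
  | add (e₁ e₂ : Expr)
  | sub (e₁ e₂ : Expr)

/-- The value of an expression; a negative array index is read as `0`. -/
def Expr.eval (s : Store) : Expr → ℤ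
  | const c => c
  | read a e₁ e₂ e₃ => s a (e₁.eval s).toNat (e₂.eval s).toNat (e₃.eval s).toNat
  | add e₁ e₂ => e₁.eval s + e₂.eval s
  | sub e₁ e₂ => e₁.eval s - e₂.eval s

/-- The number of steps for the evaluation of an expression. -/
def Expr.steps : Expr → ℕ
  | const _ => 1
  | read _ e₁ e₂ e₃ => e₁.steps + e₂.steps + e₃.steps + 1
  | add e₁ e₂ => e₁.steps + e₂.steps + 1
  | sub e₁ e₂ => e₁.steps + e₂.steps + 1

/-- Programs. `assign a e₁ e₂ e₃ e` stores the value of `e` in entry `(e₁, e₂, e₃)` of array `a`;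
`ifLe e₁ e₂ c₁ c₂` runs `c₁` if `e₁ ≤ e₂`, else `c₂`; `loop e c` evaluates `e` once and then runs
`c` as many times as this value says. -/
inductive Prog where
  | skip
  | assign (a : ℕ) (e₁ e₂ e₃ e : Expr)
  | seq (c₁ c₂ : Prog)
  | ifLe (e₁ e₂ : Expr) (c₁ c₂ : Prog)
  | loop (e : Expr) (c : Prog)

/-- Change one entry of the memory. -/
def Store.set (s : Store) (a i j l : ℕ) (v : ℤ) : Store :=
  fun a' i' j' l' => if a' = a ∧ i' = i ∧ j' = j ∧ l' = l then v else s a' i' j' l'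

/-- The memory after a run of the program, and the number of steps of the run. -/
def Prog.run : Prog → Store → Store × ℕ
  | skip, s => (s, 1)
  | assign a e₁ e₂ e₃ e, s =>
      (s.set a (e₁.eval s).toNat (e₂.eval s).toNat (e₃.eval s).toNat (e.eval s),
        e₁.steps + e₂.steps + e₃.steps + e.steps + 1)
  | seq c₁ c₂, s =>
      ((c₂.run (c₁.run s).1).1, (c₁.run s).2 + (c₂.run (c₁.run s).1).2 + 1)
  | ifLe e₁ e₂ c₁ c₂, s =>
      if e₁.eval s ≤ e₂.eval s then
        ((c₁.run s).1, e₁.steps + e₂.steps + (c₁.run s).2 + 1)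
      else
        ((c₂.run s).1, e₁.steps + e₂.steps + (c₂.run s).2 + 1)
  | loop e c, s =>
      (fun t : Store × ℕ => ((c.run t.1).1, t.2 + (c.run t.1).2 + 1))^[(e.eval s).toNat]
        (s, e.steps + 1)

/-! ## Input, output and input size -/

/-- A vector as an array, with zeros elsewhere. -/
def vecArray {a : ℕ} (v : Fin a → ℤ) : ℕ → ℕ → ℕ → ℤ :=
  fun i j l => if h : i < a ∧ j = 0 ∧ l = 0 then v ⟨i, h.1⟩ else 0

/-- A matrix as an array, with zeros elsewhere. -/
def matArray {a b : ℕ} (v : Fin a → Fin b → ℤ) : ℕ → ℕ → ℕ → ℤ :=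
  fun i j l => if h : i < a ∧ j < b ∧ l = 0 then v ⟨i, h.1⟩ ⟨j, h.2.1⟩ else 0

/-- The initial memory that holds the instance. -/
def Instance.encode (I : Instance n k p) : Store
  | 0 => vecArray ![(n : ℤ), (k : ℤ), (p : ℤ)]
  | 1 => matArray fun r s => if s ∈ I.startSet r then 1 else 0
  | 2 => matArray fun r s => (I.count r s : ℤ)
  | 3 => matArray fun d r => if r ∈ I.req d then 1 else 0
  | 4 => vecArray I.time
  | 5 => vecArray fun d => (I.dur d : ℤ)
  | 6 => vecArray I.reward
  | 7 => matArray fun s d => (I.travel (Sum.inl s) d : ℤ)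
  | 8 => matArray fun i j => (I.travel (Sum.inr i) j : ℤ)
  | 9 => matArray fun s d => (I.cost (Sum.inl s) d : ℤ)
  | 10 => matArray fun i j => (I.cost (Sum.inr i) j : ℤ)
  | _ => fun _ _ _ => 0

/-- The solution stored in arrays 11 to 14 of the memory. -/
def readSolution (n k p : ℕ) (s : Store) : Solution n k p where
  y d := s 11 d 0 0
  xs r u d := s 12 r u d
  x r i j := s 13 r i j
  xt r d := s 14 r d 0

/-- The length of the binary encoding of an integer, with a sign bit. -/
def bits (c : ℤ) : ℕ := c.natAbs.size + 1

/-- The size of an instance: the number of bits of a binary encoding. -/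
def Instance.size (I : Instance n k p) : ℕ :=
  n + k + p + ∑ r, ∑ s, (1 + bits (I.count r s)) + n * k +
    ∑ d, (bits (I.time d) + bits (I.dur d) + bits (I.reward d)) +
    ∑ x, ∑ d, (bits (I.travel x d) + bits (I.cost x d))

/-! ## Approximation algorithms -/

/-- An algorithm, given by the relation `A I z` that `z` is a possible output on the instance `I`,
is an `α`-approximation algorithm for the instances in the class `C`, where `α` may depend on the
number of resource types: every possible output on an instance in `C` is a feasible solution whose
objective is at least `1 / α` times the objective of every feasible solution (hence of an optimal
one), and the algorithm can be run in time polynomial in the size of the instance, that is, one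
program produces an output of the algorithm within such a number of steps on every instance
in `C`. -/
def IsApproxAlgorithm (C : ∀ {n k p : ℕ}, Instance n k p → Prop)
    (A : ∀ {n k p : ℕ}, Instance n k p → Solution n k p → Prop) (α : ℕ → ℚ) : Prop :=
  (∀ {n k p : ℕ} (I : Instance n k p), C I → ∀ z, A I z →
    I.Feasible z ∧ ∀ z', I.Feasible z' → 1 / α k * (I.objective z' : ℚ) ≤ I.objective z) ∧
  ∃ (P : Prog) (T : Polynomial ℕ), ∀ {n k p : ℕ} (I : Instance n k p), C I →
    A I (readSolution n k p (P.run I.encode).1) ∧ (P.run I.encode).2 ≤ T.eval I.size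

end MRMD

/-!
Every cost is at most `w^min / (2 k)`, and at most `k` resources, one per type, travel to a demand
that the output meets, so travelling costs the output at most half of its reward. On the other hand
every demand belongs to exactly one of the `k` sets `E_r`, so a best one-type problem collects at
least the fraction `1 / k` of the rewards of any feasible solution. Types with more resources can
follow routes of types with fewer resources because all resources start at the same place and
skipping demands is harmless by the triangle inequality.

With a single starting location `s` a one-type problem is an assignment problem. Take two copies of
the demands as nodes, the demands themselves and the terminals; a permutation of the nodes encodes
the routes that it traces from the terminals into the demands and back to a terminal, a fixed demand
being unmet. Giving fixed demand `d` the price `w_d` and forbidden moves a prohibitive price, the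
assignments of least price are the optimal collections of routes, because by Hall's theorem a set of
demands can be covered by `c` routes as soon as it contains no antichain of more than `c` demands,
as is true of the demands met by a flow of value `c`. The assignment problem is solved in
polynomial time by the Hungarian method, that is by successive shortest augmenting paths with dual
potentials. Following a permutation past the demands that do not require a type gives the output.
-/

namespace MRMD

variable {n k p : ℕ}

/-! ## The order on the demands -/

/-- The time condition of an arc, without the condition that `i` and `j` share a required type.
Unlike `Instance.Arc` it is transitive, which is why a resource may skip stops of a route. -/
def Instance.Prec (I : Instance n k p) (i j : Fin n) : Prop :=
  I.time i + I.dur i + I.travel (Sum.inr i) j ≤ I.time j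

/-- The time condition of a starting arc: a resource starting at `s` reaches `d` in time. -/
def Instance.Reach (I : Instance n k p) (s : Fin p) (d : Fin n) : Prop :=
  (I.travel (Sum.inl s) d : ℤ) ≤ I.time d

section Order

variable {I : Instance n k p}

theorem Instance.Arc.prec {i j : Fin n} (h : I.Arc i j) : I.Prec i j := h.1

theorem Instance.Prec.arc {i j : Fin n} (h : I.Prec i j) {r : Fin k} (hi : r ∈ I.req i)
    (hj : r ∈ I.req j) : I.Arc i j :=
  ⟨h, r, Finset.mem_inter.2 ⟨hi, hj⟩⟩

namespace Instance.Standing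

theorem isStrictOrder_prec (hI : I.Standing) : IsStrictOrder (Fin n) I.Prec where
  irrefl i h :=
    have ⟨_, hr⟩ := hI.req_nonempty i
    hI.acyclic i (.single (Instance.Prec.arc h hr hr))
  trans i j l hij hjl := by
    have := hI.triangle (Sum.inr i) j l
    unfold Instance.Prec at *
    omega

theorem prec_trans (hI : I.Standing) {i j l : Fin n} :
    I.Prec i j → I.Prec j l → I.Prec i l :=
  hI.isStrictOrder_prec.trans i j l

theorem prec_irrefl (hI : I.Standing) (i : Fin n) : ¬ I.Prec i i :=
  hI.isStrictOrder_prec.irrefl i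

theorem wellFounded_prec (hI : I.Standing) : WellFounded I.Prec :=
  have := hI.isStrictOrder_prec
  Finite.wellFounded_of_trans_of_irrefl I.Prec

theorem wellFounded_flip_prec (hI : I.Standing) : WellFounded fun i j => I.Prec j i :=
  have := hI.isStrictOrder_prec
  Finite.wellFounded_of_trans_of_irrefl (Function.swap I.Prec)

theorem reach_of_prec (hI : I.Standing) {s : Fin p} {i j : Fin n} (hi : I.Reach s i)
    (hij : I.Prec i j) : I.Reach s j := by
  have := hI.triangle (Sum.inl s) i j
  unfold Instance.Prec at hij
  unfold Instance.Reach at *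
  omega

theorem pairwise_prec (hI : I.Standing) {l : List (Fin n)} (hl : l.IsChain I.Prec) :
    l.Pairwise I.Prec :=
  have := hI.isStrictOrder_prec
  List.isChain_iff_pairwise.1 hl

end Instance.Standing

end Order

/-! ## Consecutive entries of lists without repetitions -/

section NodupLists

variable {α : Type*} {l₁ l₂ l₃ l₄ : List α} {a b : α}

theorem append_cons_inj_of_nodup (h : (l₁ ++ a :: l₂).Nodup) :
    l₃ ++ a :: l₄ = l₁ ++ a :: l₂ ↔ l₃ = l₁ ∧ l₄ = l₂ := by
  rw [List.nodup_middle, List.nodup_cons, List.mem_append, not_or] at h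
  rw [eq_comm, List.append_cons_inj_of_notMem h.1.1 h.1.2, eq_comm, eq_comm (a := l₂),
    eq_self_iff_true, true_and]

theorem pair_infix_iff_getLast? (h : (l₁ ++ a :: l₂).Nodup) :
    [b, a] <:+: l₁ ++ a :: l₂ ↔ l₁.getLast? = some b := by
  rw [List.getLast?_eq_some_iff]
  constructor
  · rintro ⟨u, v, huv⟩
    have : (u ++ [b]) ++ a :: v = l₁ ++ a :: l₂ := by simpa using huv
    exact ⟨u, ((append_cons_inj_of_nodup h).1 this).1.symm⟩
  · rintro ⟨u, rfl⟩
    exact ⟨u, l₂, by simp⟩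

theorem pair_infix_iff_head? (h : (l₁ ++ a :: l₂).Nodup) :
    [a, b] <:+: l₁ ++ a :: l₂ ↔ l₂.head? = some b := by
  rw [List.head?_eq_some_iff]
  constructor
  · rintro ⟨u, v, huv⟩
    have : u ++ a :: (b :: v) = l₁ ++ a :: l₂ := by simpa using huv
    exact ⟨v, ((append_cons_inj_of_nodup h).1 this).2.symm⟩
  · rintro ⟨v, rfl⟩
    exact ⟨l₁, v, by simp⟩

theorem head?_append_cons_eq_some_iff (h : (l₁ ++ a :: l₂).Nodup) :
    (l₁ ++ a :: l₂).head? = some a ↔ l₁ = [] := by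
  rw [List.head?_eq_some_iff]
  constructor
  · rintro ⟨t, ht⟩
    exact ((append_cons_inj_of_nodup (l₃ := []) h).1 ht.symm).1.symm
  · rintro rfl
    exact ⟨l₂, rfl⟩

theorem getLast?_append_cons_eq_some_iff (h : (l₁ ++ a :: l₂).Nodup) :
    (l₁ ++ a :: l₂).getLast? = some a ↔ l₂ = [] := by
  rw [List.getLast?_eq_some_iff]
  constructor
  · rintro ⟨t, ht⟩
    exact ((append_cons_inj_of_nodup h).1 ht.symm).2.symm
  · rintro rfl
    exact ⟨l₁, rfl⟩

end NodupLists

/-! ## Routes -/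

section Routes

variable {I : Instance n k p} {W : List (Route n p)} {r q : Fin k} {E : Finset (Fin n)}
  {ρ : Route n p} {d : Fin n}

theorem mem_served : d ∈ served W ↔ ∃ ρ ∈ W, d ∈ ρ.2 := by
  simp [served]

theorem mem_restrict : d ∈ I.restrict q ρ ↔ d ∈ ρ.2 ∧ q ∈ I.req d := by
  simp [Instance.restrict]

theorem eq_of_mem_routes (hW : (served W).Nodup) {ρ' : Route n p} (hρ : ρ ∈ W) (hρ' : ρ' ∈ W)
    (hd : d ∈ ρ.2) (hd' : d ∈ ρ'.2) : ρ = ρ' := by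
  by_contra hne
  have hsymm : Std.Symm (Function.onFun List.Disjoint (Prod.snd : Route n p → List (Fin n))) :=
    ⟨fun _ _ h => List.Disjoint.symm h⟩
  exact (List.nodup_flatMap.1 hW).2.forall hρ hρ' hne hd hd'

theorem nodup_restrict (hW : (served W).Nodup) (hρ : ρ ∈ W) (q : Fin k) :
    (I.restrict q ρ).Nodup :=
  ((List.nodup_flatMap.1 hW).1 ρ hρ).filter _

theorem card_le_count_starts {s : Fin p} {X : Finset (Fin n)} (f : Route n p → Option (Fin n))
    (hX : ∀ d ∈ X, ∃ ρ ∈ W, ρ.1 = s ∧ f ρ = some d) : X.card ≤ (W.map Prod.fst).count s := by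
  have hsub : X ⊆ ((W.filter (·.1 = s)).filterMap f).toFinset := fun d hd => by
    simpa [and_assoc] using hX d hd
  calc X.card ≤ ((W.filter (·.1 = s)).filterMap f).length :=
        (Finset.card_le_card hsub).trans (List.toFinset_card_le _)
    _ ≤ (W.filter (·.1 = s)).length := List.length_filterMap_le _ _
    _ = (W.map Prod.fst).count s := by
        rw [List.count, List.countP_map, List.countP_eq_length_filter]
        rfl

theorem Instance.RoutesFeasible.pairwise_prec (hI : I.Standing) (hW : I.RoutesFeasible r E W)
    (hρ : ρ ∈ W) : ρ.2.Pairwise I.Prec :=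
  hI.pairwise_prec ((hW.chain ρ hρ).imp fun _ _ => Instance.Arc.prec)

theorem Instance.RoutesFeasible.start_mem (hW : I.RoutesFeasible r E W) (hρ : ρ ∈ W) :
    ρ.1 ∈ I.startSet r :=
  have ⟨_, _, h⟩ := hW.first ρ hρ
  h.2.1

theorem Instance.RoutesFeasible.reach (hI : I.Standing) (hW : I.RoutesFeasible r E W)
    (hρ : ρ ∈ W) (hd : d ∈ ρ.2) : I.Reach ρ.1 d := by
  obtain ⟨e, he, hs⟩ := hW.first ρ hρ
  obtain ⟨l, hl⟩ := List.head?_eq_some_iff.1 he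
  have hprec := hW.pairwise_prec hI hρ
  rw [hl] at hprec hd
  rcases List.mem_cons.1 hd with rfl | hd
  · exact hs.1
  · exact hI.reach_of_prec hs.1 (List.rel_of_pairwise_cons hprec hd)

theorem routesValue_eq_sum_toFinset (hW : (served W).Nodup) :
    I.routesValue W = ∑ d ∈ (served W).toFinset, I.reward d :=
  (List.sum_toFinset I.reward hW).symm

end Routes

/-! ## Flows of solutions -/

/-- The number of resources of type `r` that enter `d`. -/
def Solution.inflow (z : Solution n k p) (r : Fin k) (d : Fin n) : ℤ :=
  ∑ s, z.xs r s d + ∑ h, z.x r h d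

/-- The number of resources of type `r` that leave `d`, including those that serve it last. -/
def Solution.outflow (z : Solution n k p) (r : Fin k) (d : Fin n) : ℤ :=
  ∑ j, z.x r d j + z.xt r d

namespace Instance.Feasible

variable {I : Instance n k p} {z : Solution n k p} {r : Fin k} {s : Fin p}

theorem inflow_eq_outflow (hz : I.Feasible z) {d : Fin n} (hr : r ∈ I.req d) :
    z.inflow r d = z.outflow r d :=
  hz.conservation d r hr

theorem xs_nonneg (hz : I.Feasible z) (r : Fin k) (s : Fin p) (d : Fin n) : 0 ≤ z.xs r s d := by
  rcases hz.xs_binary r s d with h | h <;> omega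

theorem x_nonneg (hz : I.Feasible z) (r : Fin k) (i j : Fin n) : 0 ≤ z.x r i j := by
  rcases hz.x_binary r i j with h | h <;> omega

theorem xt_nonneg (hz : I.Feasible z) (r : Fin k) (d : Fin n) : 0 ≤ z.xt r d := by
  rcases hz.xt_binary r d with h | h <;> omega

theorem sum_x_le_outflow (hz : I.Feasible z) (X : Finset (Fin n)) (d : Fin n) :
    ∑ j ∈ X, z.x r d j ≤ z.outflow r d := by
  have := Finset.sum_le_sum_of_subset_of_nonneg (f := z.x r d) X.subset_univ
    fun j _ _ => hz.x_nonneg r d j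
  have := hz.xt_nonneg r d
  unfold Solution.outflow
  omega

theorem inflow_eq_of_startSet (hz : I.Feasible z) (hs : I.startSet r = {s}) (d : Fin n) :
    z.inflow r d = z.xs r s d + ∑ h, z.x r h d := by
  rw [Solution.inflow, Finset.sum_eq_single s _ (by simp)]
  intro s' _ hne
  refine (hz.xs_binary r s' d).resolve_right fun h => hne ?_
  simpa [hs] using h.2.2.1

/-- Cut the flow of type `r` along the set `L` of demands that precede a member of `X`: everything
that enters `X ∪ L` comes from the start or from `L`. -/
theorem card_le_count_of_antichain (hI : I.Standing) (hz : I.Feasible z)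
    (hs : I.startSet r = {s}) {X : Finset (Fin n)} (hX : ∀ d ∈ X, ∀ e ∈ X, ¬ I.Prec d e)
    (hflow : ∀ d ∈ X, 1 ≤ z.inflow r d) : X.card ≤ I.count r s := by
  classical
  let L : Finset (Fin n) := Finset.univ.filter fun v => r ∈ I.req v ∧ ∃ x ∈ X, I.Prec v x
  have mem_L {v : Fin n} : v ∈ L ↔ r ∈ I.req v ∧ ∃ x ∈ X, I.Prec v x := by simp [L]
  have hdisj : Disjoint X L := Finset.disjoint_left.2 fun d hd hdL =>
    have ⟨_, x, hx, h⟩ := mem_L.1 hdL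
    hX d hd x hx h
  have inflow_eq : ∀ v ∈ X ∪ L, z.inflow r v = z.xs r s v + ∑ h ∈ L, z.x r h v := by
    intro v hv
    rw [hz.inflow_eq_of_startSet hs, ← Finset.sum_subset L.subset_univ]
    intro h _ hh
    refine (hz.x_binary r h v).resolve_right fun ⟨_, harc, hr⟩ => hh (mem_L.2 ⟨?_, ?_⟩)
    · exact (Finset.mem_inter.1 hr).1
    · rcases Finset.mem_union.1 hv with hv | hv
      · exact ⟨v, hv, harc.prec⟩
      · obtain ⟨-, x, hx, hvx⟩ := mem_L.1 hv
        exact ⟨x, hx, hI.prec_trans harc.prec hvx⟩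
  have hcut : ∑ v ∈ X ∪ L, ∑ h ∈ L, z.x r h v ≤ ∑ h ∈ L, z.inflow r h := by
    rw [Finset.sum_comm]
    refine Finset.sum_le_sum fun h hh => ?_
    rw [hz.inflow_eq_outflow (mem_L.1 hh).1]
    exact hz.sum_x_le_outflow _ _
  have hsupply : ∑ v ∈ X ∪ L, z.xs r s v ≤ I.count r s :=
    (Finset.sum_le_sum_of_subset_of_nonneg (Finset.subset_univ _)
      fun v _ _ => hz.xs_nonneg r s v).trans (hz.supply r s (by simp [hs]))
  have htotal := Finset.sum_congr rfl inflow_eq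
  rw [Finset.sum_add_distrib, Finset.sum_union hdisj] at htotal
  have hcard : (X.card : ℤ) ≤ ∑ h ∈ X, z.inflow r h := by simpa using Finset.sum_le_sum hflow
  omega

theorem reach_of_inflow (hI : I.Standing) (hz : I.Feasible z) (hs : I.startSet r = {s})
    {d : Fin n} : 1 ≤ z.inflow r d → I.Reach s d := by
  induction d using hI.wellFounded_prec.induction with
  | _ d ih =>
    intro hd
    rw [hz.inflow_eq_of_startSet hs] at hd
    rcases hz.xs_binary r s d with h0 | ⟨-, h, -⟩
    · obtain ⟨h, -, hh⟩ := Finset.exists_ne_zero_of_sum_ne_zero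
        (f := fun h => z.x r h d) (s := Finset.univ) (by omega)
      obtain ⟨h1, harc, hr⟩ := (hz.x_binary r h d).resolve_left hh
      refine hI.reach_of_prec (ih h harc.prec ?_) harc.prec
      rw [hz.inflow_eq_outflow (Finset.mem_inter.1 hr).1]
      simpa [h1] using hz.sum_x_le_outflow (r := r) {d} h
    · exact h

end Instance.Feasible

/-! ## The solution that follows given routes -/

section Follow

variable {I : Instance n k p} {W : List (Route n p)} {q : Fin k} {i d : Fin n} {ρ : Route n p}
  {l₁ l₂ : List (Fin n)}

theorem exists_route_iff_of_mem_restrict (hW : (served W).Nodup) (hρ : ρ ∈ W)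
    (hi : i ∈ I.restrict q ρ) {P : Route n p → Prop} (hP : ∀ ρ', P ρ' → i ∈ I.restrict q ρ') :
    (∃ ρ' ∈ W, P ρ') ↔ P ρ := by
  refine ⟨fun ⟨ρ', hρ', h⟩ => ?_, fun h => ⟨ρ, hρ, h⟩⟩
  rwa [eq_of_mem_routes hW hρ hρ' (mem_restrict.1 hi).1 (mem_restrict.1 (hP _ h)).1]

theorem follow_eq_of_restrict_eq (hW : (served W).Nodup) (hρ : ρ ∈ W)
    (hl : I.restrict q ρ = l₁ ++ i :: l₂) :
    (∀ s, (I.follow W).xs q s i = if ρ.1 = s ∧ l₁ = [] then 1 else 0) ∧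
    (∀ h, (I.follow W).x q h i = if l₁.getLast? = some h then 1 else 0) ∧
    (∀ j, (I.follow W).x q i j = if l₂.head? = some j then 1 else 0) ∧
    (I.follow W).xt q i = if l₂ = [] then 1 else 0 := by
  have hnodup : (l₁ ++ i :: l₂).Nodup := hl ▸ nodup_restrict hW hρ q
  have hi : i ∈ I.restrict q ρ := by simp [hl]
  refine ⟨fun s => if_congr ?_ rfl rfl, fun h => if_congr ?_ rfl rfl,
    fun j => if_congr ?_ rfl rfl, if_congr ?_ rfl rfl⟩
  · rw [exists_route_iff_of_mem_restrict hW hρ hi fun _ h => List.mem_of_mem_head? h.2, hl,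
      head?_append_cons_eq_some_iff hnodup]
  · rw [exists_route_iff_of_mem_restrict hW hρ hi fun _ h => h.subset (by simp), hl,
      pair_infix_iff_getLast? hnodup]
  · rw [exists_route_iff_of_mem_restrict hW hρ hi fun _ h => h.subset (by simp), hl,
      pair_infix_iff_head? hnodup]
  · rw [exists_route_iff_of_mem_restrict hW hρ hi fun _ h => List.mem_of_getLast? h, hl,
      getLast?_append_cons_eq_some_iff hnodup]

theorem follow_eq_zero_of_not_served (hi : ¬ (i ∈ served W ∧ q ∈ I.req i)) :
    (∀ s, (I.follow W).xs q s i = 0) ∧ (∀ h, (I.follow W).x q h i = 0) ∧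
    (∀ j, (I.follow W).x q i j = 0) ∧ (I.follow W).xt q i = 0 := by
  have hnot : ∀ ρ ∈ W, i ∉ I.restrict q ρ := fun ρ hρ hm =>
    hi ⟨mem_served.2 ⟨ρ, hρ, (mem_restrict.1 hm).1⟩, (mem_restrict.1 hm).2⟩
  refine ⟨fun s => if_neg ?_, fun h => if_neg ?_, fun j => if_neg ?_, if_neg ?_⟩ <;>
    rintro ⟨ρ, hρ, h⟩
  · exact hnot ρ hρ (List.mem_of_mem_head? h.2)
  · exact hnot ρ hρ (h.subset (by simp))
  · exact hnot ρ hρ (h.subset (by simp))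
  · exact hnot ρ hρ (List.mem_of_getLast? h)

open Classical in
theorem follow_inflow_outflow (hW : (served W).Nodup) (q : Fin k) (i : Fin n) :
    (I.follow W).inflow q i = (if i ∈ served W ∧ q ∈ I.req i then 1 else 0) ∧
    (I.follow W).outflow q i = (if i ∈ served W ∧ q ∈ I.req i then 1 else 0) := by
  unfold Solution.inflow Solution.outflow
  split_ifs with hi
  · obtain ⟨ρ, hρ, hiρ⟩ := mem_served.1 hi.1
    obtain ⟨l₁, l₂, hl⟩ := List.append_of_mem (mem_restrict.2 ⟨hiρ, hi.2⟩)
    obtain ⟨hxs, hx_in, hx_out, hxt⟩ := follow_eq_of_restrict_eq hW hρ hl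
    simp only [hxs, hx_in, hx_out, hxt]
    constructor
    · rcases List.eq_nil_or_concat l₁ with rfl | ⟨l, a, rfl⟩ <;> simp
    · cases l₂ <;> simp
  · obtain ⟨hxs, hx_in, hx_out, hxt⟩ := follow_eq_zero_of_not_served hi
    simp [hxs, hx_in, hx_out, hxt]

open Classical in
theorem follow_y : (I.follow W).y d = if d ∈ served W then 1 else 0 := rfl

theorem follow_inflow_le_y (hW : (served W).Nodup) (q : Fin k) (d : Fin n) :
    (I.follow W).inflow q d ≤ (I.follow W).y d := by
  rw [(follow_inflow_outflow hW q d).1, follow_y]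
  split_ifs <;> simp_all

theorem sum_follow_xs_le_count (I : Instance n k p) (W : List (Route n p)) (q : Fin k)
    (s : Fin p) : ∑ d, (I.follow W).xs q s d ≤ (W.map Prod.fst).count s := by
  classical
  rw [show ∑ d, (I.follow W).xs q s d = _ from Finset.sum_boole _ _]
  exact_mod_cast card_le_count_starts (fun ρ => (I.restrict q ρ).head?)
    fun d hd => (Finset.mem_filter.1 hd).2

theorem follow_supply {s : Fin p} {r : Fin k} {E : Finset (Fin n)}
    (hW : I.RoutesFeasible r E W)
    (hcount : ∀ q, ∀ d ∈ E, q ∈ I.req d → I.count r s ≤ I.count q s) (q : Fin k) :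
    ∑ d, (I.follow W).xs q s d ≤ I.count q s := by
  by_cases h : ∃ d ∈ served W, q ∈ I.req d
  · obtain ⟨d, hd, hq⟩ := h
    exact (sum_follow_xs_le_count I W q s).trans
      (mod_cast (hW.supply s).trans (hcount q d (hW.stops_mem d hd) hq))
  · push Not at h
    rw [Finset.sum_eq_zero fun d _ =>
      (follow_eq_zero_of_not_served fun hd => h d hd.1 hd.2).1 s]
    positivity

theorem follow_feasible (hI : I.Standing) {s : Fin p} (hs : ∀ r, I.startSet r = {s}) {r : Fin k}
    {E : Finset (Fin n)} (hW : I.RoutesFeasible r E W)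
    (hcount : ∀ q, ∀ d ∈ E, q ∈ I.req d → I.count r s ≤ I.count q s) :
    I.Feasible (I.follow W) where
  supply q s' hs' := by
    obtain rfl : s' = s := by simpa [hs] using hs'
    exact follow_supply hW hcount q
  conservation d q _ :=
    have ⟨hin, hout⟩ := follow_inflow_outflow hW.disjoint q d
    hin.trans hout.symm
  service d q hq := by
    change _ ≤ (I.follow W).inflow q d
    rw [(follow_inflow_outflow hW.disjoint q d).1, follow_y]
    simp [hq]
  y_binary d := (ite_eq_or_eq _ _ _).symm
  xs_binary q s' d := by
    refine (ite_eq_or_eq _ _ _).symm.imp_right fun h => ⟨h, ?_⟩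
    obtain ⟨ρ, hρ, rfl, hhead⟩ := of_not_not fun hn => one_ne_zero (h.symm.trans (if_neg hn))
    have hd := mem_restrict.1 (List.mem_of_mem_head? hhead)
    have hstart := hW.start_mem hρ
    rw [hs] at hstart
    exact ⟨hW.reach hI hρ hd.1, by rwa [hs], hd.2⟩
  x_binary q i j := by
    refine (ite_eq_or_eq _ _ _).symm.imp_right fun h => ⟨h, ?_⟩
    obtain ⟨ρ, hρ, hij⟩ := of_not_not fun hn => one_ne_zero (h.symm.trans (if_neg hn))
    have hi := (mem_restrict.1 (hij.subset (by simp : i ∈ [i, j]))).2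
    have hj := (mem_restrict.1 (hij.subset (by simp : j ∈ [i, j]))).2
    have hprec : [i, j].Pairwise I.Prec :=
      (hW.pairwise_prec hI hρ).sublist (hij.sublist.trans List.filter_sublist)
    exact ⟨(List.pairwise_pair.1 hprec).arc hi hj, Finset.mem_inter.2 ⟨hi, hj⟩⟩
  xt_binary q d := by
    refine (ite_eq_or_eq _ _ _).symm.imp_right fun h => ⟨h, ?_⟩
    obtain ⟨ρ, _, hlast⟩ := of_not_not fun hn => one_ne_zero (h.symm.trans (if_neg hn))
    exact (mem_restrict.1 (List.mem_of_getLast? hlast)).2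

theorem routesValue_eq_sum_follow_y (hW : (served W).Nodup) :
    I.routesValue W = ∑ d, (I.follow W).y d * I.reward d := by
  classical
  simp only [routesValue_eq_sum_toFinset hW, follow_y, ite_mul, one_mul, zero_mul,
    ← Finset.sum_filter]
  exact Finset.sum_congr (by ext; simp) fun _ _ => rfl

theorem Instance.SmallCosts.two_mul_card_mul_cost_le (hC : I.SmallCosts) (hk : 0 < k)
    (x : Fin p ⊕ Fin n) (d e : Fin n) : 2 * (k : ℤ) * I.cost x d ≤ I.reward e := by
  have h := hC x d e
  have hk' : (0 : ℚ) < 2 * k := by positivity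
  rw [one_div_mul_eq_div, le_div_iff₀' hk'] at h
  exact_mod_cast h

theorem Instance.SmallCosts.reward_nonneg (hC : I.SmallCosts) (hk : 0 < k) (e : Fin n) :
    0 ≤ I.reward e :=
  le_trans (by positivity) (hC.two_mul_card_mul_cost_le hk (Sum.inr e) e e)

/-- The travel costs of type `r`, charged to the demands at which the arcs end. -/
def Instance.arrivalCost (I : Instance n k p) (z : Solution n k p) (r : Fin k) (d : Fin n) : ℤ :=
  ∑ s, z.xs r s d * I.cost (Sum.inl s) d + ∑ i, z.x r i d * I.cost (Sum.inr i) d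

theorem Instance.objective_eq_sub_sum_arrivalCost (I : Instance n k p) (z : Solution n k p) :
    I.objective z = ∑ d, z.y d * I.reward d - ∑ r, ∑ d, I.arrivalCost z r d := by
  unfold Instance.objective
  congr! 2 with r
  rw [Finset.sum_comm, Finset.sum_comm (f := fun i j => z.x r i j * (I.cost (Sum.inr i) j : ℤ)),
    ← Finset.sum_add_distrib]
  rfl

theorem Instance.Feasible.arrivalCost_nonneg {z : Solution n k p} (hz : I.Feasible z) (r : Fin k)
    (d : Fin n) : 0 ≤ I.arrivalCost z r d :=
  add_nonneg
    (Finset.sum_nonneg fun s _ => mul_nonneg (hz.xs_nonneg r s d) (Int.natCast_nonneg _))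
    (Finset.sum_nonneg fun i _ => mul_nonneg (hz.x_nonneg r i d) (Int.natCast_nonneg _))

theorem Instance.SmallCosts.two_mul_card_mul_arrivalCost_le (hC : I.SmallCosts) (hk : 0 < k)
    {z : Solution n k p} (hz : I.Feasible z) (r : Fin k) (d : Fin n) :
    2 * (k : ℤ) * I.arrivalCost z r d ≤ z.inflow r d * I.reward d := by
  have hle (x : Fin p ⊕ Fin n) {a : ℤ} (ha : 0 ≤ a) :
      2 * (k : ℤ) * (a * I.cost x d) ≤ a * I.reward d := by
    rw [mul_left_comm]
    exact mul_le_mul_of_nonneg_left (hC.two_mul_card_mul_cost_le hk x d d) ha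
  rw [Instance.arrivalCost, Solution.inflow, mul_add, add_mul, Finset.mul_sum, Finset.mul_sum,
    Finset.sum_mul, Finset.sum_mul]
  exact add_le_add (Finset.sum_le_sum fun s _ => hle _ (hz.xs_nonneg r s d))
    (Finset.sum_le_sum fun i _ => hle _ (hz.x_nonneg r i d))

/-- Each of the `k` types enters a served demand at most once, and an unserved one not at all. -/
theorem routesValue_le_two_mul_objective_follow (hk : 0 < k) (hC : I.SmallCosts)
    (hW : (served W).Nodup) (hz : I.Feasible (I.follow W)) :
    I.routesValue W ≤ 2 * I.objective (I.follow W) := by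
  have hbound : 2 * (k : ℤ) * ∑ r, ∑ d, I.arrivalCost (I.follow W) r d ≤ k * I.routesValue W :=
    calc 2 * (k : ℤ) * ∑ r, ∑ d, I.arrivalCost (I.follow W) r d
        = ∑ r : Fin k, ∑ d, 2 * (k : ℤ) * I.arrivalCost (I.follow W) r d := by
          simp only [Finset.mul_sum]
      _ ≤ ∑ _r : Fin k, ∑ d, (I.follow W).y d * I.reward d := by
          refine Finset.sum_le_sum fun r _ => Finset.sum_le_sum fun d _ => ?_
          refine (hC.two_mul_card_mul_arrivalCost_le hk hz r d).trans ?_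
          exact mul_le_mul_of_nonneg_right (follow_inflow_le_y hW r d) (hC.reward_nonneg hk d)
      _ = k * I.routesValue W := by simp [routesValue_eq_sum_follow_y hW]
  have hhalf : 2 * ∑ r, ∑ d, I.arrivalCost (I.follow W) r d ≤ I.routesValue W := by
    rw [mul_comm 2 (k : ℤ), mul_assoc] at hbound
    exact le_of_mul_le_mul_left hbound (mod_cast hk)
  rw [I.objective_eq_sub_sum_arrivalCost, ← routesValue_eq_sum_follow_y hW]
  linarith

end Follow

/-! ## Permutations and antichains -/

section Antichains

theorem exists_perm_extending {ι γ : Type*} {S : Finset γ}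
    {f g : ι → γ} (hf : f.Injective) (hg : g.Injective) (hfS : ∀ i, f i ∈ S)
    (hgS : ∀ i, g i ∈ S) :
    ∃ π : Equiv.Perm γ, (∀ i, π (f i) = g i) ∧ ∀ x ∉ S, π x = x := by
  classical
  let f' (i : ι) : {x // x ∈ S} := ⟨f i, hfS i⟩
  let g' (i : ι) : {x // x ∈ S} := ⟨g i, hgS i⟩
  have hf' : f'.Injective := fun i j h => hf (congrArg Subtype.val h)
  have hg' : g'.Injective := fun i j h => hg (congrArg Subtype.val h)
  let e : {x // x ∈ Set.range f'} ≃ {x // x ∈ Set.range g'} :=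
    (Equiv.ofInjective f' hf').symm.trans (Equiv.ofInjective g' hg')
  have he (i : ι) : e.extendSubtype (f' i) = g' i := by
    rw [Equiv.extendSubtype_apply_of_mem _ _ ⟨i, rfl⟩]
    exact congrArg (Subtype.val ∘ Equiv.ofInjective g' hg') (Equiv.ofInjective_symm_apply hf' i)
  refine ⟨Equiv.Perm.ofSubtype e.extendSubtype, fun i => ?_, fun x hx =>
    Equiv.Perm.ofSubtype_apply_of_not_mem _ hx⟩
  exact (Equiv.Perm.ofSubtype_apply_of_mem _ (hfS i)).trans (congrArg Subtype.val (he i))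

open Classical in
/-- Hall's condition holds for a set `B` of vertices: the members of `B` without a predecessor
in `B` form an antichain, and the others are successors. -/
theorem exists_injective_successor {α β : Type*} {R : α → α → Prop} {Y : Finset α} {T : Finset β}
    (hY : ∀ X ⊆ Y, (∀ d ∈ X, ∀ e ∈ X, ¬ R d e) → X.card ≤ T.card) :
    ∃ g : Y → α ⊕ β, g.Injective ∧ ∀ y : Y, g y ∈ (Y.filter (R y)).disjSum T := by
  refine (Finset.all_card_le_biUnion_card_iff_exists_injective _).1 fun A => ?_
  rcases A.eq_empty_or_nonempty with rfl | ⟨a₀, ha₀⟩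
  · simp
  let B : Finset α := A.map (Function.Embedding.subtype _)
  let N : Finset α := Y.filter fun e => ∃ a ∈ B, R a e
  have hBY : B ⊆ Y := fun b hb => by
    obtain ⟨y, -, rfl⟩ := Finset.mem_map.1 hb
    exact y.2
  have hminimal : (B \ N).card ≤ T.card :=
    hY _ (Finset.sdiff_subset.trans hBY) fun d hd e he hde =>
      (Finset.mem_sdiff.1 he).2 (Finset.mem_filter.2
        ⟨hBY (Finset.mem_sdiff.1 he).1, d, (Finset.mem_sdiff.1 hd).1, hde⟩)
  have hsub : N.disjSum T ⊆ A.biUnion fun y : Y => (Y.filter (R y)).disjSum T := by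
    intro x hx
    rw [Finset.mem_biUnion]
    rcases Finset.mem_disjSum.1 hx with ⟨e, he, rfl⟩ | ⟨a, ha, rfl⟩
    · obtain ⟨heY, b, hb, hbe⟩ := Finset.mem_filter.1 he
      obtain ⟨y, hy, rfl⟩ := Finset.mem_map.1 hb
      exact ⟨y, hy, Finset.inl_mem_disjSum.2 (Finset.mem_filter.2 ⟨heY, hbe⟩)⟩
    · exact ⟨a₀, ha₀, Finset.inr_mem_disjSum.2 ha⟩
  calc A.card = B.card := (Finset.card_map _).symm
    _ ≤ N.card + (B \ N).card := by
        rw [add_comm]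
        exact Nat.le_add_of_sub_le (Finset.le_card_sdiff N B)
    _ ≤ N.card + T.card := by gcongr
    _ = (N.disjSum T).card := (Finset.card_disjSum _ _).symm
    _ ≤ _ := Finset.card_le_card hsub

end Antichains

/-! ## Routings -/

/-- A permutation `π` of `n` demands (`Sum.inl`) and `n` terminals (`Sum.inr`) that describes at
most `c` routes from `s` on demands of `E`; this turns the one-type problem into an assignment
problem. A served demand is sent to the next stop of its route, or to a terminal if it is the last
stop; the first stops are the images of the first `c` terminals; all other demands are fixed. -/
structure Instance.Routing (I : Instance n k p) (s : Fin p) (E : Finset (Fin n)) (c : ℕ)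
    (π : Equiv.Perm (Fin n ⊕ Fin n)) : Prop where
  step : ∀ d e, π (Sum.inl d) = Sum.inl e → d ≠ e → I.Prec d e
  start : ∀ a e, π (Sum.inr a) = Sum.inl e → (a : ℕ) < c
  moved : ∀ d, π (Sum.inl d) ≠ Sum.inl d → d ∈ E ∧ I.Reach s d

theorem exists_routing {I : Instance n k p} (hI : I.Standing) {s : Fin p} {E : Finset (Fin n)}
    {c : ℕ} {Y : Finset (Fin n)} (hE : ∀ d ∈ Y, d ∈ E ∧ I.Reach s d)
    (hY : ∀ X ⊆ Y, (∀ d ∈ X, ∀ e ∈ X, ¬ I.Prec d e) → X.card ≤ c) :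
    ∃ π, I.Routing s E c π ∧ ∀ d, π (Sum.inl d) ≠ Sum.inl d ↔ d ∈ Y := by
  classical
  let T : Finset (Fin n) := Finset.univ.filter fun a => (a : ℕ) < c
  have hT (X : Finset (Fin n)) (hX : X ⊆ Y) (hanti : ∀ d ∈ X, ∀ e ∈ X, ¬ I.Prec d e) :
      X.card ≤ T.card := by
    rw [Fin.card_filter_val_lt]
    exact le_min (by simpa using X.card_le_univ) (hY X hX hanti)
  obtain ⟨g, hg, hgT⟩ := exists_injective_successor hT
  obtain ⟨π, hπ, hfix⟩ := exists_perm_extending (S := Y.disjSum T)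
    (f := fun y : Y => Sum.inl y.1) (Sum.inl_injective.comp Subtype.val_injective) hg
    (fun y => Finset.inl_mem_disjSum.2 y.2)
    fun y => Finset.disjSum_mono (Y.filter_subset _) subset_rfl (hgT y)
  have hstep (d e : Fin n) (hd : d ∈ Y) (h : π (Sum.inl d) = Sum.inl e) : I.Prec d e := by
    have := hgT ⟨d, hd⟩
    rw [← hπ ⟨d, hd⟩, h] at this
    exact (Finset.mem_filter.1 (Finset.inl_mem_disjSum.1 this)).2
  have hmoved (d : Fin n) : π (Sum.inl d) ≠ Sum.inl d ↔ d ∈ Y := by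
    refine ⟨fun hd => of_not_not fun hdY => hd (hfix _ ?_), fun hd h =>
      hI.prec_irrefl d (hstep d d hd h)⟩
    rwa [Finset.inl_mem_disjSum]
  refine ⟨π, ⟨fun d e h hne => ?_, fun a e h => ?_, fun d hd => hE d ((hmoved d).1 hd)⟩, hmoved⟩
  · refine hstep d e ((hmoved d).1 ?_) h
    rw [h]
    exact fun h' => hne (Sum.inl.inj h').symm
  · by_contra hac
    have : π (Sum.inr a) = Sum.inr a :=
      hfix _ (by simpa [T, Finset.inr_mem_disjSum] using hac)
    simp [h] at this

/-! ## Trails -/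

/-- The list `l` collects the left values met when `f` is iterated from `x` until a right value is
reached. -/
inductive IsTrail {α β : Type*} (f : α ⊕ β → α ⊕ β) : α ⊕ β → List α → Prop
  | nil (b : β) : IsTrail f (Sum.inr b) []
  | cons {a : α} {l : List α} : IsTrail f (f (Sum.inl a)) l → IsTrail f (Sum.inl a) (a :: l)

namespace IsTrail

variable {α β : Type*} {f : α ⊕ β → α ⊕ β} {x : α ⊕ β} {l l' : List α} {a : α}

theorem unique (h : IsTrail f x l) (h' : IsTrail f x l') : l = l' := by
  induction h generalizing l' with
  | nil b => cases h'; rfl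
  | cons _ ih =>
    cases h' with
    | cons h' => rw [ih h']

theorem head?_eq (h : IsTrail f x l) : l.head? = x.getLeft? := by
  cases h <;> rfl

theorem exists_eq_append (h : IsTrail f x l) (ha : a ∈ l) :
    ∃ l₁ l₂, l = l₁ ++ a :: l₂ ∧ IsTrail f (f (Sum.inl a)) l₂ := by
  induction h with
  | nil _ => cases ha
  | @cons b l h ih =>
    rcases List.mem_cons.1 ha with rfl | ha
    · exact ⟨[], l, rfl, h⟩
    · obtain ⟨l₁, l₂, rfl, h₂⟩ := ih ha
      exact ⟨b :: l₁, l₂, rfl, h₂⟩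

theorem apply_inl_ne (h : IsTrail f x l) (ha : a ∈ l) : f (Sum.inl a) ≠ Sum.inl a := by
  intro hfix
  obtain ⟨-, l₂, -, h₂⟩ := h.exists_eq_append ha
  have := h₂.unique (hfix.symm ▸ h₂.cons)
  simpa using congrArg List.length this

theorem eq_inl_or_exists_apply_eq (h : IsTrail f x l) (ha : a ∈ l) :
    x = Sum.inl a ∨ ∃ b ∈ l, f (Sum.inl b) = Sum.inl a := by
  induction h with
  | nil _ => cases ha
  | @cons b l h ih =>
    rcases List.mem_cons.1 ha with rfl | ha
    · exact Or.inl rfl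
    · rcases ih ha with h' | ⟨c, hc, h'⟩
      · exact Or.inr ⟨b, List.mem_cons_self, h'⟩
      · exact Or.inr ⟨c, List.mem_cons_of_mem _ hc, h'⟩

theorem isChain {R : α → α → Prop} (hR : ∀ a b, f (Sum.inl a) = Sum.inl b → a ≠ b → R a b)
    (h : IsTrail f x l) : l.IsChain R := by
  induction h with
  | nil _ => exact .nil
  | @cons a l h ih =>
    refine List.isChain_cons.2 ⟨fun b hb => ?_, ih⟩
    have hab : f (Sum.inl a) = Sum.inl b := Sum.getLeft?_eq_some_iff.1 (h.head?_eq ▸ hb)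
    refine hR a b hab ?_
    rintro rfl
    exact h.cons.apply_inl_ne List.mem_cons_self hab

end IsTrail

open Classical in
/-- The demands met when following `π` from `x` up to the next terminal, and `[]` if there is no
such terminal. -/
noncomputable def trail (π : Equiv.Perm (Fin n ⊕ Fin n)) (x : Fin n ⊕ Fin n) : List (Fin n) :=
  if h : ∃ l, IsTrail π x l then h.choose else []

/-- The routes from `s` that a routing describes. -/
noncomputable def routesOf (s : Fin p) (π : Equiv.Perm (Fin n ⊕ Fin n)) : List (Route n p) :=
  ((List.finRange n).filter fun a => (π (Sum.inr a)).isLeft).map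
    fun a => (s, trail π (π (Sum.inr a)))

/-- Move to the next stop, unless the current demand requires type `q`. -/
def Instance.chase (I : Instance n k p) (q : Fin k) (π : Equiv.Perm (Fin n ⊕ Fin n)) :
    Fin n ⊕ Fin n → Fin n ⊕ Fin n
  | Sum.inl d => if q ∈ I.req d then Sum.inl d else π (Sum.inl d)
  | Sum.inr a => Sum.inr a

section Trails

variable {I : Instance n k p} {s : Fin p} {E : Finset (Fin n)} {c : ℕ}
  {π : Equiv.Perm (Fin n ⊕ Fin n)} {x : Fin n ⊕ Fin n} {l : List (Fin n)} {d : Fin n} {q : Fin k}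

theorem IsTrail.trail_eq (h : IsTrail π x l) : trail π x = l := by
  have hex : ∃ l, IsTrail π x l := ⟨l, h⟩
  rw [trail, dif_pos hex]
  exact hex.choose_spec.unique h

theorem IsTrail.getLeft?_iterate_chase (h : IsTrail π x l) {m : ℕ} (hm : l.length ≤ m) :
    ((I.chase q π)^[m] x).getLeft? = (l.filter fun d => q ∈ I.req d).head? := by
  induction h generalizing m with
  | nil _ => rw [Function.iterate_fixed rfl]; rfl
  | @cons d l _ ih =>
    by_cases hq : q ∈ I.req d
    · rw [Function.iterate_fixed (show I.chase q π (Sum.inl d) = _ from if_pos hq)]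
      simp [hq]
    · obtain ⟨m, rfl⟩ := Nat.exists_eq_add_of_lt hm
      rw [Function.iterate_succ_apply, Instance.chase, if_neg hq, ih (Nat.le_add_right _ _)]
      simp [hq]

namespace Instance.Routing

theorem exists_isTrail (hI : I.Standing) (hπ : I.Routing s E c π)
    (hd : π (Sum.inl d) ≠ Sum.inl d) : ∃ l, IsTrail π (π (Sum.inl d)) l := by
  induction d using hI.wellFounded_flip_prec.induction with
  | _ d ih =>
    rcases h : π (Sum.inl d) with e | b
    · have hde : d ≠ e := fun hde => hd (hde ▸ h)
      have he : π (Sum.inl e) ≠ Sum.inl e := fun he =>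
        hde (Sum.inl.inj (π.injective (h.trans he.symm)))
      obtain ⟨l, hl⟩ := ih e (hπ.step d e h hde) he
      exact ⟨_, hl.cons⟩
    · exact ⟨[], .nil b⟩

theorem isTrail_next (hI : I.Standing) (hπ : I.Routing s E c π)
    (hd : π (Sum.inl d) ≠ Sum.inl d) : IsTrail π (π (Sum.inl d)) (trail π (π (Sum.inl d))) := by
  obtain ⟨l, hl⟩ := hπ.exists_isTrail hI hd
  rwa [hl.trail_eq]

theorem isTrail_start (hI : I.Standing) (hπ : I.Routing s E c π) (a : Fin n) :
    IsTrail π (π (Sum.inr a)) (trail π (π (Sum.inr a))) := by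
  suffices ∃ l, IsTrail π (π (Sum.inr a)) l by
    obtain ⟨l, hl⟩ := this
    rwa [hl.trail_eq]
  rcases h : π (Sum.inr a) with e | b
  · have he : π (Sum.inl e) ≠ Sum.inl e := fun he => by cases π.injective (h.trans he.symm)
    exact ⟨_, (hπ.isTrail_next hI he).cons⟩
  · exact ⟨[], .nil b⟩

theorem nodup_of_isTrail (hI : I.Standing) (hπ : I.Routing s E c π) (hl : IsTrail π x l) :
    l.Nodup := by
  refine (hI.pairwise_prec (hl.isChain hπ.step)).imp ?_
  rintro d e h rfl
  exact hI.prec_irrefl d h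

theorem getLeft?_chase (hI : I.Standing) (hπ : I.Routing s E c π) (hl : IsTrail π x l) :
    ((I.chase q π)^[n] x).getLeft? = (l.filter fun d => q ∈ I.req d).head? :=
  hl.getLeft?_iterate_chase (by simpa using (hπ.nodup_of_isTrail hI hl).length_le_card)

theorem exists_mem_trail_iff (hI : I.Standing) (hπ : I.Routing s E c π) :
    (∃ a, d ∈ trail π (π (Sum.inr a))) ↔ π (Sum.inl d) ≠ Sum.inl d := by
  refine ⟨fun ⟨a, ha⟩ => (hπ.isTrail_start hI a).apply_inl_ne ha, ?_⟩
  induction d using hI.wellFounded_prec.induction with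
  | _ d ih =>
    intro hd
    have hmem {x : Fin n ⊕ Fin n} {l : List (Fin n)} (hx : π x = Sum.inl d)
        (hl : IsTrail π (π x) l) : d ∈ l :=
      List.mem_of_mem_head? (by rw [hl.head?_eq, hx]; rfl)
    obtain ⟨e | a, hx⟩ := π.surjective (Sum.inl d)
    · have hed : e ≠ d := by
        rintro rfl
        exact hd hx
      obtain ⟨a, ha⟩ := ih e (hπ.step e d hx hed) (by simpa [hx] using hed.symm)
      obtain ⟨l₁, l₂, hl, hl₂⟩ := (hπ.isTrail_start hI a).exists_eq_append ha
      exact ⟨a, by simp [hl, hmem hx hl₂]⟩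
    · exact ⟨a, hmem hx (hπ.isTrail_start hI a)⟩

theorem eq_of_mem_trail (hI : I.Standing) (hπ : I.Routing s E c π) {a b : Fin n}
    (ha : d ∈ trail π (π (Sum.inr a))) (hb : d ∈ trail π (π (Sum.inr b))) : a = b := by
  induction d using hI.wellFounded_prec.induction with
  | _ d ih =>
    rcases (hπ.isTrail_start hI a).eq_inl_or_exists_apply_eq ha with h | ⟨e, he, h⟩ <;>
      rcases (hπ.isTrail_start hI b).eq_inl_or_exists_apply_eq hb with h' | ⟨e', he', h'⟩ <;>
      cases π.injective (h.trans h'.symm)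
    · rfl
    · refine ih e (hπ.step e d h ?_) he he'
      rintro rfl
      exact (hπ.isTrail_start hI a).apply_inl_ne he h

end Instance.Routing

theorem mem_routesOf {ρ : Route n p} : ρ ∈ routesOf s π ↔
    ∃ a, (π (Sum.inr a)).isLeft ∧ ρ = (s, trail π (π (Sum.inr a))) := by
  simp only [routesOf, List.mem_map, List.mem_filter, List.mem_finRange, true_and]
  exact exists_congr fun a => and_congr_right fun _ => eq_comm

namespace Instance.Routing

theorem mem_served_routesOf_iff_exists (hI : I.Standing) (hπ : I.Routing s E c π) :
    d ∈ served (routesOf s π) ↔ ∃ a, d ∈ trail π (π (Sum.inr a)) := by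
  rw [mem_served]
  constructor
  · rintro ⟨ρ, hρ, hd⟩
    obtain ⟨a, -, rfl⟩ := mem_routesOf.1 hρ
    exact ⟨a, hd⟩
  · rintro ⟨a, ha⟩
    refine ⟨_, mem_routesOf.2 ⟨a, ?_, rfl⟩, ha⟩
    rw [← Sum.isSome_getLeft?_iff_isLeft, ← (hπ.isTrail_start hI a).head?_eq,
      List.isSome_head?]
    exact List.ne_nil_of_mem ha

theorem mem_served_routesOf (hI : I.Standing) (hπ : I.Routing s E c π) :
    d ∈ served (routesOf s π) ↔ π (Sum.inl d) ≠ Sum.inl d :=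
  (hπ.mem_served_routesOf_iff_exists hI).trans (hπ.exists_mem_trail_iff hI)

theorem nodup_served_routesOf (hI : I.Standing) (hπ : I.Routing s E c π) :
    (served (routesOf s π)).Nodup := by
  refine List.nodup_flatMap.2 ⟨fun ρ hρ => ?_, ?_⟩
  · obtain ⟨a, -, rfl⟩ := mem_routesOf.1 hρ
    exact hπ.nodup_of_isTrail hI (hπ.isTrail_start hI a)
  · refine List.pairwise_map.2 (((List.nodup_finRange n).filter _).imp ?_)
    exact fun hab d hd hd' => hab (hπ.eq_of_mem_trail hI hd hd')

theorem count_starts_routesOf_le (hπ : I.Routing s E c π) (s' : Fin p) :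
    ((routesOf s π).map Prod.fst).count s' ≤ if s' = s then c else 0 := by
  rw [routesOf, List.map_map]
  split_ifs with hs
  · refine List.count_le_length.trans ?_
    rw [List.length_map, ← List.toFinset_card_of_nodup ((List.nodup_finRange n).filter _)]
    refine (Finset.card_le_card (t := Finset.univ.filter fun a : Fin n => (a : ℕ) < c)
      fun a ha => ?_).trans ?_
    · have ha : (π (Sum.inr a)).isLeft := by simpa using ha
      obtain ⟨e, he⟩ := Sum.isLeft_iff.1 ha
      simpa using hπ.start a e he
    · rw [Fin.card_filter_val_lt]
      exact min_le_right _ _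
  · refine (List.count_eq_zero_of_not_mem fun h => hs ?_).le
    obtain ⟨a, -, h⟩ := List.mem_map.1 h
    exact h.symm

theorem routesFeasible (hI : I.Standing) {r : Fin k} (hs : s ∈ I.startSet r)
    (hE : ∀ d ∈ E, r ∈ I.req d) (hπ : I.Routing s E (I.count r s) π) :
    I.RoutesFeasible r E (routesOf s π) := by
  have hmem (d : Fin n) (hd : d ∈ served (routesOf s π)) : d ∈ E :=
    (hπ.moved d ((hπ.mem_served_routesOf hI).1 hd)).1
  have hreq {ρ : Route n p} (hρ : ρ ∈ routesOf s π) (d : Fin n) (hd : d ∈ ρ.2) : r ∈ I.req d :=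
    hE d (hmem d (mem_served.2 ⟨ρ, hρ, hd⟩))
  refine ⟨hmem, fun ρ hρ => ?_, fun ρ hρ => ?_, hπ.nodup_served_routesOf hI, fun s' => ?_⟩
  · obtain ⟨a, ha, rfl⟩ := mem_routesOf.1 hρ
    obtain ⟨e, he⟩ := Sum.isLeft_iff.1 ha
    have hhead : (trail π (π (Sum.inr a))).head? = some e := by
      rw [(hπ.isTrail_start hI a).head?_eq, he]
      rfl
    have hmem := List.mem_of_mem_head? hhead
    exact ⟨e, hhead, (hπ.moved e ((hπ.isTrail_start hI a).apply_inl_ne hmem)).2, hs,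
      hreq hρ e hmem⟩
  · obtain ⟨a, -, rfl⟩ := mem_routesOf.1 hρ
    exact ((hπ.isTrail_start hI a).isChain hπ.step).imp_of_mem_imp fun d e hd he h =>
      h.arc (hreq hρ d hd) (hreq hρ e he)
  · refine (hπ.count_starts_routesOf_le s').trans ?_
    split_ifs with h
    · rw [h]
    · exact Nat.zero_le _

theorem exists_restrict_eq (hI : I.Standing) (hπ : I.Routing s E c π)
    (hd : π (Sum.inl d) ≠ Sum.inl d) (hq : q ∈ I.req d) :
    ∃ ρ ∈ routesOf s π, ∃ l, I.restrict q ρ =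
      l ++ d :: (trail π (π (Sum.inl d))).filter fun e => q ∈ I.req e := by
  obtain ⟨ρ, hρ, hdρ⟩ := mem_served.1 ((hπ.mem_served_routesOf hI).2 hd)
  refine ⟨ρ, hρ, ?_⟩
  obtain ⟨a, -, rfl⟩ := mem_routesOf.1 hρ
  obtain ⟨l₁, l₂, hl, hl₂⟩ := (hπ.isTrail_start hI a).exists_eq_append hdρ
  exact ⟨l₁.filter fun e => q ∈ I.req e, by simp [Instance.restrict, hl, hl₂.trail_eq, hq]⟩

theorem chase_eq_inl_iff (hI : I.Standing) (hπ : I.Routing s E c π) (hl : IsTrail π x l) :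
    (I.chase q π)^[n] x = Sum.inl d ↔ (l.filter fun e => q ∈ I.req e).head? = some d := by
  rw [← hπ.getLeft?_chase hI hl, Sum.getLeft?_eq_some_iff]

theorem chase_isRight_iff (hI : I.Standing) (hπ : I.Routing s E c π) (hl : IsTrail π x l) :
    ((I.chase q π)^[n] x).isRight ↔ (l.filter fun e => q ∈ I.req e) = [] := by
  rw [← List.head?_eq_none_iff, ← hπ.getLeft?_chase hI hl, Sum.getLeft?_eq_none_iff]

open Classical in
theorem follow_y_routesOf (hI : I.Standing) (hπ : I.Routing s E c π) (d : Fin n) :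
    (I.follow (routesOf s π)).y d = if π (Sum.inl d) ≠ Sum.inl d then 1 else 0 :=
  if_congr (hπ.mem_served_routesOf hI) rfl rfl

open Classical in
theorem follow_xs_routesOf (hI : I.Standing) (hπ : I.Routing s E c π) (q : Fin k) (s' : Fin p)
    (d : Fin n) : (I.follow (routesOf s π)).xs q s' d =
      if s' = s ∧ ∃ a, (I.chase q π)^[n] (π (Sum.inr a)) = Sum.inl d then 1 else 0 := by
  refine if_congr ⟨?_, ?_⟩ rfl rfl
  · rintro ⟨ρ, hρ, rfl, hhead⟩
    obtain ⟨a, -, rfl⟩ := mem_routesOf.1 hρ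
    exact ⟨rfl, a, (hπ.chase_eq_inl_iff hI (hπ.isTrail_start hI a)).2 hhead⟩
  · rintro ⟨rfl, a, ha⟩
    have hhead := (hπ.chase_eq_inl_iff hI (hπ.isTrail_start hI a)).1 ha
    refine ⟨_, mem_routesOf.2 ⟨a, ?_, rfl⟩, rfl, hhead⟩
    rw [← Sum.isSome_getLeft?_iff_isLeft, ← (hπ.isTrail_start hI a).head?_eq, List.isSome_head?]
    exact List.ne_nil_of_mem (List.mem_filter.1 (List.mem_of_mem_head? hhead)).1

open Classical in
theorem follow_x_routesOf (hI : I.Standing) (hπ : I.Routing s E c π) (q : Fin k) (i j : Fin n) :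
    (I.follow (routesOf s π)).x q i j = if (π (Sum.inl i) ≠ Sum.inl i ∧ q ∈ I.req i) ∧
      (I.chase q π)^[n] (π (Sum.inl i)) = Sum.inl j then 1 else 0 := by
  by_cases hi : π (Sum.inl i) ≠ Sum.inl i ∧ q ∈ I.req i
  · obtain ⟨ρ, hρ, l, hl⟩ := hπ.exists_restrict_eq hI hi.1 hi.2
    rw [(follow_eq_of_restrict_eq (hπ.nodup_served_routesOf hI) hρ hl).2.2.1]
    exact if_congr ((hπ.chase_eq_inl_iff hI (hπ.isTrail_next hI hi.1)).symm.trans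
      (and_iff_right hi).symm) rfl rfl
  · rw [if_neg fun h => hi h.1]
    rw [← hπ.mem_served_routesOf hI] at hi
    exact (follow_eq_zero_of_not_served hi).2.2.1 j

open Classical in
theorem follow_xt_routesOf (hI : I.Standing) (hπ : I.Routing s E c π) (q : Fin k) (i : Fin n) :
    (I.follow (routesOf s π)).xt q i = if (π (Sum.inl i) ≠ Sum.inl i ∧ q ∈ I.req i) ∧
      ((I.chase q π)^[n] (π (Sum.inl i))).isRight then 1 else 0 := by
  by_cases hi : π (Sum.inl i) ≠ Sum.inl i ∧ q ∈ I.req i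
  · obtain ⟨ρ, hρ, l, hl⟩ := hπ.exists_restrict_eq hI hi.1 hi.2
    rw [(follow_eq_of_restrict_eq (hπ.nodup_served_routesOf hI) hρ hl).2.2.2]
    exact if_congr ((hπ.chase_isRight_iff hI (hπ.isTrail_next hI hi.1)).symm.trans
      (and_iff_right hi).symm) rfl rfl
  · rw [if_neg fun h => hi h.1]
    rw [← hπ.mem_served_routesOf hI] at hi
    exact (follow_eq_zero_of_not_served hi).2.2.2

end Instance.Routing

end Trails

/-! ## The approximation guarantee -/

section Guarantee

variable {I : Instance n k p} {s : Fin p} {σ : Equiv.Perm (Fin k)} {d : Fin n} {r : Fin k}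

theorem numResources_eq_of_startSet (hs : I.startSet r = {s}) :
    I.numResources r = I.count r s := by
  simp [Instance.numResources, hs]

theorem mem_remaining {i : Fin k} :
    d ∈ I.remaining σ i ↔ σ i ∈ I.req d ∧ ∀ j < i, σ j ∉ I.req d := by
  simp [Instance.remaining]

theorem exists_mem_remaining (hI : I.Standing) (σ : Equiv.Perm (Fin k)) (d : Fin n) :
    ∃ i, d ∈ I.remaining σ i := by
  obtain ⟨r, hr⟩ := hI.req_nonempty d
  obtain ⟨i, hi, hmin⟩ := WellFounded.has_min (wellFounded_lt (α := Fin k))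
    {i | σ i ∈ I.req d} ⟨σ.symm r, by simpa using hr⟩
  exact ⟨i, mem_remaining.2 ⟨hi, fun j hj hjd => hmin j hjd hj⟩⟩

theorem sum_reward_le_sum_remaining (hI : I.Standing) (hw : ∀ d, 0 ≤ I.reward d)
    (σ : Equiv.Perm (Fin k)) (Y : Finset (Fin n)) :
    ∑ d ∈ Y, I.reward d ≤ ∑ i, ∑ d ∈ Y ∩ I.remaining σ i, I.reward d := by
  simp only [← Finset.filter_mem_eq_inter, Finset.sum_filter]
  rw [Finset.sum_comm]
  refine Finset.sum_le_sum fun d _ => ?_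
  obtain ⟨i, hi⟩ := exists_mem_remaining hI σ d
  calc I.reward d = if d ∈ I.remaining σ i then I.reward d else 0 := (if_pos hi).symm
    _ ≤ _ := Finset.single_le_sum (f := fun i => if d ∈ I.remaining σ i then I.reward d else 0)
        (fun j _ => ite_nonneg (hw d) le_rfl) (Finset.mem_univ i)

theorem exists_routesFeasible_routesValue_eq (hI : I.Standing) (hs : s ∈ I.startSet r)
    {E Y : Finset (Fin n)} (hE : ∀ d ∈ E, r ∈ I.req d) (hYE : ∀ d ∈ Y, d ∈ E ∧ I.Reach s d)
    (hY : ∀ X ⊆ Y, (∀ d ∈ X, ∀ e ∈ X, ¬ I.Prec d e) → X.card ≤ I.count r s) :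
    ∃ V, I.RoutesFeasible r E V ∧ I.routesValue V = ∑ d ∈ Y, I.reward d := by
  obtain ⟨π, hπ, hmoved⟩ := exists_routing hI hYE hY
  refine ⟨routesOf s π, hπ.routesFeasible hI hs hE, ?_⟩
  rw [routesValue_eq_sum_toFinset (hπ.nodup_served_routesOf hI)]
  congr 1
  ext d
  rw [List.mem_toFinset, hπ.mem_served_routesOf hI, hmoved]

theorem Instance.Feasible.sum_reward_le_routesValue (hI : I.Standing) (hs : I.startSet r = {s})
    {z : Solution n k p} (hz : I.Feasible z) {E Y : Finset (Fin n)} (hE : ∀ d ∈ E, r ∈ I.req d)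
    {W : List (Route n p)} (hW : I.RoutesOptimal r E W) (hYE : Y ⊆ E)
    (hY : ∀ d ∈ Y, z.y d = 1) : ∑ d ∈ Y, I.reward d ≤ I.routesValue W := by
  have hflow (d : Fin n) (hd : d ∈ Y) : 1 ≤ z.inflow r d :=
    hY d hd ▸ hz.service d r (hE d (hYE hd))
  obtain ⟨V, hV, hval⟩ := exists_routesFeasible_routesValue_eq hI (r := r) (s := s) (by simp [hs])
    hE (fun d hd => ⟨hYE hd, hz.reach_of_inflow hI hs (hflow d hd)⟩)
    fun X hX hanti => hz.card_le_count_of_antichain hI hs hanti fun d hd => hflow d (hX hd)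
  exact hval ▸ hW.2 V hV

theorem Instance.Feasible.objective_le (hI : I.Standing) (hs : ∀ r, I.startSet r = {s})
    (hw : ∀ d, 0 ≤ I.reward d) {z : Solution n k p} (hz : I.Feasible z)
    {W : Fin k → List (Route n p)} {v : ℤ}
    (hW : ∀ i, I.RoutesOptimal (σ i) (I.remaining σ i) (W i)) (hv : ∀ i, I.routesValue (W i) ≤ v) :
    I.objective z ≤ k * v := by
  let Y : Finset (Fin n) := Finset.univ.filter fun d => z.y d = 1
  have hpart (i : Fin k) : ∑ d ∈ Y ∩ I.remaining σ i, I.reward d ≤ v :=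
    (hz.sum_reward_le_routesValue hI (hs _) (fun d hd => (mem_remaining.1 hd).1) (hW i)
      Finset.inter_subset_right fun d hd =>
        (Finset.mem_filter.1 (Finset.mem_inter.1 hd).1).2).trans (hv i)
  calc I.objective z
      = ∑ d, z.y d * I.reward d - ∑ r, ∑ d, I.arrivalCost z r d :=
        I.objective_eq_sub_sum_arrivalCost z
    _ ≤ ∑ d, z.y d * I.reward d := sub_le_self _ <| Finset.sum_nonneg fun r _ =>
        Finset.sum_nonneg fun d _ => hz.arrivalCost_nonneg r d
    _ = ∑ d ∈ Y, I.reward d := by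
        rw [Finset.sum_filter]
        refine Finset.sum_congr rfl fun d _ => ?_
        rcases hz.y_binary d with h | h <;> simp [h]
    _ ≤ ∑ i, ∑ d ∈ Y ∩ I.remaining σ i, I.reward d := sum_reward_le_sum_remaining hI hw σ Y
    _ ≤ ∑ _i : Fin k, v := Finset.sum_le_sum fun i _ => hpart i
    _ = k * v := by simp

theorem count_le_of_mem_remaining (hs : ∀ r, I.startSet r = {s})
    (hσ : Monotone fun i => I.numResources (σ i)) {i : Fin k} (hd : d ∈ I.remaining σ i)
    (hr : r ∈ I.req d) : I.count (σ i) s ≤ I.count r s := by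
  have hle : i ≤ σ.symm r := le_of_not_gt fun hlt =>
    (mem_remaining.1 hd).2 _ hlt (by simpa using hr)
  simpa [numResources_eq_of_startSet (hs _)] using hσ hle

theorem Instance.AlgorithmA.feasible_and_objective_le (hI : I.Standing) (hS : I.SameStart)
    (hC : I.SmallCosts) {z : Solution n k p} (hz : I.AlgorithmA z) :
    I.Feasible z ∧ ∀ z', I.Feasible z' →
      1 / (2 * (k : ℚ)) * (I.objective z' : ℚ) ≤ I.objective z := by
  obtain ⟨s, hs⟩ := hS
  obtain ⟨σ, W, b, hσ, hW, hb, -, rfl⟩ := hz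
  have hfeasible : I.Feasible (I.follow (W b)) :=
    follow_feasible hI hs (hW b).1 fun _ _ hd hr => count_le_of_mem_remaining hs hσ hd hr
  refine ⟨hfeasible, fun z' hz' => ?_⟩
  have hupper := hz'.objective_le hI hs (hC.reward_nonneg hI.types_pos) hW hb
  have hlower := routesValue_le_two_mul_objective_follow hI.types_pos hC (hW b).1.disjoint
    hfeasible
  have hle : I.objective z' ≤ 2 * k * I.objective (I.follow (W b)) := by
    linarith [mul_le_mul_of_nonneg_left hlower (Int.natCast_nonneg k)]
  have hk : (0 : ℚ) < 2 * k := mul_pos two_pos (mod_cast hI.types_pos)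
  rw [one_div, inv_mul_eq_div, div_le_iff₀' hk]
  exact_mod_cast hle

end Guarantee

/-! ## One-type problems as assignment problems -/

open Classical in
/-- The cost of assigning the successor `x` to `y`: the lost reward if `x = y` is a demand, `M` for
pairs that no routing contains, and `0` otherwise. -/
noncomputable def Instance.entry (I : Instance n k p) (s : Fin p) (E : Finset (Fin n)) (c : ℕ)
    (M : ℤ) : Fin n ⊕ Fin n → Fin n ⊕ Fin n → ℤ
  | Sum.inr _, _ => 0
  | Sum.inl e, Sum.inl d =>
      if d = e then I.reward e else if (e ∈ E ∧ I.Reach s e) ∧ I.Prec d e then 0 else M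
  | Sum.inl e, Sum.inr a => if (e ∈ E ∧ I.Reach s e) ∧ (a : ℕ) < c then 0 else M

section Assignment

variable {I : Instance n k p} {s : Fin p} {E : Finset (Fin n)} {c : ℕ} {M : ℤ}
  {π : Equiv.Perm (Fin n ⊕ Fin n)} {r : Fin k}

theorem entry_nonneg (hw : ∀ d, 0 ≤ I.reward d) (hM : 0 ≤ M) (x y : Fin n ⊕ Fin n) :
    0 ≤ I.entry s E c M x y := by
  unfold Instance.entry
  split
  · exact le_rfl
  · split_ifs
    exacts [hw _, le_rfl, hM]
  · split_ifs
    exacts [le_rfl, hM]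

theorem Instance.Routing.of_entry_ne (h : ∀ x, I.entry s E c M (π x) x ≠ M) :
    I.Routing s E c π where
  step d e he hne := by
    have hd := h (Sum.inl d)
    rw [he, Instance.entry, if_neg hne] at hd
    exact (of_not_not fun hn => hd (if_neg hn)).2
  start a e he := by
    have ha := h (Sum.inr a)
    rw [he, Instance.entry] at ha
    exact (of_not_not fun hn => ha (if_neg hn)).2
  moved d hd := by
    obtain ⟨x, hx⟩ := π.surjective (Sum.inl d)
    have hentry := h x
    rw [hx] at hentry
    rcases x with e | a
    · have hne : e ≠ d := fun hed => hd (hed ▸ hx)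
      rw [Instance.entry, if_neg hne] at hentry
      exact (of_not_not fun hn => hentry (if_neg hn)).1
    · exact (of_not_not fun hn => hentry (if_neg hn)).1

theorem Instance.Routing.one : I.Routing s E c 1 where
  step _ _ h hne := absurd (Sum.inl.inj h) hne
  start _ _ h := by cases h
  moved _ h := absurd rfl h

theorem Instance.Routing.entry_inl (hπ : I.Routing s E c π) (d : Fin n) :
    I.entry s E c M (π (Sum.inl d)) (Sum.inl d) =
      if π (Sum.inl d) = Sum.inl d then I.reward d else 0 := by
  rcases h : π (Sum.inl d) with e | a
  · by_cases hde : d = e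
    · simp [Instance.entry, hde]
    · have hed : π (Sum.inl e) ≠ Sum.inl e := fun he =>
        hde (Sum.inl.inj (π.injective (h.trans he.symm)))
      simp [Instance.entry, hde, Ne.symm hde, hπ.moved e hed, hπ.step d e h hde]
  · simp [Instance.entry]

theorem Instance.Routing.entry_inr (hπ : I.Routing s E c π) (a : Fin n) :
    I.entry s E c M (π (Sum.inr a)) (Sum.inr a) = 0 := by
  rcases h : π (Sum.inr a) with e | b
  · have he : π (Sum.inl e) ≠ Sum.inl e := fun he => by cases π.injective (h.trans he.symm)
    simp [Instance.entry, hπ.moved e he, hπ.start a e h]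
  · rfl

open Classical in
theorem Instance.Routing.sum_entry (hπ : I.Routing s E c π) :
    ∑ x, I.entry s E c M (π x) x =
      ∑ d, I.reward d - ∑ d with π (Sum.inl d) ≠ Sum.inl d, I.reward d := by
  simp only [Fintype.sum_sum_type, hπ.entry_inl, hπ.entry_inr, Finset.sum_const_zero, add_zero]
  rw [eq_sub_iff_add_eq, ← Finset.sum_filter]
  exact Finset.sum_filter_add_sum_filter_not _ _ _

theorem Instance.Routing.of_optimal (hw : ∀ d, 0 ≤ I.reward d) (hM : ∑ d, I.reward d < M)
    (hopt : ∀ ρ : Equiv.Perm (Fin n ⊕ Fin n),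
      ∑ x, I.entry s E c M (π x) x ≤ ∑ x, I.entry s E c M (ρ x) x) : I.Routing s E c π := by
  have hM0 : 0 ≤ M := (Finset.sum_nonneg fun d _ => hw d).trans hM.le
  refine .of_entry_ne (M := M) fun x => ne_of_lt ?_
  calc I.entry s E c M (π x) x
      ≤ ∑ x, I.entry s E c M (π x) x :=
        Finset.single_le_sum (f := fun x => I.entry s E c M (π x) x)
          (fun x _ => entry_nonneg hw hM0 _ _) (Finset.mem_univ x)
    _ ≤ ∑ x, I.entry s E c M ((1 : Equiv.Perm (Fin n ⊕ Fin n)) x) x := hopt 1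
    _ = ∑ d, I.reward d := Instance.Routing.one.sum_entry.trans (by simp)
    _ < M := hM

open Classical in
theorem Instance.Routing.routesValue_routesOf (hI : I.Standing) (hπ : I.Routing s E c π) :
    I.routesValue (routesOf s π) = ∑ d with π (Sum.inl d) ≠ Sum.inl d, I.reward d := by
  rw [routesValue_eq_sum_toFinset (hπ.nodup_served_routesOf hI)]
  congr 1
  ext d
  rw [List.mem_toFinset, hπ.mem_served_routesOf hI]
  simp

/-- An antichain meets each route at most once. -/
theorem Instance.RoutesFeasible.card_le_count_of_antichain (hI : I.Standing)
    {V : List (Route n p)} (hV : I.RoutesFeasible r E V) (hs : I.startSet r = {s})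
    {X : Finset (Fin n)} (hX : ∀ d ∈ X, d ∈ served V)
    (hanti : ∀ d ∈ X, ∀ e ∈ X, ¬ I.Prec d e) : X.card ≤ I.count r s := by
  refine (card_le_count_starts (fun ρ => (ρ.2.filter (· ∈ X)).head?) fun d hd => ?_).trans
    (hV.supply s)
  obtain ⟨ρ, hρ, hdρ⟩ := mem_served.1 (hX d hd)
  refine ⟨ρ, hρ, by simpa [hs] using hV.start_mem hρ, ?_⟩
  have hmem : d ∈ ρ.2.filter (· ∈ X) := by simpa using ⟨hdρ, hd⟩
  obtain ⟨l₁, l₂, hl⟩ := List.append_of_mem hmem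
  have hprec := (hV.pairwise_prec hI hρ).filter (· ∈ X)
  rw [hl] at hprec ⊢
  rcases l₁ with _ | ⟨e, l₁⟩
  · rfl
  · have he : e ∈ ρ.2.filter (· ∈ X) := by simp [hl]
    have hed := List.rel_of_pairwise_cons hprec (a' := d) (by simp)
    exact absurd hed (hanti e (by simpa using (List.mem_filter.1 he).2) d hd)

theorem routesOptimal_routesOf (hI : I.Standing) (hw : ∀ d, 0 ≤ I.reward d)
    (hs : I.startSet r = {s}) (hE : ∀ d ∈ E, r ∈ I.req d) (hM : ∑ d, I.reward d < M)
    (hopt : ∀ ρ : Equiv.Perm (Fin n ⊕ Fin n), ∑ x, I.entry s E (I.count r s) M (π x) x ≤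
      ∑ x, I.entry s E (I.count r s) M (ρ x) x) :
    I.RoutesOptimal r E (routesOf s π) := by
  classical
  have hπ := Instance.Routing.of_optimal hw hM hopt
  refine ⟨hπ.routesFeasible hI (by simp [hs]) hE, fun V hV => ?_⟩
  obtain ⟨ρ, hρ, hmoved⟩ := exists_routing hI (s := s) (E := E) (c := I.count r s)
    (Y := (served V).toFinset)
    (fun d hd => by
      obtain ⟨ρ, hρ, hdρ⟩ := mem_served.1 (List.mem_toFinset.1 hd)
      obtain rfl : ρ.1 = s := by simpa [hs] using hV.start_mem hρ
      exact ⟨hV.stops_mem d (List.mem_toFinset.1 hd), hV.reach hI hρ hdρ⟩)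
    fun X hX hanti => hV.card_le_count_of_antichain hI hs
      (fun d hd => List.mem_toFinset.1 (hX hd)) hanti
  have hV' : I.routesValue V = ∑ d with ρ (Sum.inl d) ≠ Sum.inl d, I.reward d := by
    rw [routesValue_eq_sum_toFinset hV.disjoint]
    congr 1
    ext d
    simp [hmoved]
  have hle := hopt ρ
  rw [hπ.sum_entry, hρ.sum_entry] at hle
  rw [hV', hπ.routesValue_routesOf hI]
  exact (sub_le_sub_iff_left _).1 hle

end Assignment

/-! ## Running times -/

/-- The memory after a run of a program. -/
def exec (c : Prog) (s : Store) : Store := (c.run s).1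

/-- The arrays that a program may change. -/
def Prog.writes : Prog → List ℕ
  | skip => []
  | assign a _ _ _ _ => [a]
  | seq c₁ c₂ => c₁.writes ++ c₂.writes
  | ifLe _ _ c₁ c₂ => c₁.writes ++ c₂.writes
  | loop _ c => c.writes

/-- Sums of entries of array `0`, which holds the dimensions of the instance, and of constants up
to `1`. -/
def Expr.isDim : Expr → Bool
  | const c => decide (c ≤ 1)
  | read a (const _) (const _) (const _) => decide (a = 0)
  | add e₁ e₂ => e₁.isDim && e₂.isDim
  | _ => false

/-- All loop lengths are bounded by the dimensions of the instance. -/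
def Prog.loopsDim : Prog → Bool
  | skip => true
  | assign _ _ _ _ _ => true
  | seq c₁ c₂ => c₁.loopsDim && c₂.loopsDim
  | ifLe _ _ c₁ c₂ => c₁.loopsDim && c₂.loopsDim
  | loop e c => e.isDim && c.loopsDim

open Polynomial in
/-- A bound on the number of steps of a program with `loopsDim`, where the indeterminate is a bound
on the entries of array `0`. -/
noncomputable def Prog.timeBound : Prog → ℕ[X]
  | skip => 1
  | assign _ e₁ e₂ e₃ e => C (e₁.steps + e₂.steps + e₃.steps + e.steps + 1)
  | seq c₁ c₂ => c₁.timeBound + c₂.timeBound + 1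
  | ifLe e₁ e₂ c₁ c₂ => C (e₁.steps + e₂.steps) + c₁.timeBound + c₂.timeBound + 1
  | loop e c => C (e.steps + 1) + C e.steps * (X + 1) * (c.timeBound + 1)

/-- One round of a loop with body `c`, acting on the memory and the number of steps. -/
def Prog.loopStep (c : Prog) (t : Store × ℕ) : Store × ℕ :=
  ((c.run t.1).1, t.2 + (c.run t.1).2 + 1)

@[simp]
theorem Store.set_apply (s : Store) (a i j l : ℕ) (v : ℤ) (a' i' j' l' : ℕ) :
    s.set a i j l v a' i' j' l' = if a' = a ∧ i' = i ∧ j' = j ∧ l' = l then v else s a' i' j' l' :=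
  (rfl)

theorem Store.set_of_ne (s : Store) {a a' : ℕ} (i j l : ℕ) (v : ℤ) (h : a' ≠ a) :
    s.set a i j l v a' = s a' := by
  funext i' j' l'
  rw [Store.set_apply, if_neg fun h' => h h'.1]

@[simp]
theorem exec_skip (s : Store) : exec .skip s = s := rfl

@[simp]
theorem exec_assign (a : ℕ) (e₁ e₂ e₃ e : Expr) (s : Store) :
    exec (.assign a e₁ e₂ e₃ e) s =
      s.set a (e₁.eval s).toNat (e₂.eval s).toNat (e₃.eval s).toNat (e.eval s) := rfl

@[simp]
theorem exec_seq (c₁ c₂ : Prog) (s : Store) : exec (.seq c₁ c₂) s = exec c₂ (exec c₁ s) := rfl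

@[simp]
theorem exec_ifLe (e₁ e₂ : Expr) (c₁ c₂ : Prog) (s : Store) :
    exec (.ifLe e₁ e₂ c₁ c₂) s = if e₁.eval s ≤ e₂.eval s then exec c₁ s else exec c₂ s := by
  simp only [exec, Prog.run]
  split_ifs <;> rfl

theorem iterate_loopStep_fst (c : Prog) (m : ℕ) (t : Store × ℕ) :
    (c.loopStep^[m] t).1 = (exec c)^[m] t.1 := by
  induction m generalizing t with
  | zero => rfl
  | succ m ih => rw [Function.iterate_succ_apply, ih, Function.iterate_succ_apply]; rfl

theorem exec_loop (e : Expr) (c : Prog) (s : Store) :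
    exec (.loop e c) s = (exec c)^[(e.eval s).toNat] s :=
  iterate_loopStep_fst c _ _

theorem iterate_exec_of_forall {a : ℕ} {c : Prog} (h : ∀ s, exec c s a = s a) (m : ℕ) (s : Store) :
    (exec c)^[m] s a = s a := by
  induction m with
  | zero => rfl
  | succ m ih => rw [Function.iterate_succ_apply', h, ih]

theorem exec_of_notMem_writes {a : ℕ} {c : Prog} (h : a ∉ c.writes) (s : Store) :
    exec c s a = s a := by
  induction c generalizing s with
  | skip => rfl
  | assign b e₁ e₂ e₃ e => exact Store.set_of_ne _ _ _ _ _ (List.ne_of_not_mem_cons h)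
  | seq c₁ c₂ ih₁ ih₂ =>
    obtain ⟨h₁, h₂⟩ := not_or.1 (List.mem_append.not.1 h)
    rw [exec_seq, ih₂ h₂, ih₁ h₁]
  | ifLe e₁ e₂ c₁ c₂ ih₁ ih₂ =>
    obtain ⟨h₁, h₂⟩ := not_or.1 (List.mem_append.not.1 h)
    rw [exec_ifLe]
    split_ifs
    exacts [ih₁ h₁ s, ih₂ h₂ s]
  | loop e c ih => rw [exec_loop, iterate_exec_of_forall (ih h)]

theorem Expr.eval_le_of_isDim {s : Store} {x : ℕ} (hs : ∀ i j l, s 0 i j l ≤ x) {e : Expr}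
    (he : e.isDim = true) : e.eval s ≤ (e.steps * (x + 1) : ℕ) := by
  fun_induction Expr.isDim e with
  | case1 c =>
    have := of_decide_eq_true he
    simp only [Expr.eval, Expr.steps]
    omega
  | case2 a c₁ c₂ c₃ =>
    obtain rfl := of_decide_eq_true he
    have := hs c₁.toNat c₂.toNat c₃.toNat
    simp only [Expr.eval, Expr.steps]
    push_cast
    omega
  | case3 e₁ e₂ ih₁ ih₂ =>
    rw [Bool.and_eq_true] at he
    calc e₁.eval s + e₂.eval s
        ≤ (e₁.steps * (x + 1) : ℕ) + (e₂.steps * (x + 1) : ℕ) := add_le_add (ih₁ he.1) (ih₂ he.2)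
      _ ≤ ((e₁.steps + e₂.steps + 1) * (x + 1) : ℕ) := by
        rw [← Nat.cast_add, ← add_mul]
        exact_mod_cast Nat.mul_le_mul_right _ (Nat.le_succ _)
  | case4 => simp at he

theorem iterate_loopStep_snd_le {c : Prog} {s : Store} {B : ℕ} (h0 : 0 ∉ c.writes)
    (hB : ∀ t : Store, t 0 = s 0 → (c.run t).2 ≤ B) (m b : ℕ) :
    (c.loopStep^[m] (s, b)).2 ≤ b + m * (B + 1) := by
  induction m with
  | zero => simp
  | succ m ih =>
    rw [Function.iterate_succ_apply']
    have hrun := hB (c.loopStep^[m] (s, b)).1 <| by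
      rw [iterate_loopStep_fst, iterate_exec_of_forall (exec_of_notMem_writes h0)]
    calc (c.loopStep^[m] (s, b)).2 + (c.run (c.loopStep^[m] (s, b)).1).2 + 1
        ≤ b + m * (B + 1) + B + 1 := by gcongr
      _ = b + (m + 1) * (B + 1) := by ring

theorem Prog.steps_le_eval_timeBound {c : Prog} (hc : c.loopsDim = true) (h0 : 0 ∉ c.writes)
    {x : ℕ} {s : Store} (hs : ∀ i j l, s 0 i j l ≤ x) : (c.run s).2 ≤ c.timeBound.eval x := by
  induction c generalizing s with
  | skip => simp [Prog.run, Prog.timeBound]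
  | assign b e₁ e₂ e₃ e => simp [Prog.run, Prog.timeBound]
  | seq c₁ c₂ ih₁ ih₂ =>
    obtain ⟨h₁, h₂⟩ := not_or.1 (List.mem_append.not.1 h0)
    simp only [Prog.loopsDim, Bool.and_eq_true] at hc
    have hs' : ∀ i j l, exec c₁ s 0 i j l ≤ x := by rwa [exec_of_notMem_writes h₁]
    have hle := add_le_add (ih₁ hc.1 h₁ hs) (ih₂ hc.2 h₂ hs')
    simpa [Prog.run, Prog.timeBound, exec] using hle
  | ifLe e₁ e₂ c₁ c₂ ih₁ ih₂ =>
    obtain ⟨h₁, h₂⟩ := not_or.1 (List.mem_append.not.1 h0)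
    simp only [Prog.loopsDim, Bool.and_eq_true] at hc
    have := ih₁ hc.1 h₁ hs
    have := ih₂ hc.2 h₂ hs
    simp only [Prog.run, Prog.timeBound, Polynomial.eval_add, Polynomial.eval_one,
      Polynomial.eval_C]
    split_ifs <;> dsimp only <;> omega
  | loop e c ih =>
    simp only [Prog.loopsDim, Bool.and_eq_true] at hc
    have hbody (t : Store) (ht : t 0 = s 0) : (c.run t).2 ≤ c.timeBound.eval x :=
      ih hc.2 h0 (by rwa [ht])
    have hsteps := iterate_loopStep_snd_le (c := c) h0 hbody (e.eval s).toNat (e.steps + 1)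
    have hlength : (e.eval s).toNat ≤ e.steps * (x + 1) :=
      Int.toNat_le.2 (Expr.eval_le_of_isDim hs hc.1)
    simp only [Prog.timeBound, Polynomial.eval_add, Polynomial.eval_mul, Polynomial.eval_one,
      Polynomial.eval_C, Polynomial.eval_X]
    exact hsteps.trans (Nat.add_le_add_left (Nat.mul_le_mul_right _ hlength) _)

/-! ## Derived commands and loop rules -/

/-- A scalar variable, stored in entry `(0, 0, 0)` of its array. -/
def Expr.var (a : ℕ) : Expr := .read a (.const 0) (.const 0) (.const 0)

/-- An entry of a vector, stored in the entries `(e, 0, 0)` of its array. -/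
def Expr.vec (a : ℕ) (e : Expr) : Expr := .read a e (.const 0) (.const 0)

/-- An entry of a matrix, stored in the entries `(e₁, e₂, 0)` of its array. -/
def Expr.mat (a : ℕ) (e₁ e₂ : Expr) : Expr := .read a e₁ e₂ (.const 0)

/-- Assignment to a scalar variable. -/
def Prog.setVar (a : ℕ) (e : Expr) : Prog := .assign a (.const 0) (.const 0) (.const 0) e

/-- Assignment to an entry of a vector. -/
def Prog.setVec (a : ℕ) (e₁ e : Expr) : Prog := .assign a e₁ (.const 0) (.const 0) e

/-- Assignment to an entry of a matrix. -/
def Prog.setMat (a : ℕ) (e₁ e₂ e : Expr) : Prog := .assign a e₁ e₂ (.const 0) e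

/-- Case distinction on equality. -/
def Prog.ifEq (e₁ e₂ : Expr) (c₁ c₂ : Prog) : Prog := .ifLe e₁ e₂ (.ifLe e₂ e₁ c₁ c₂) c₂

/-- Case distinction on strict inequality. -/
def Prog.ifLt (e₁ e₂ : Expr) (c₁ c₂ : Prog) : Prog := .ifLe e₂ e₁ c₂ c₁

/-- Run `c` for the values `0, 1, …, e - 1` of the variable `i`. -/
def Prog.forTo (i : ℕ) (e : Expr) (c : Prog) : Prog :=
  .seq (.setVar i (.const 0)) (.loop e (.seq c (.setVar i (.add (.var i) (.const 1)))))

@[simp]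
theorem eval_const (s : Store) (c : ℤ) : (Expr.const c).eval s = c := (rfl)

@[simp]
theorem eval_add (s : Store) (e₁ e₂ : Expr) :
    (Expr.add e₁ e₂).eval s = e₁.eval s + e₂.eval s := (rfl)

@[simp]
theorem eval_sub (s : Store) (e₁ e₂ : Expr) :
    (Expr.sub e₁ e₂).eval s = e₁.eval s - e₂.eval s := (rfl)

@[simp]
theorem eval_var (s : Store) (a : ℕ) : (Expr.var a).eval s = s a 0 0 0 := (rfl)

@[simp]
theorem eval_vec (s : Store) (a : ℕ) (e : Expr) :
    (Expr.vec a e).eval s = s a (e.eval s).toNat 0 0 := (rfl)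

@[simp]
theorem eval_mat (s : Store) (a : ℕ) (e₁ e₂ : Expr) :
    (Expr.mat a e₁ e₂).eval s = s a (e₁.eval s).toNat (e₂.eval s).toNat 0 := (rfl)

@[simp]
theorem exec_setVar (a : ℕ) (e : Expr) (s : Store) :
    exec (.setVar a e) s = s.set a 0 0 0 (e.eval s) := rfl

@[simp]
theorem exec_setVec (a : ℕ) (e₁ e : Expr) (s : Store) :
    exec (.setVec a e₁ e) s = s.set a (e₁.eval s).toNat 0 0 (e.eval s) := rfl

@[simp]
theorem exec_setMat (a : ℕ) (e₁ e₂ e : Expr) (s : Store) :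
    exec (.setMat a e₁ e₂ e) s = s.set a (e₁.eval s).toNat (e₂.eval s).toNat 0 (e.eval s) := rfl

@[simp]
theorem exec_ifEq (e₁ e₂ : Expr) (c₁ c₂ : Prog) (s : Store) :
    exec (.ifEq e₁ e₂ c₁ c₂) s = if e₁.eval s = e₂.eval s then exec c₁ s else exec c₂ s := by
  simp only [Prog.ifEq, exec_ifLe]
  split_ifs <;> first | rfl | omega

@[simp]
theorem exec_ifLt (e₁ e₂ : Expr) (c₁ c₂ : Prog) (s : Store) :
    exec (.ifLt e₁ e₂ c₁ c₂) s = if e₁.eval s < e₂.eval s then exec c₁ s else exec c₂ s := by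
  simp only [Prog.ifLt, exec_ifLe]
  split_ifs <;> first | rfl | omega

section Loop

variable {i : ℕ} {e : Expr} {c : Prog} {s : Store} {m : ℕ}

theorem notMem_writes_forTo {b : ℕ} :
    b ∉ (Prog.forTo i e c).writes ↔ b ≠ i ∧ b ∉ c.writes := by
  simp only [Prog.forTo, Prog.setVar, Prog.writes, List.mem_append, List.mem_singleton]
  tauto

theorem exec_forTo (J : ℕ → Store → Prop) (hJ : ∀ j t v, J j t → J j (t.set i 0 0 0 v))
    (hi : i ∉ c.writes) (he : e.eval (s.set i 0 0 0 0) = m) (h0 : J 0 s)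
    (hs : ∀ (j : ℕ) (t : Store), j < m → (∀ b ∉ (Prog.forTo i e c).writes, t b = s b) →
      t i 0 0 0 = j → J j t → J (j + 1) (exec c t)) :
    J m (exec (.forTo i e c) s) := by
  set body : Prog := .seq c (.setVar i (.add (.var i) (.const 1))) with hbody
  have hrun : exec (.forTo i e c) s = (exec body)^[m] (s.set i 0 0 0 0) := by
    rw [Prog.forTo, exec_seq, exec_setVar, exec_loop, eval_const, he, Int.toNat_natCast]
  have hframe (j : ℕ) : ∀ b ∉ (Prog.forTo i e c).writes,
      (exec body)^[j] (s.set i 0 0 0 0) b = s b := fun b hb => by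
    obtain ⟨hbi, hbc⟩ := notMem_writes_forTo.1 hb
    rw [iterate_exec_of_forall (exec_of_notMem_writes _), Store.set_of_ne _ _ _ _ _ hbi]
    simpa [hbody, Prog.writes, Prog.setVar] using ⟨hbc, hbi⟩
  suffices h : ∀ j ≤ m, (exec body)^[j] (s.set i 0 0 0 0) i 0 0 0 = j ∧
      J j ((exec body)^[j] (s.set i 0 0 0 0)) from hrun ▸ (h m le_rfl).2
  intro j hj
  induction j with
  | zero => exact ⟨by simp [Store.set_apply], hJ _ _ _ h0⟩
  | succ j ih =>
    obtain ⟨hij, hJj⟩ := ih (Nat.le_of_succ_le hj)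
    rw [Function.iterate_succ_apply', hbody, exec_seq, ← hbody, exec_setVar, eval_add, eval_var,
      eval_const, exec_of_notMem_writes hi, hij]
    exact ⟨by simp [Store.set_apply], hJ _ _ _ (hs j _ hj (hframe j) hij hJj)⟩

open Classical in
/-- The rule for loops whose rounds fill sets `Q j` of entries of an array `a` with values that do
not depend on the round. -/
theorem exec_forTo_apply {a : ℕ} (Q : ℕ → ℕ → ℕ → ℕ → Prop) (f : ℕ → ℕ → ℕ → ℤ) (hai : a ≠ i)
    (hi : i ∉ c.writes) (he : e.eval (s.set i 0 0 0 0) = m)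
    (hs : ∀ (j : ℕ) (t : Store), j < m → (∀ b ∉ (Prog.forTo i e c).writes, t b = s b) →
      t i 0 0 0 = j →
      (∀ x y z, t a x y z = if ∃ l < j, Q l x y z then f x y z else s a x y z) →
      ∀ x y z, exec c t a x y z = if Q j x y z then f x y z else t a x y z) (x y z : ℕ) :
    exec (.forTo i e c) s a x y z = if ∃ j < m, Q j x y z then f x y z else s a x y z := by
  revert x y z
  refine exec_forTo
    (fun j t => ∀ x y z, t a x y z = if ∃ l < j, Q l x y z then f x y z else s a x y z)
    (fun j t v h => by rwa [Store.set_of_ne _ _ _ _ _ hai]) hi he (fun x y z => by simp)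
    fun j t hj hframe hij ht x y z => ?_
  rw [hs j t hj hframe hij ht, ht]
  simp only [Nat.lt_succ_iff_lt_or_eq, or_and_right, exists_or, exists_eq_left]
  by_cases hQ : Q j x y z <;> by_cases hl : ∃ l < j, Q l x y z <;>
    simp only [hQ, hl, or_true, or_false, if_true, if_false]

end Loop

/-! ## Augmenting trees of the Hungarian method -/

/-- A partial assignment of the Hungarian method for the `N × N` cost matrix `a`: every column
`c ∈ S` has the row `P c`, or no row if `P c = -1`, each of the rows `0, …, m - 1` belongs to
exactly one column, and the edges used are tight for the feasible dual variables `u`, `v`.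
A column outside of `0, …, N - 1` is virtual and has no costs. -/
structure IsAssignment (N : ℕ) (a : ℕ → ℕ → ℤ) (S : Set ℕ) (m : ℕ) (u v P : ℕ → ℤ) : Prop where
  feasible : ∀ i < N, ∀ j < N, u i + v j ≤ a i j
  range : ∀ c ∈ S, P c = -1 ∨ ∃ i < m, P c = (i : ℕ)
  inj : ∀ c ∈ S, ∀ d ∈ S, ∀ i : ℕ, P c = i → P d = i → c = d
  surj : ∀ i < m, ∃ c ∈ S, P c = (i : ℕ)
  tight : ∀ c ∈ S, c < N → ∀ i : ℕ, P c = i → u i + v c = a i c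

/-- A column `c` with `0 < rank c` has a parent `way c` of smaller positive rank whose row has a
tight edge to `c`. This is only required of the columns `0, …, N - 1` of rank at most `b`. -/
def IsAncestry (N : ℕ) (a : ℕ → ℕ → ℤ) (u v P rank way : ℕ → ℤ) (b : ℤ) : Prop :=
  ∀ c < N, 0 < rank c → rank c ≤ b → ∃ d ≤ N, way c = (d : ℕ) ∧ 0 < rank d ∧ rank d < rank c ∧
    ∃ i : ℕ, P d = i ∧ u i + v c = a i c

/-- The search tree for the row `m`, which is matched to the virtual column `N`, the root of the
tree. The columns of the tree are the root and `g` more columns, those of positive rank. -/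
structure IsSearchTree (N : ℕ) (a : ℕ → ℕ → ℤ) (m : ℕ) (u v P rank way : ℕ → ℤ) (g : ℕ) : Prop
    extends IsAssignment N a (Set.Iic N) (m + 1) u v P where
  root : P N = m
  rank_root : rank N = 1
  rank_le : ∀ c ≤ N, rank c ≤ g + 1
  card_eq : ((Finset.range N).filter fun c => 0 < rank c).card = g
  ancestry : IsAncestry N a u v P rank way (g + 1)

/-- An assignment of the rows `0, …, m` to the columns other than `h`, where `h` is a column of the
search tree. -/
structure IsHole (N : ℕ) (a : ℕ → ℕ → ℤ) (m : ℕ) (u v P rank way : ℕ → ℤ) (h : ℕ) : Prop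
    extends IsAssignment N a (Set.Iic N \ {h}) (m + 1) u v P where
  le : h ≤ N
  rank_pos : 0 < rank h
  ancestry : IsAncestry N a u v P rank way (rank h)

section Hungarian

variable {N m g : ℕ} {a : ℕ → ℕ → ℤ} {S : Set ℕ} {u v P rank way u' v' P' rank' way' : ℕ → ℤ}

theorem IsAssignment.insert_root (h : IsAssignment N a (Set.Iio N) m u v P)
    (hP : ∀ c < N, P' c = P c) (hroot : P' N = m) :
    IsAssignment N a (Set.Iic N) (m + 1) u v P' where
  feasible := h.feasible
  range c hc := by
    obtain hc | rfl := (Set.mem_Iic.1 hc).lt_or_eq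
    · rw [hP c hc]
      exact (h.range c hc).imp_right fun ⟨i, hi, hci⟩ => ⟨i, hi.trans (Nat.lt_succ_self m), hci⟩
    · exact Or.inr ⟨m, Nat.lt_succ_self m, hroot⟩
  inj c hc d hd i hci hdi := by
    have hm (e : ℕ) (he : e < N) (hei : P' e = (i : ℕ)) : i < m := by
      rw [hP e he] at hei
      obtain hnone | ⟨l, hl, hel⟩ := h.range e he <;> omega
    obtain hc | rfl := (Set.mem_Iic.1 hc).lt_or_eq <;>
      obtain hd | rfl := (Set.mem_Iic.1 hd).lt_or_eq
    · exact h.inj c hc d hd i (hP c hc ▸ hci) (hP d hd ▸ hdi)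
    · have := hm c hc hci
      omega
    · have := hm d hd hdi
      omega
    · rfl
  surj i hi := by
    obtain hi | rfl := (Nat.lt_succ_iff.1 hi).lt_or_eq
    · obtain ⟨c, hc, hci⟩ := h.surj i hi
      exact ⟨c, (Set.mem_Iio.1 hc).le, (hP c hc).trans hci⟩
    · exact ⟨N, Set.self_mem_Iic, hroot⟩
  tight c _ hcN i hci := h.tight c hcN hcN i (hP c hcN ▸ hci)

theorem IsAssignment.diff_singleton (h : IsAssignment N a S m u v P) {c : ℕ} (hc : P c = -1) :
    IsAssignment N a (S \ {c}) m u v P where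
  feasible := h.feasible
  range d hd := h.range d hd.1
  inj d hd e he := h.inj d hd.1 e he.1
  surj i hi := by
    obtain ⟨d, hd, hdi⟩ := h.surj i hi
    exact ⟨d, ⟨hd, by rintro rfl; omega⟩, hdi⟩
  tight d hd := h.tight d hd.1

theorem IsAssignment.move {c d : ℕ} (h : IsAssignment N a (S \ {c}) m u v P) (hc : c ∈ S)
    (hd : d ∈ S) (hdc : d ≠ c) (hP : ∀ e, P' e = if e = c then P d else P e)
    (htight : ∀ i : ℕ, P d = i → u i + v c = a i c) :
    IsAssignment N a (S \ {d}) m u v P' where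
  feasible := h.feasible
  range e he := by
    rw [hP]
    split_ifs with hec
    exacts [h.range d ⟨hd, hdc⟩, h.range e ⟨he.1, hec⟩]
  inj e he f hf i hei hfi := by
    rw [hP] at hei hfi
    split_ifs at hei hfi with hec hfc hfc
    · exact hec.trans hfc.symm
    · exact absurd (h.inj d ⟨hd, hdc⟩ f ⟨hf.1, hfc⟩ i hei hfi) (Ne.symm hf.2)
    · exact absurd (h.inj e ⟨he.1, hec⟩ d ⟨hd, hdc⟩ i hei hfi) he.2
    · exact h.inj e ⟨he.1, hec⟩ f ⟨hf.1, hfc⟩ i hei hfi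
  surj i hi := by
    obtain ⟨e, he, hei⟩ := h.surj i hi
    by_cases hed : e = d
    · exact ⟨c, ⟨hc, hdc.symm⟩, by rw [hP, if_pos rfl, ← hed, hei]⟩
    · exact ⟨e, ⟨he.1, hed⟩, by rw [hP, if_neg (by exact he.2), hei]⟩
  tight e he heN i hei := by
    rw [hP] at hei
    split_ifs at hei with hec
    exacts [hec ▸ htight i hei, h.tight e ⟨he.1, hec⟩ heN i hei]

theorem IsSearchTree.of_isAssignment (h : IsAssignment N a (Set.Iio N) m u v P)
    (hP : ∀ c < N, P' c = P c) (hroot : P' N = m) (hrank : ∀ c < N, rank c = 0)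
    (hrank_root : rank N = 1) : IsSearchTree N a m u v P' rank way 0 where
  toIsAssignment := h.insert_root hP hroot
  root := hroot
  rank_root := hrank_root
  rank_le c hc := by
    obtain hc | rfl := hc.lt_or_eq
    · simp [hrank c hc]
    · simp [hrank_root]
  card_eq := by
    rw [Finset.card_eq_zero, Finset.filter_eq_empty_iff]
    exact fun c hc => (hrank c (Finset.mem_range.1 hc)).not_gt
  ancestry c hc hpos := absurd (hrank c hc) hpos.ne'

open Classical in
theorem IsSearchTree.raise (h : IsSearchTree N a m u v P rank way g) {δ : ℤ} (hδ : 0 ≤ δ)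
    (hmin : ∀ c ≤ N, 0 < rank c → ∀ i : ℕ, P c = i → ∀ d < N, rank d ≤ 0 → δ ≤ a i d - u i - v d)
    (hu : ∀ i : ℕ, u' i = if ∃ c ≤ N, 0 < rank c ∧ P c = i then u i + δ else u i)
    (hv : ∀ c < N, v' c = if 0 < rank c then v c - δ else v c) :
    IsSearchTree N a m u' v' P rank way g where
  feasible i hi j hj := by
    have := h.feasible i hi j hj
    rw [hu, hv j hj]
    split_ifs with hi' hj'
    · omega
    · obtain ⟨c, hc, hpos, hci⟩ := hi'
      have := hmin c hc hpos i hci j hj (not_lt.1 hj')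
      omega
    · omega
    · omega
  range := h.range
  inj := h.inj
  surj := h.surj
  tight c hc hcN i hci := by
    have := h.tight c hc hcN i hci
    have hiff : (∃ d ≤ N, 0 < rank d ∧ P d = i) ↔ 0 < rank c :=
      ⟨fun ⟨d, hd, hpos, hdi⟩ => h.inj c hc d hd i hci hdi ▸ hpos, fun hpos => ⟨c, hc, hpos, hci⟩⟩
    rw [hu, hv c hcN, if_congr hiff rfl rfl]
    split_ifs <;> omega
  root := h.root
  rank_root := h.rank_root
  rank_le := h.rank_le
  card_eq := h.card_eq
  ancestry c hc hpos hle := by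
    obtain ⟨d, hd, hway, hdpos, hlt, i, hdi, htight⟩ := h.ancestry c hc hpos hle
    refine ⟨d, hd, hway, hdpos, hlt, i, hdi, ?_⟩
    rw [hu, hv c hc, if_pos ⟨d, hd, hdpos, hdi⟩, if_pos hpos]
    omega

theorem IsSearchTree.insert (h : IsSearchTree N a m u v P rank way g) {c d i : ℕ} (hc : c ≤ N)
    (hcpos : 0 < rank c) (hd : d < N) (hdpos : rank d ≤ 0) (hci : P c = i)
    (htight : u i + v d = a i d) (hrank : ∀ e, rank' e = if e = d then (g : ℤ) + 2 else rank e)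
    (hway : ∀ e, way' e = if e = d then (c : ℤ) else way e) :
    IsSearchTree N a m u v P rank' way' (g + 1) where
  toIsAssignment := h.toIsAssignment
  root := h.root
  rank_root := by rw [hrank, if_neg hd.ne', h.rank_root]
  rank_le e he := by
    have := h.rank_le e he
    rw [hrank]
    split_ifs <;> push_cast <;> omega
  card_eq := by
    have heq : (Finset.range N).filter (fun e => 0 < rank' e) =
        Insert.insert d ((Finset.range N).filter fun e => 0 < rank e) := by
      ext e
      simp only [Finset.mem_filter, Finset.mem_range, Finset.mem_insert, hrank]
      split_ifs with hed <;> omega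
    rw [heq, Finset.card_insert_of_notMem, h.card_eq]
    simp [hdpos]
  ancestry e he hpos _ := by
    have hrank_of_pos {f : ℕ} (hf : 0 < rank f) : rank' f = rank f := by
      rw [hrank, if_neg (by rintro rfl; omega)]
    by_cases hed : e = d
    · have := h.rank_le c hc
      refine ⟨c, hc, by rw [hway, if_pos hed], ?_, ?_, i, hci, hed ▸ htight⟩
      · rwa [hrank_of_pos hcpos]
      · rw [hrank_of_pos hcpos, hrank, if_pos hed]
        omega
    · rw [hrank, if_neg hed] at hpos
      obtain ⟨f, hf, hef, hfpos, hlt, hrow⟩ := h.ancestry e he hpos (h.rank_le e he.le)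
      refine ⟨f, hf, by rw [hway, if_neg hed, hef], ?_, ?_, hrow⟩
      · rwa [hrank_of_pos hfpos]
      · rwa [hrank_of_pos hfpos, hrank_of_pos hpos]

theorem IsSearchTree.le_of_forall_ne (h : IsSearchTree N a m u v P rank way g)
    (hmatched : ∀ c < N, 0 < rank c → P c ≠ -1) : g ≤ m := by
  have hrow (c : ℕ) (hc : c < N ∧ 0 < rank c) : ∃ i < m, P c = (i : ℕ) := by
    obtain hnone | ⟨i, hi, hci⟩ := h.range c hc.1.le
    · exact absurd hnone (hmatched c hc.1 hc.2)
    · refine ⟨i, (Nat.lt_succ_iff.1 hi).lt_of_ne ?_, hci⟩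
      rintro rfl
      exact hc.1.ne (h.inj c hc.1.le N Set.self_mem_Iic i hci h.root)
  choose! f hf using hrow
  rw [← h.card_eq, ← Finset.card_range m]
  refine Finset.card_le_card_of_injOn f ?_ ?_
  · intro c hc
    rw [Finset.mem_coe, Finset.mem_filter, Finset.mem_range] at hc
    exact Finset.mem_coe.2 (Finset.mem_range.2 (hf c hc).1)
  · intro c hc d hd hcd
    rw [Finset.mem_coe, Finset.mem_filter, Finset.mem_range] at hc hd
    exact h.inj c hc.1.le d hd.1.le _ (hf c hc).2 (hcd ▸ (hf d hd).2)

theorem IsSearchTree.exists_rank_nonpos (h : IsSearchTree N a m u v P rank way g) (hg : g < N) :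
    ∃ d < N, rank d ≤ 0 := by
  by_contra! hpos
  have hcard := h.card_eq
  rw [Finset.filter_true_of_mem fun c hc => hpos c (Finset.mem_range.1 hc), Finset.card_range]
    at hcard
  exact hg.ne' hcard

theorem IsSearchTree.isHole (h : IsSearchTree N a m u v P rank way g) {c : ℕ} (hc : c ≤ N)
    (hpos : 0 < rank c) (hP : P c = -1) : IsHole N a m u v P rank way c where
  toIsAssignment := h.diff_singleton hP
  le := hc
  rank_pos := hpos
  ancestry d hd hdpos _ := h.ancestry d hd hdpos (h.rank_le d hd.le)

theorem IsHole.exists_move {c : ℕ} (h : IsHole N a m u v P rank way c) (hcN : c ≠ N) :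
    ∃ d : ℕ, way c = d ∧ rank d < rank c ∧ ∀ P' : ℕ → ℤ,
      (∀ e, P' e = if e = c then P d else P e) → IsHole N a m u v P' rank way d := by
  obtain ⟨d, hd, hway, hdpos, hlt, i, hdi, htight⟩ :=
    h.ancestry c (h.le.lt_of_ne hcN) h.rank_pos le_rfl
  have hdc : d ≠ c := by rintro rfl; exact hlt.false
  refine ⟨d, hway, hlt, fun P' hP => ⟨?_, hd, hdpos, fun e he hepos hele => ?_⟩⟩
  · refine h.move h.le hd hdc hP fun j hj => ?_
    obtain rfl : i = j := Nat.cast_injective (hdi.symm.trans hj)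
    exact htight
  · obtain ⟨f, hf, hef, hfpos, hfe, hrow⟩ := h.ancestry e he hepos (hele.trans hlt.le)
    have hfc : f ≠ c := by rintro rfl; omega
    exact ⟨f, hf, hef, hfpos, hfe, by rwa [hP, if_neg hfc]⟩

theorem IsHole.isAssignment (h : IsHole N a m u v P rank way N) :
    IsAssignment N a (Set.Iio N) (m + 1) u v P :=
  Set.Iic_sdiff_right (a := N) ▸ h.toIsAssignment

theorem IsAssignment.exists_perm (h : IsAssignment N a (Set.Iio N) N u v P) :
    ∃ f : Equiv.Perm (Fin N), ∀ c : Fin N, P c = (f c : ℕ) := by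
  choose! q hq using h.surj
  have hinj : Function.Injective fun i : Fin N => (⟨q i, (hq i i.2).1⟩ : Fin N) := fun i j hij => by
    have hi := (hq i i.2).2
    rw [show q i = q j from congrArg Fin.val hij, (hq j j.2).2] at hi
    exact Fin.ext (Nat.cast_injective hi).symm
  refine ⟨(Equiv.ofBijective _ (Finite.injective_iff_bijective.1 hinj)).symm, fun c => ?_⟩
  obtain ⟨i, rfl⟩ := (Finite.injective_iff_bijective.1 hinj).2 c
  rw [Equiv.ofBijective_symm_apply_apply]
  exact (hq i i.2).2

theorem IsAssignment.sum_le_sum (h : IsAssignment N a (Set.Iio N) N u v P) {f : Equiv.Perm (Fin N)}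
    (hf : ∀ c : Fin N, P c = (f c : ℕ)) (ρ : Equiv.Perm (Fin N)) :
    ∑ c : Fin N, a (f c) c ≤ ∑ c : Fin N, a (ρ c) c :=
  calc ∑ c : Fin N, a (f c) c
      = ∑ c : Fin N, (u (f c) + v c) :=
        Finset.sum_congr rfl fun c _ => (h.tight c c.2 c.2 _ (hf c)).symm
    _ = ∑ c : Fin N, (u (ρ c) + v c) := by
        rw [Finset.sum_add_distrib, Finset.sum_add_distrib, Equiv.sum_comp f fun i : Fin N => u i,
          Equiv.sum_comp ρ fun i : Fin N => u i]
    _ ≤ ∑ c : Fin N, a (ρ c) c := Finset.sum_le_sum fun c _ => h.feasible _ (ρ c).2 _ c.2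

end Hungarian

/-! ## The Hungarian method as a program -/

notation "arrA" => (18 : ℕ)
notation "arrU" => (19 : ℕ)
notation "arrV" => (20 : ℕ)
notation "arrP" => (21 : ℕ)
notation "arrRank" => (22 : ℕ)
notation "arrWay" => (23 : ℕ)
notation "varDelta" => (24 : ℕ)
notation "varFrom" => (25 : ℕ)
notation "varTo" => (26 : ℕ)
notation "varHole" => (27 : ℕ)
notation "idxC" => (28 : ℕ)
notation "idxD" => (29 : ℕ)
notation "idxG" => (30 : ℕ)
notation "idxM" => (31 : ℕ)

open _root_.MRMD.Expr _root_.MRMD.Prog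

/-- The number `n` of demands. -/
def dimN : Expr := var 0

/-- The number `2 n` of rows and columns of the assignment problem. -/
def dimNN : Expr := add dimN dimN

/-- The slack of the edge between the row of the column `e₁` and the column `e₂`. -/
def slackExpr (e₁ e₂ : Expr) : Expr :=
  sub (sub (mat arrA (vec arrP e₁) e₂) (vec arrU (vec arrP e₁))) (vec arrV e₂)

/-- Take the edge from `idxC` to `idxD` as the best edge so far. -/
def takeEdge : Prog := seq (setVar varFrom (var idxC)) (setVar varTo (var idxD))

/-- Compare the edge from `idxC` to `idxD`, if it leaves the tree, with the best edge so far. -/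
def compareEdge : Prog :=
  ifLt (const 0) (vec arrRank (var idxC))
    (ifLe (vec arrRank (var idxD)) (const 0)
      (ifLe (const 0) (var varFrom)
        (ifLt (slackExpr (var idxC) (var idxD)) (slackExpr (var varFrom) (var varTo)) takeEdge skip)
        takeEdge)
      skip)
    skip

/-- Find an edge of minimum slack that leaves the tree. -/
def scan : Prog :=
  seq (setVar varFrom (const (-1)))
    (forTo idxC (add dimNN (const 1)) (forTo idxD dimNN compareEdge))

/-- Change the dual variables of the column `idxC`, if it is in the tree, and of its row. -/
def raiseColumn : Prog :=
  ifLt (const 0) (vec arrRank (var idxC))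
    (seq (setVec arrU (vec arrP (var idxC)) (add (vec arrU (vec arrP (var idxC))) (var varDelta)))
      (setVec arrV (var idxC) (sub (vec arrV (var idxC)) (var varDelta))))
    skip

/-- Change the dual variables of the tree so that the best edge becomes tight. -/
def raise : Prog :=
  seq (setVar varDelta (slackExpr (var varFrom) (var varTo)))
    (forTo idxC (add dimNN (const 1)) raiseColumn)

/-- Add the best edge to the tree. -/
def attach : Prog :=
  seq (setVec arrWay (var varTo) (var varFrom))
    (setVec arrRank (var varTo) (add (var idxG) (const 2)))

/-- Unless an unmatched column has been found, add a column to the tree. -/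
def growTree : Prog :=
  ifLt (var varHole) (const 0)
    (seq scan (seq raise (seq attach
      (ifLt (vec arrP (var varTo)) (const 0) (setVar varHole (var varTo)) skip))))
    skip

/-- Move the unmatched column towards the root. -/
def augment : Prog :=
  ifLt (var varHole) dimNN
    (seq (setVec arrP (var varHole) (vec arrP (vec arrWay (var varHole))))
      (setVar varHole (vec arrWay (var varHole))))
    skip

/-- Start a tree for the row `idxM`. -/
def startTree : Prog :=
  seq (setVec arrP dimNN (var idxM))
    (seq (forTo idxC dimNN (setVec arrRank (var idxC) (const 0)))
      (seq (setVec arrRank dimNN (const 1)) (setVar varHole (const (-1)))))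

/-- Match the row `idxM`. -/
def insertRow : Prog :=
  seq startTree (seq (forTo idxG dimNN growTree) (loop (add dimNN (const 1)) augment))

/-- Start without matched rows and with dual variables zero. -/
def initAssignment : Prog :=
  forTo idxC dimNN
    (seq (setVec arrP (var idxC) (const (-1)))
      (seq (setVec arrU (var idxC) (const 0)) (setVec arrV (var idxC) (const 0))))

/-- The Hungarian method, which finds an assignment of minimum cost for the matrix `arrA`. -/
def hungarian : Prog := seq initAssignment (forTo idxM dimNN insertRow)

/-- The slack of the edge between the row of the column `c` and the column `d`. -/
def slack (s : Store) (c d : ℕ) : ℤ :=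
  s arrA (s arrP c 0 0).toNat d 0 - s arrU (s arrP c 0 0).toNat 0 0 - s arrV d 0 0

/-- The edges that leave the tree, as pairs of columns. -/
def cut (N : ℕ) (s : Store) : Set (ℕ × ℕ) :=
  {q | q.1 ≤ N ∧ 0 < s arrRank q.1 0 0 ∧ q.2 < N ∧ s arrRank q.2 0 0 ≤ 0}

/-- The pair `(x, y)` minimizes `f` on `S`, where `x = -1` means that `S` is empty. -/
def IsArgmin (S : Set (ℕ × ℕ)) (f : ℕ → ℕ → ℤ) (x y : ℤ) : Prop :=
  x = -1 ∧ S = ∅ ∨ ∃ c d : ℕ, x = c ∧ y = d ∧ (c, d) ∈ S ∧ ∀ q ∈ S, f c d ≤ f q.1 q.2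

/-- The assignment in the memory. -/
def HasAssignment (N m : ℕ) (s : Store) : Prop :=
  IsAssignment N (fun i j => s arrA i j 0) (Set.Iio N) m (fun i => s arrU i 0 0)
    (fun j => s arrV j 0 0) (fun c => s arrP c 0 0)

/-- The search tree in the memory. -/
def HasSearchTree (N m : ℕ) (s : Store) (g : ℕ) : Prop :=
  IsSearchTree N (fun i j => s arrA i j 0) m (fun i => s arrU i 0 0) (fun j => s arrV j 0 0)
    (fun c => s arrP c 0 0) (fun c => s arrRank c 0 0) (fun c => s arrWay c 0 0) g

/-- The assignment in the memory, with a hole at the column `h`. -/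
def HasHole (N m : ℕ) (s : Store) (h : ℕ) : Prop :=
  IsHole N (fun i j => s arrA i j 0) m (fun i => s arrU i 0 0) (fun j => s arrV j 0 0)
    (fun c => s arrP c 0 0) (fun c => s arrRank c 0 0) (fun c => s arrWay c 0 0) h

/-- The state after `g` rounds of the search for an unmatched column: either all `g` columns of the
tree are matched, or an unmatched column of the tree is stored in `varHole`. -/
def SearchState (N m g : ℕ) (s : Store) : Prop :=
  (s varHole 0 0 0 < 0 ∧ HasSearchTree N m s g ∧
    ∀ c < N, 0 < s arrRank c 0 0 → s arrP c 0 0 ≠ -1) ∨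
  ∃ h : ℕ, s varHole 0 0 0 = h ∧ HasHole N m s h ∧ s arrRank h 0 0 ≤ N + 1

section Hungarian

variable {N m g c d : ℕ} {s t : Store}

theorem eval_dimNN_congr (h : t 0 = s 0) : dimNN.eval t = dimNN.eval s := by
  simp [dimNN, dimN, h]

theorem eval_dimNN_add_one (hN : dimNN.eval s = N) :
    (add dimNN (const 1)).eval s = (N + 1 : ℕ) := by
  simp [hN]

theorem eval_slackExpr {e₁ e₂ : Expr} (hc : e₁.eval t = c) (hd : e₂.eval t = d)
    (ht : ∀ b ∈ [arrA, arrU, arrV, arrP], t b = s b) : (slackExpr e₁ e₂).eval t = slack s c d := by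
  simp only [List.forall_mem_cons] at ht
  obtain ⟨hA, hU, hV, hP, -⟩ := ht
  simp [slackExpr, slack, hc, hd, hA, hU, hV, hP]

theorem isArgmin_compareEdge {T : Set (ℕ × ℕ)} (hC : t idxC 0 0 0 = c) (hD : t idxD 0 0 0 = d)
    (hc : c ≤ N) (hd : d < N) (ht : ∀ b ∈ [arrA, arrU, arrV, arrP], t b = s b)
    (hrank : t arrRank = s arrRank)
    (h : IsArgmin (T ∩ cut N s) (slack s) (t varFrom 0 0 0) (t varTo 0 0 0)) :
    IsArgmin (insert (c, d) T ∩ cut N s) (slack s) (exec compareEdge t varFrom 0 0 0)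
      (exec compareEdge t varTo 0 0 0) := by
  have hslack : (slackExpr (var idxC) (var idxD)).eval t = slack s c d := eval_slackExpr hC hD ht
  by_cases hcut : (c, d) ∈ cut N s
  · have hcut' := hcut
    obtain ⟨-, hcpos : 0 < s arrRank c 0 0, -, hdpos : s arrRank d 0 0 ≤ 0⟩ := hcut'
    rw [Set.insert_inter_of_mem hcut]
    obtain ⟨hnone, hempty⟩ | ⟨c', d', hc', hd', hmem, hmin⟩ := h
    · rw [hempty]
      refine Or.inr ⟨c, d, ?_, ?_, by simp, by simp⟩ <;>
        simp [compareEdge, takeEdge, hC, hD, hrank, hnone, hcpos, hdpos]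
    · have hslack' : (slackExpr (var varFrom) (var varTo)).eval t = slack s c' d' :=
        eval_slackExpr hc' hd' ht
      by_cases hlt : slack s c d < slack s c' d'
      · refine Or.inr ⟨c, d, ?_, ?_, by simp, ?_⟩
        · simp [compareEdge, takeEdge, hC, hD, hrank, hc', hslack, hslack', hlt,
            hcpos, hdpos]
        · simp [compareEdge, takeEdge, hC, hD, hrank, hc', hslack, hslack', hlt,
            hcpos, hdpos]
        · rintro q (rfl | hq)
          exacts [le_rfl, hlt.le.trans (hmin q hq)]
      · refine Or.inr ⟨c', d', ?_, ?_, Set.mem_insert_of_mem _ hmem, ?_⟩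
        · simp [compareEdge, hC, hD, hrank, hc', hslack, hslack', hlt]
        · simp [compareEdge, takeEdge, hC, hD, hrank, hc', hd', hslack, hslack', hlt]
        · rintro q (rfl | hq)
          exacts [not_lt.1 hlt, hmin q hq]
  · have hskip : exec compareEdge t = t := by
      simp only [cut, Set.mem_ofPred_eq, hc, hd, true_and, not_and, not_le] at hcut
      by_cases hcpos : 0 < s arrRank c 0 0
      · simp [compareEdge, hC, hD, hrank, (hcut hcpos).not_ge]
      · simp [compareEdge, hC, hrank, hcpos]
    rwa [hskip, Set.insert_inter_of_notMem hcut]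

theorem isArgmin_scan (hN : dimNN.eval s = N) :
    IsArgmin (cut N s) (slack s) (exec scan s varFrom 0 0 0) (exec scan s varTo 0 0 0) := by
  set J : Set (ℕ × ℕ) → Store → Prop := fun T t =>
    IsArgmin (T ∩ cut N s) (slack s) (t varFrom 0 0 0) (t varTo 0 0 0) with hJ
  suffices h : J {q | q.1 < N + 1} (exec scan s) by
    have hcut : {q | q.1 < N + 1} ∩ cut N s = cut N s :=
      Set.inter_eq_right.2 fun q hq => Nat.lt_succ_of_le hq.1
    rwa [hJ, hcut] at h
  rw [scan, exec_seq]
  refine exec_forTo (fun j => J {q | q.1 < j}) (fun _ _ _ h => h) (by decide)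
    (eval_dimNN_add_one hN)
    (Or.inl ⟨by simp, by simp⟩) fun j t hj ht hC h => ?_
  have hround := exec_forTo (i := idxD) (e := dimNN) (c := compareEdge) (s := t) (m := N)
    (fun l => J {q | q.1 < j ∨ q.1 = j ∧ q.2 < l}) (fun _ _ _ h => h) (by decide) ?_ ?_
    fun l t' hl ht' hD h' => ?_
  · have hset : {q : ℕ × ℕ | q.1 < j ∨ q.1 = j ∧ q.2 < N} ∩ cut N s =
        {q | q.1 < j + 1} ∩ cut N s := by
      ext q
      simp [cut]
      omega
    simpa only [hJ, hset] using hround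
  · exact (eval_dimNN_congr (ht 0 (by decide))).trans hN
  · simpa using h
  · have hset : insert (j, l) {q : ℕ × ℕ | q.1 < j ∨ q.1 = j ∧ q.2 < l} =
        {q | q.1 < j ∨ q.1 = j ∧ q.2 < l + 1} := by
      ext q
      simp [Prod.ext_iff]
      omega
    refine hset ▸ isArgmin_compareEdge ?_ hD (Nat.le_of_lt_succ hj) hl ?_ ?_ h'
    · rw [ht' idxC (by decide), hC]
    · exact fun b hb => (ht' b (by revert b; decide)).trans <|
        (ht b (by revert b; decide)).trans (exec_of_notMem_writes (by revert b; decide) s)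
    · exact (ht' _ (by decide)).trans (ht _ (by decide))

theorem HasSearchTree.exists_row (h : HasSearchTree N m s g)
    (hmatched : ∀ c < N, 0 < s arrRank c 0 0 → s arrP c 0 0 ≠ -1) (hc : c ≤ N)
    (hpos : 0 < s arrRank c 0 0) : ∃ i ≤ m, s arrP c 0 0 = (i : ℕ) := by
  obtain hc | rfl := hc.lt_or_eq
  · obtain hnone | ⟨i, hi, hci⟩ := h.range c hc.le
    exacts [absurd hnone (hmatched c hc hpos), ⟨i, Nat.le_of_lt_succ hi, hci⟩]
  · exact ⟨m, le_rfl, h.root⟩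

open Classical in
theorem exec_raise_arrU (hN : dimNN.eval s = N) (hc : s varFrom 0 0 0 = c) (hd : s varTo 0 0 0 = d)
    (hinj : ∀ c ≤ N, ∀ d ≤ N, 0 < s arrRank c 0 0 → 0 < s arrRank d 0 0 →
      (s arrP c 0 0).toNat = (s arrP d 0 0).toNat → c = d) (i : ℕ) :
    exec raise s arrU i 0 0 =
      if ∃ j < N + 1, 0 < s arrRank j 0 0 ∧ i = (s arrP j 0 0).toNat then
        s arrU i 0 0 + slack s c d else s arrU i 0 0 := by
  have hδ : (slackExpr (var varFrom) (var varTo)).eval s = slack s c d :=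
    eval_slackExpr hc hd fun _ _ => rfl
  have hloop := exec_forTo_apply (a := arrU) (i := idxC) (c := raiseColumn)
    (e := add dimNN (const 1)) (s := s.set varDelta 0 0 0 (slack s c d)) (m := N + 1)
    (fun j x y z => 0 < s arrRank j 0 0 ∧ x = (s arrP j 0 0).toNat ∧ y = 0 ∧ z = 0)
    (fun x y z => s arrU x y z + slack s c d) (by decide) (by decide) (eval_dimNN_add_one hN)
    (fun j t hj ht hC h x y z => ?_) i 0 0
  · simpa [raise, hδ] using hloop
  · have hP : t arrP = s arrP := ht _ (by decide)
    have hrank : t arrRank = s arrRank := ht _ (by decide)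
    have hdelta : t varDelta 0 0 0 = slack s c d := by rw [ht _ (by decide)]; simp
    by_cases hpos : 0 < s arrRank j 0 0
    · have hrow : t arrU (s arrP j 0 0).toNat 0 0 = s arrU (s arrP j 0 0).toNat 0 0 := by
        rw [h, if_neg]
        · exact congrFun₃ (Store.set_of_ne _ _ _ _ _ (by decide)) _ _ _
        · rintro ⟨l, hl, hlpos, hlj, -⟩
          exact hl.ne (hinj l (by omega) j (by omega) hlpos hpos hlj.symm)
      simp only [raiseColumn, exec_ifLt, eval_const, eval_vec, eval_var, hC, Int.toNat_natCast,
        hrank, hpos, if_true, exec_seq, exec_setVec, Store.set_apply, eval_add, eval_sub, hP,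
        hrow, hdelta, true_and]
      by_cases hx : x = (s arrP j 0 0).toNat ∧ y = 0 ∧ z = 0
      · obtain ⟨rfl, rfl, rfl⟩ := hx
        simp
      · simp [hx]
    · simp [raiseColumn, hC, hrank, hpos]

open Classical in
theorem exec_raise_arrV (hN : dimNN.eval s = N) (hc : s varFrom 0 0 0 = c) (hd : s varTo 0 0 0 = d)
    {j : ℕ} (hj : j < N) : exec raise s arrV j 0 0 =
      if 0 < s arrRank j 0 0 then s arrV j 0 0 - slack s c d else s arrV j 0 0 := by
  have hδ : (slackExpr (var varFrom) (var varTo)).eval s = slack s c d :=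
    eval_slackExpr hc hd fun _ _ => rfl
  have hloop := exec_forTo_apply (a := arrV) (i := idxC) (c := raiseColumn)
    (e := add dimNN (const 1)) (s := s.set varDelta 0 0 0 (slack s c d)) (m := N + 1)
    (fun j x y z => 0 < s arrRank j 0 0 ∧ x = j ∧ y = 0 ∧ z = 0)
    (fun x y z => s arrV x y z - slack s c d) (by decide) (by decide) (eval_dimNN_add_one hN)
    (fun j t hj ht hC h x y z => ?_) j 0 0
  · simpa [raise, hδ, hj.trans (Nat.lt_succ_self N)] using hloop
  · have hrank : t arrRank = s arrRank := ht _ (by decide)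
    have hdelta : t varDelta 0 0 0 = slack s c d := by rw [ht _ (by decide)]; simp
    have hcol : t arrV j 0 0 = s arrV j 0 0 := by
      rw [h, if_neg]
      · exact congrFun₃ (Store.set_of_ne _ _ _ _ _ (by decide)) _ _ _
      · rintro ⟨l, hl, -, rfl, -⟩
        exact hl.false
    by_cases hpos : 0 < s arrRank j 0 0
    · by_cases hx : x = j ∧ y = 0 ∧ z = 0
      · obtain ⟨rfl, rfl, rfl⟩ := hx
        simp [raiseColumn, hC, hrank, hpos, hcol, hdelta]
      · simp [raiseColumn, hC, hrank, hpos, hx]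
    · simp [raiseColumn, hC, hrank, hpos]

theorem HasSearchTree.raise (h : HasSearchTree N m s g) (hN : dimNN.eval s = N) (hm : m < N)
    (hmatched : ∀ c < N, 0 < s arrRank c 0 0 → s arrP c 0 0 ≠ -1) (hc : s varFrom 0 0 0 = c)
    (hd : s varTo 0 0 0 = d) (hcd : (c, d) ∈ cut N s)
    (hmin : ∀ q ∈ cut N s, slack s c d ≤ slack s q.1 q.2) :
    HasSearchTree N m (exec raise s) g ∧ slack (exec raise s) c d = 0 := by
  have hA : exec MRMD.raise s arrA = s arrA := exec_of_notMem_writes (by decide) s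
  have hP : exec MRMD.raise s arrP = s arrP := exec_of_notMem_writes (by decide) s
  have hrank : exec MRMD.raise s arrRank = s arrRank := exec_of_notMem_writes (by decide) s
  have hway : exec MRMD.raise s arrWay = s arrWay := exec_of_notMem_writes (by decide) s
  have hrow {e : ℕ} (he : e ≤ N) (hpos : 0 < s arrRank e 0 0) (i : ℕ) :
      i = (s arrP e 0 0).toNat ↔ s arrP e 0 0 = i := by
    obtain ⟨l, -, hl⟩ := h.exists_row hmatched he hpos
    omega
  have hU := exec_raise_arrU hN hc hd fun e he e' he' hpos hpos' hee' =>
    h.inj e he e' he' _ ((hrow he hpos _).1 rfl) ((hrow he' hpos' _).1 hee')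
  obtain ⟨hcN : c ≤ N, hcpos : 0 < s arrRank c 0 0, hdN : d < N, hdpos : s arrRank d 0 0 ≤ 0⟩ := hcd
  constructor
  · rw [HasSearchTree, hA, hP, hrank, hway]
    refine IsSearchTree.raise h (δ := slack s c d) ?_ (fun e he hpos i hi e' he' hpos' => ?_)
      (fun i => ?_) fun e he => exec_raise_arrV hN hc hd he
    · obtain ⟨i, hi, hci⟩ := h.exists_row hmatched hcN hcpos
      have := h.feasible i (hi.trans_lt hm) d hdN
      simp only [slack, hci, Int.toNat_natCast]
      omega
    · rw [(hrow he hpos i).2 hi]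
      exact hmin (e, e') ⟨he, hpos, he', hpos'⟩
    · rw [hU]
      refine if_congr (exists_congr fun e => ?_) rfl rfl
      rw [Nat.lt_succ_iff]
      exact and_congr_right fun he => and_congr_right fun hpos => hrow he hpos i
  · have hmem : ∃ j < N + 1, 0 < s arrRank j 0 0 ∧ (s arrP c 0 0).toNat = (s arrP j 0 0).toNat :=
      ⟨c, Nat.lt_succ_of_le hcN, hcpos, rfl⟩
    rw [slack, hA, hP, hU, if_pos hmem, exec_raise_arrV hN hc hd hdN, if_neg hdpos.not_gt, slack]
    omega

theorem HasSearchTree.attach (h : HasSearchTree N m s g) (hc : s varFrom 0 0 0 = c)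
    (hd : s varTo 0 0 0 = d) (hg : s idxG 0 0 0 = g) (hcd : (c, d) ∈ cut N s)
    (hrow : 0 ≤ s arrP c 0 0) (hslack : slack s c d = 0) :
    HasSearchTree N m (exec attach s) (g + 1) := by
  refine IsSearchTree.insert h hcd.1 hcd.2.1 hcd.2.2.1 hcd.2.2.2 (Int.toNat_of_nonneg hrow).symm ?_
    (fun e => ?_) fun e => ?_
  · change s arrU (s arrP c 0 0).toNat 0 0 + s arrV d 0 0 = s arrA (s arrP c 0 0).toNat d 0
    rw [slack] at hslack
    omega
  · simp [MRMD.attach, hd, hg]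
  · simp [MRMD.attach, hd, hc]

theorem HasSearchTree.congr (h : HasSearchTree N m s g)
    (ht : ∀ b ∈ [arrA, arrU, arrV, arrP, arrRank, arrWay], t b = s b) : HasSearchTree N m t g := by
  simp only [List.forall_mem_cons] at ht
  obtain ⟨hA, hU, hV, hP, hrank, hway, -⟩ := ht
  rwa [HasSearchTree, hA, hU, hV, hP, hrank, hway]

theorem HasSearchTree.extend (h : HasSearchTree N m s g) (hN : dimNN.eval s = N) (hm : m < N)
    (hg : g < N) (hmatched : ∀ c < N, 0 < s arrRank c 0 0 → s arrP c 0 0 ≠ -1)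
    (hG : s idxG 0 0 0 = g) :
    ∃ d < N, ∃ t, exec MRMD.attach (exec MRMD.raise (exec scan s)) = t ∧ t varTo 0 0 0 = d ∧
      HasSearchTree N m t (g + 1) ∧
      ∀ e, t arrRank e 0 0 = if e = d then (g : ℤ) + 2 else s arrRank e 0 0 := by
  obtain ⟨d₀, hd₀, hd₀pos⟩ := h.exists_rank_nonpos hg
  have hne : (N, d₀) ∈ cut N s := ⟨le_rfl, h.rank_root.symm ▸ zero_lt_one, hd₀, hd₀pos⟩
  obtain ⟨-, hempty⟩ | ⟨c, d, hc, hd, hcd, hmin⟩ := isArgmin_scan hN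
  · simp [hempty] at hne
  set s₁ := exec scan s with hs₁
  have hscan (b : ℕ) (hb : b ∉ scan.writes := by decide) : s₁ b = s b := exec_of_notMem_writes hb s
  have hcut₁ : cut N s₁ = cut N s := by rw [cut, hscan arrRank, cut]
  have hslack₁ : slack s₁ = slack s := by
    funext e e'
    rw [slack, hscan arrA, hscan arrU, hscan arrV, hscan arrP, slack]
  rw [← hcut₁, ← hslack₁] at hmin
  rw [← hcut₁] at hcd
  have h₁ : HasSearchTree N m s₁ g := h.congr fun b hb => hscan b (by revert b; decide)
  have hmatched₁ : ∀ c < N, 0 < s₁ arrRank c 0 0 → s₁ arrP c 0 0 ≠ -1 := by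
    rwa [hscan arrRank, hscan arrP]
  have hraise (b : ℕ) (hb : b ∉ MRMD.raise.writes := by decide) : exec MRMD.raise s₁ b = s₁ b :=
    exec_of_notMem_writes hb s₁
  obtain ⟨h₂, hslack₂⟩ :=
    h₁.raise ((eval_dimNN_congr (hscan 0)).trans hN) hm hmatched₁ hc hd hcd hmin
  obtain ⟨i, -, hi⟩ := h₁.exists_row hmatched₁ hcd.1 hcd.2.1
  refine ⟨d, hcd.2.2.1, _, rfl, ?_, h₂.attach (c := c) (d := d) ?_ ?_ ?_ ?_ ?_ hslack₂, fun e => ?_⟩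
  · simp [MRMD.attach, hraise varTo, hd]
  · rw [hraise varFrom, hc]
  · rw [hraise varTo, hd]
  · rw [hraise idxG, hscan idxG, hG]
  · rwa [cut, hraise arrRank]
  · rw [hraise arrP, hi]
    positivity
  · simp [MRMD.attach, hraise varTo, hraise idxG, hraise arrRank, hscan idxG, hscan arrRank, hd, hG]

theorem SearchState.exec_growTree (h : SearchState N m g s) (hN : dimNN.eval s = N) (hm : m < N)
    (hg : g < N) (hG : s idxG 0 0 0 = g) : SearchState N m (g + 1) (exec growTree s) := by
  obtain ⟨hhole, htree, hmatched⟩ | ⟨c, hhole, hc⟩ := h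
  · obtain ⟨d, hd, t, ht, htd, htree', hrank⟩ := htree.extend hN hm hg hmatched hG
    have hhole' : t varHole = s varHole := by
      rw [← ht, exec_of_notMem_writes (by decide), exec_of_notMem_writes (by decide),
        exec_of_notMem_writes (by decide)]
    have hrun : exec growTree s = if t arrP d 0 0 < 0 then t.set varHole 0 0 0 d else t := by
      simp [growTree, hhole, ht, htd]
    rw [hrun]
    obtain hnone | ⟨i, -, hi⟩ := htree'.range d hd.le
    · have hdpos : 0 < t arrRank d 0 0 := by rw [hrank, if_pos rfl]; positivity
      rw [if_pos (hnone.trans_lt (by decide))]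
      refine Or.inr ⟨d, by simp, htree'.isHole hd.le hdpos hnone, ?_⟩
      have := hrank d
      simp only [Store.set_apply]
      simp
      omega
    · rw [if_neg (by omega)]
      refine Or.inl ⟨hhole' ▸ hhole, htree', fun e he hepos => ?_⟩
      by_cases hed : e = d
      · subst hed; omega
      · have hP : t arrP = s arrP := by
          rw [← ht, exec_of_notMem_writes (by decide), exec_of_notMem_writes (by decide),
            exec_of_notMem_writes (by decide)]
        rw [hrank, if_neg hed] at hepos
        exact hP ▸ hmatched e he hepos
  · have hrun : exec growTree s = s := by simp [growTree, hhole]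
    exact hrun.symm ▸ Or.inr ⟨c, hhole, hc⟩

theorem HasHole.exec_augment (h : HasHole N m s c) (hN : dimNN.eval s = N)
    (hc : s varHole 0 0 0 = c) :
    ∃ d : ℕ, exec augment s varHole 0 0 0 = d ∧ HasHole N m (exec augment s) d ∧
      exec augment s arrRank = s arrRank ∧ (d = N ∨ c ≠ N ∧ s arrRank d 0 0 < s arrRank c 0 0) := by
  have hframe (b : ℕ) (hb : b ∉ augment.writes := by decide) : exec augment s b = s b :=
    exec_of_notMem_writes hb s
  obtain hcN | rfl := h.le.lt_or_eq
  · obtain ⟨d, hway, hlt, hmove⟩ := IsHole.exists_move h hcN.ne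
    refine ⟨d, ?_, ?_, hframe arrRank, Or.inr ⟨hcN.ne, hlt⟩⟩
    · simp [augment, hc, hN, hcN, hway]
    · rw [HasHole, hframe arrA, hframe arrU, hframe arrV, hframe arrRank, hframe arrWay]
      refine hmove _ fun e => ?_
      simp [augment, hc, hN, hcN, hway]
  · have hrun : exec augment s = s := by simp [augment, hc, hN]
    exact ⟨c, by rw [hrun, hc], by rwa [hrun], hframe arrRank, Or.inl rfl⟩

theorem HasHole.hasAssignment_loop_augment (h : HasHole N m s c) (hN : dimNN.eval s = N)
    (hc : s varHole 0 0 0 = c) (hrank : s arrRank c 0 0 ≤ N + 1) :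
    HasAssignment N (m + 1) (exec (loop (add dimNN (const 1)) augment) s) := by
  suffices hJ : ∀ j : ℕ, ∃ d : ℕ, dimNN.eval ((exec augment)^[j] s) = N ∧
      (exec augment)^[j] s varHole 0 0 0 = d ∧ HasHole N m ((exec augment)^[j] s) d ∧
      (d = N ∨ (exec augment)^[j] s arrRank d 0 0 + j ≤ N + 1) by
    rw [exec_loop, eval_dimNN_add_one hN, Int.toNat_natCast]
    obtain ⟨d, -, -, hd, rfl | hle⟩ := hJ (N + 1)
    · exact IsHole.isAssignment hd
    · have := hd.rank_pos
      omega
  intro j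
  induction j with
  | zero => exact ⟨c, hN, hc, h, Or.inr (by simpa using hrank)⟩
  | succ j ih =>
    obtain ⟨d, hN', hd, hhole, hle⟩ := ih
    obtain ⟨e, he, hhole', hrank', hlt⟩ := hhole.exec_augment hN' hd
    rw [Function.iterate_succ_apply']
    refine ⟨e, (eval_dimNN_congr (exec_of_notMem_writes (by decide) _)).trans hN', he, hhole', ?_⟩
    rw [hrank']
    push_cast
    omega

theorem HasAssignment.exec_startTree (h : HasAssignment N m s) (hN : dimNN.eval s = N)
    (hM : s idxM 0 0 0 = m) : SearchState N m 0 (exec startTree s) := by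
  set clear : Prog := forTo idxC dimNN (setVec arrRank (var idxC) (const 0)) with hclear
  set s₁ := exec clear (s.set arrP N 0 0 m) with hs₁
  have hframe (b : ℕ) (hb : b ∉ clear.writes) : s₁ b = s.set arrP N 0 0 m b :=
    exec_of_notMem_writes hb _
  have hN₁ : dimNN.eval s₁ = N := (eval_dimNN_congr (hframe 0 (by decide))).trans hN
  have hzero : ∀ c < N, s₁ arrRank c 0 0 = 0 := by
    refine exec_forTo (fun j t => ∀ c < j, t arrRank c 0 0 = 0) (fun _ _ _ h => h) (by decide) hN
      (by simp) fun j t _ _ hC h c hc => ?_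
    obtain hc | rfl := (Nat.le_of_lt_succ hc).lt_or_eq
    · simp [hC, hc.ne, h c hc]
    · simp [hC]
  have hrun : exec startTree s = (s₁.set arrRank N 0 0 1).set varHole 0 0 0 (-1) := by
    simp [startTree, hM, hN, ← hclear, ← hs₁, hN₁]
  rw [hrun]
  refine Or.inl ⟨by simp, ?_, fun c hc hpos => ?_⟩
  · refine IsSearchTree.of_isAssignment (P := fun c => s arrP c 0 0) ?_ (fun c hc => ?_) ?_
      (fun c hc => ?_) ?_
    · simpa [HasAssignment, hframe arrA (by decide), hframe arrU (by decide),
        hframe arrV (by decide)] using h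
    · simp [hframe arrP (by decide), hc.ne]
    · simp [hframe arrP (by decide)]
    · simp [hc.ne, hzero c hc]
    · simp
  · simp [hc.ne, hzero c hc] at hpos

theorem HasAssignment.exec_insertRow (h : HasAssignment N m s) (hN : dimNN.eval s = N)
    (hm : m < N) (hM : s idxM 0 0 0 = m) : HasAssignment N (m + 1) (exec insertRow s) := by
  have hN₁ : dimNN.eval (exec startTree s) = N :=
    (eval_dimNN_congr (exec_of_notMem_writes (by decide) s)).trans hN
  have hgrow : SearchState N m N (exec (forTo idxG dimNN growTree) (exec startTree s)) :=
    exec_forTo (fun g t => SearchState N m g t) (fun _ _ _ h => h) (by decide) hN₁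
      (h.exec_startTree hN hM) fun g t hg ht hG hstate =>
        hstate.exec_growTree ((eval_dimNN_congr (ht 0 (by decide))).trans hN₁) hm hg hG
  obtain ⟨-, htree, hmatched⟩ | ⟨c, hc, hhole, hrank⟩ := hgrow
  · exact absurd (htree.le_of_forall_ne hmatched) hm.not_ge
  · exact hhole.hasAssignment_loop_augment
      ((eval_dimNN_congr (exec_of_notMem_writes (by decide) _)).trans hN₁) hc hrank

theorem hasAssignment_initAssignment (hN : dimNN.eval s = N)
    (hA : ∀ i < N, ∀ j < N, 0 ≤ s arrA i j 0) : HasAssignment N 0 (exec initAssignment s) := by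
  have hA' : exec initAssignment s arrA = s arrA := exec_of_notMem_writes (by decide) s
  have hinit : ∀ c < N, exec initAssignment s arrP c 0 0 = -1 ∧
      exec initAssignment s arrU c 0 0 = 0 ∧ exec initAssignment s arrV c 0 0 = 0 := by
    refine exec_forTo
      (fun j t => ∀ c < j, t arrP c 0 0 = -1 ∧ t arrU c 0 0 = 0 ∧ t arrV c 0 0 = 0)
      (fun _ _ _ h => h) (by decide) hN (by simp) fun j t _ _ hC h c hc => ?_
    obtain hc | rfl := (Nat.le_of_lt_succ hc).lt_or_eq
    · simp [hC, hc.ne, h c hc]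
    · simp [hC]
  exact
    { feasible := fun i hi j hj => by simpa [hA', hinit i hi, hinit j hj] using hA i hi j hj
      range := fun c hc => Or.inl (hinit c hc).1
      inj := fun c hc d _ i hci => by
        have := (hinit c hc).1
        omega
      surj := by simp
      tight := fun c hc _ i hci => by
        have := (hinit c hc).1
        omega }

theorem hasAssignment_hungarian (hN : dimNN.eval s = N)
    (hA : ∀ i < N, ∀ j < N, 0 ≤ s arrA i j 0) : HasAssignment N N (exec hungarian s) := by
  have hN₁ : dimNN.eval (exec initAssignment s) = N :=
    (eval_dimNN_congr (exec_of_notMem_writes (by decide) s)).trans hN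
  exact exec_forTo (fun m t => HasAssignment N m t) (fun _ _ _ h => h) (by decide) hN₁
    (hasAssignment_initAssignment hN hA) fun m t hm ht hM h =>
      h.exec_insertRow ((eval_dimNN_congr (ht 0 (by decide))).trans hN₁) hm hM

end Hungarian

/-! ## Algorithm A as a program -/

notation "varStart" => (15 : ℕ)
notation "varBig" => (16 : ℕ)
notation "varOk" => (33 : ℕ)
notation "arrNext" => (34 : ℕ)
notation "arrCost" => (35 : ℕ)
notation "varBest" => (36 : ℕ)
notation "varCur" => (37 : ℕ)
notation "idxR" => (38 : ℕ)
notation "idxQ" => (39 : ℕ)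
notation "idxI" => (40 : ℕ)
notation "idxJ" => (41 : ℕ)

/-- The number of resource types. -/
def dimK : Expr := vec 0 (const 1)

/-- The number of starting locations. -/
def dimP : Expr := vec 0 (const 2)

/-- Find the common starting location. -/
def findStart : Prog :=
  forTo idxI dimP (ifLe (const 1) (mat 1 (const 0) (var idxI)) (setVar varStart (var idxI)) skip)

/-- Compute the cost of forbidden pairs: one more than the total reward. -/
def sumRewards : Prog :=
  seq (setVar varBig (const 1))
    (forTo idxI dimN (setVar varBig (add (var varBig) (vec 6 (var idxI)))))

/-- Run `c₁` if the type `q` is processed before the type `r`, else `c₂`. -/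
def ifBefore (q r : Expr) (c₁ c₂ : Prog) : Prog :=
  ifLt (mat 2 q (var varStart)) (mat 2 r (var varStart)) c₁
    (ifEq (mat 2 q (var varStart)) (mat 2 r (var varStart)) (ifLt q r c₁ c₂) c₂)

/-- Clear `varOk` if the demand `idxI` is removed before the type `idxR` is processed. -/
def excludeEarlier : Prog :=
  forTo idxQ dimK
    (ifLe (const 1) (mat 3 (var idxI) (var idxQ))
      (ifBefore (var idxQ) (var idxR) (setVar varOk (const 0)) skip) skip)

/-- Set `varOk` to `1` if the demand `idxI` may be served in the subproblem of the type `idxR`. -/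
def markDemand : Prog :=
  ifLe (const 1) (mat 3 (var idxI) (var idxR))
    (ifLe (mat 7 (var varStart) (var idxI)) (vec 4 (var idxI))
      (seq (setVar varOk (const 1)) excludeEarlier) (setVar varOk (const 0)))
    (setVar varOk (const 0))

/-- The assignment of an entry of the cost matrix. -/
def setEntry (e : Expr) : Prog := setMat arrA (var idxI) (var idxJ) e

/-- Compute one entry of the cost matrix. -/
def fillEntry : Prog :=
  ifLt (var idxI) dimN
    (ifEq (var idxJ) (var idxI) (setEntry (vec 6 (var idxI)))
      (ifLe (const 1) (var varOk)
        (ifLt (var idxJ) dimN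
          (ifLe (add (add (vec 4 (var idxJ)) (vec 5 (var idxJ))) (mat 8 (var idxJ) (var idxI)))
            (vec 4 (var idxI)) (setEntry (const 0)) (setEntry (var varBig)))
          (ifLt (sub (var idxJ) dimN) (mat 2 (var idxR) (var varStart))
            (setEntry (const 0)) (setEntry (var varBig))))
        (setEntry (var varBig))))
    (setEntry (const 0))

/-- Compute one row of the cost matrix. -/
def fillRow : Prog := seq markDemand (forTo idxJ dimNN fillEntry)

/-- Compute the cost matrix. -/
def fillMatrix : Prog := forTo idxI dimNN fillRow

/-- Store the assignment for the type `idxR`. -/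
def storeNext : Prog :=
  forTo idxI dimNN (setMat arrNext (var idxR) (var idxI) (vec arrP (var idxI)))

/-- Store the total reward of the demands which are not served with the type `idxR`. -/
def storeCost : Prog :=
  seq (setVec arrCost (var idxR) (const 0))
    (forTo idxI dimN (ifEq (vec arrP (var idxI)) (var idxI)
      (setVec arrCost (var idxR) (add (vec arrCost (var idxR)) (vec 6 (var idxI)))) skip))

/-- Solve the subproblem of the type `idxR`. -/
def solveType : Prog := seq fillMatrix (seq hungarian (seq storeNext storeCost))

/-- Find the best type. -/
def chooseBest : Prog :=
  seq (setVar varBest (const 0))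
    (forTo idxR dimK
      (ifLt (vec arrCost (var idxR)) (vec arrCost (var varBest)) (setVar varBest (var idxR))
        (ifEq (vec arrCost (var idxR)) (vec arrCost (var varBest))
          (ifBefore (var varBest) (var idxR) (setVar varBest (var idxR)) skip) skip)))

/-- Output the demands which are met. -/
def outputServed : Prog :=
  forTo idxI dimN
    (ifEq (mat arrNext (var varBest) (var idxI)) (var idxI) skip (setVec 11 (var idxI) (const 1)))

/-- Move on to the next demand if the current one does not require the type `idxQ`. -/
def chaseStep : Prog :=
  ifLt (var varCur) dimN
    (ifLe (const 1) (mat 3 (var varCur) (var idxQ)) skip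
      (setVar varCur (mat arrNext (var varBest) (var varCur)))) skip

/-- Find the next stop after `idxI` of a resource of the type `idxQ`. -/
def chaseNext : Prog :=
  seq (setVar varCur (mat arrNext (var varBest) (var idxI))) (loop dimN chaseStep)

/-- Output the arc to `varCur` on which a resource of the type `idxQ` leaves `idxI`. -/
def writeArc : Prog :=
  ifLt (var idxI) dimN
    (ifEq (mat arrNext (var varBest) (var idxI)) (var idxI) skip
      (ifLe (const 1) (mat 3 (var idxI) (var idxQ))
        (ifLt (var varCur) dimN (assign 13 (var idxQ) (var idxI) (var varCur) (const 1))
          (setMat 14 (var idxQ) (var idxI) (const 1))) skip))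
    (ifLt (var varCur) dimN (assign 12 (var idxQ) (var varStart) (var varCur) (const 1)) skip)

/-- Output all arcs. -/
def outputArcs : Prog := forTo idxQ dimK (forTo idxI dimNN (seq chaseNext writeArc))

/-- Output the solution that follows the routes of the type `varBest`. -/
def output : Prog := seq outputServed outputArcs

/-- An implementation of Algorithm A. -/
def algorithm : Prog :=
  seq findStart (seq sumRewards (seq (forTo idxR dimK solveType) (seq chooseBest output)))

/-! ## The instance in the memory -/

/-- The index of a demand or terminal in the arrays: the terminal `a` has the index `n + a`. -/
def code (x : Fin n ⊕ Fin n) : ℕ := (finSumFinEquiv x : Fin (n + n))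

theorem code_inl (d : Fin n) : code (Sum.inl d) = d := by simp [code]

theorem code_inr (a : Fin n) : code (Sum.inr a) = n + a := by simp [code, Nat.add_comm]

theorem code_lt (x : Fin n ⊕ Fin n) : code x < n + n := (finSumFinEquiv x).2

theorem code_injective : Function.Injective (code (n := n)) :=
  Fin.val_injective.comp finSumFinEquiv.injective

theorem exists_code_eq {i : ℕ} (hi : i < n + n) : ∃ x : Fin n ⊕ Fin n, code x = i :=
  ⟨finSumFinEquiv.symm ⟨i, hi⟩, by simp [code]⟩

/-- The memory `s` holds the instance `I`. -/
def HoldsInput (I : Instance n k p) (s : Store) : Prop := ∀ b ∈ List.range 11, s b = I.encode b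

/-- The arrays which the context of a subproblem depends on. -/
def ctxArrays : List ℕ := List.range 11 ++ [varStart, varBig]

/-- The memory holds the instance, the starting location and the cost of forbidden pairs. -/
structure Ctx (I : Instance n k p) (s₀ : Fin p) (s : Store) : Prop where
  input : HoldsInput I s
  start : s varStart 0 0 0 = (s₀ : ℕ)
  big : s varBig 0 0 0 = 1 + ∑ d, I.reward d

section Context

variable {I : Instance n k p} {s₀ : Fin p} {s t : Store}

theorem HoldsInput.of_frame (h : HoldsInput I s) {c : Prog} (ht : ∀ b ∉ c.writes, t b = s b)
    (hc : ∀ b ∈ List.range 11, b ∉ c.writes := by decide) : HoldsInput I t :=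
  fun b hb => (ht b (hc b hb)).trans (h b hb)

theorem Ctx.of_frame (h : Ctx I s₀ s) {c : Prog} (ht : ∀ b ∉ c.writes, t b = s b)
    (hc : ∀ b ∈ ctxArrays, b ∉ c.writes := by decide) : Ctx I s₀ t where
  input := h.input.of_frame ht fun b hb => hc b (List.mem_append_left _ hb)
  start := by rw [ht _ (hc _ (by decide)), h.start]
  big := by rw [ht _ (hc _ (by decide)), h.big]

theorem Ctx.exec (h : Ctx I s₀ s) (c : Prog) (hc : ∀ b ∈ ctxArrays, b ∉ c.writes := by decide) :
    Ctx I s₀ (exec c s) :=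
  h.of_frame (fun _ hb => exec_of_notMem_writes hb s) hc

theorem Ctx.set (h : Ctx I s₀ s) {b i j l : ℕ} {v : ℤ} (hb : b ∉ ctxArrays := by decide) :
    Ctx I s₀ (s.set b i j l v) :=
  h.of_frame (c := .assign b (const 0) (const 0) (const 0) (const 0))
    (fun _ hb' => Store.set_of_ne _ _ _ _ _ (List.ne_of_not_mem_cons hb'))
    fun _ hb' hm => hb (List.mem_singleton.1 hm ▸ hb')

namespace HoldsInput

theorem dimN (h : HoldsInput I s) : dimN.eval s = n := by
  simp [MRMD.dimN, h 0 (by decide), Instance.encode, vecArray]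

theorem dimNN (h : HoldsInput I s) : dimNN.eval s = (n + n : ℕ) := by
  simp [MRMD.dimNN, h.dimN]

theorem dimK (h : HoldsInput I s) : dimK.eval s = k := by
  simp [MRMD.dimK, h 0 (by decide), Instance.encode, vecArray]

theorem dimP (h : HoldsInput I s) : dimP.eval s = p := by
  simp [MRMD.dimP, h 0 (by decide), Instance.encode, vecArray]

theorem one_le_startSet (h : HoldsInput I s) (r : Fin k) (u : Fin p) :
    1 ≤ s 1 r u 0 ↔ u ∈ I.startSet r := by
  rw [h 1 (by decide)]
  by_cases hu : u ∈ I.startSet r <;> simp [Instance.encode, matArray, hu]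

theorem count (h : HoldsInput I s) (r : Fin k) (u : Fin p) : s 2 r u 0 = I.count r u := by
  simp [h 2 (by decide), Instance.encode, matArray]

theorem one_le_req (h : HoldsInput I s) (d : Fin n) (r : Fin k) : 1 ≤ s 3 d r 0 ↔ r ∈ I.req d := by
  rw [h 3 (by decide)]
  by_cases hr : r ∈ I.req d <;> simp [Instance.encode, matArray, hr]

theorem time (h : HoldsInput I s) (d : Fin n) : s 4 d 0 0 = I.time d := by
  simp [h 4 (by decide), Instance.encode, vecArray]

theorem dur (h : HoldsInput I s) (d : Fin n) : s 5 d 0 0 = I.dur d := by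
  simp [h 5 (by decide), Instance.encode, vecArray]

theorem reward (h : HoldsInput I s) (d : Fin n) : s 6 d 0 0 = I.reward d := by
  simp [h 6 (by decide), Instance.encode, vecArray]

theorem travel_start (h : HoldsInput I s) (u : Fin p) (d : Fin n) :
    s 7 u d 0 = I.travel (Sum.inl u) d := by
  simp [h 7 (by decide), Instance.encode, matArray]

theorem travel (h : HoldsInput I s) (d e : Fin n) : s 8 d e 0 = I.travel (Sum.inr d) e := by
  simp [h 8 (by decide), Instance.encode, matArray]

end HoldsInput

theorem HoldsInput.set (h : HoldsInput I s) {b i j l : ℕ} {v : ℤ}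
    (hb : b ∉ List.range 11 := by decide) : HoldsInput I (s.set b i j l v) :=
  h.of_frame (c := .assign b (const 0) (const 0) (const 0) (const 0))
    (fun _ hb' => Store.set_of_ne _ _ _ _ _ (List.ne_of_not_mem_cons hb'))
    fun _ hb' hm => hb (List.mem_singleton.1 hm ▸ hb')

theorem exec_findStart (hs : ∀ r, I.startSet r = {s₀}) (hk : 0 < k) (h : HoldsInput I s) :
    exec findStart s varStart 0 0 0 = (s₀ : ℕ) := by
  have hloop := exec_forTo_apply (a := varStart) (i := idxI) (e := dimP) (s := s) (m := p)
    (c := ifLe (const 1) (mat 1 (const 0) (var idxI)) (setVar varStart (var idxI)) skip)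
    (fun j x y z => j = s₀ ∧ x = 0 ∧ y = 0 ∧ z = 0) (fun _ _ _ => (s₀ : ℕ)) (by decide)
    (by decide) h.set.dimP (fun j t hj ht hi _ x y z => ?_) 0 0 0
  · rw [findStart, hloop, if_pos ⟨s₀, s₀.2, rfl, rfl, rfl, rfl⟩]
  · lift j to Fin p using hj
    have hstart : 1 ≤ t 1 0 j 0 ↔ (j : ℕ) = s₀ := by
      rw [Fin.val_inj, ← Finset.mem_singleton, ← hs ⟨0, hk⟩]
      exact (h.of_frame ht).one_le_startSet ⟨0, hk⟩ j
    simp only [exec_ifLe, exec_setVar, exec_skip, eval_const, eval_mat, eval_var, hi,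
      Int.toNat_natCast, Int.toNat_zero, hstart]
    by_cases hjs : (j : ℕ) = s₀ <;> simp [hjs]

theorem exec_sumRewards (h : HoldsInput I s) :
    exec sumRewards s varBig 0 0 0 = 1 + ∑ d, I.reward d := by
  have h' : HoldsInput I (s.set varBig 0 0 0 1) := h.set
  have hsum : ∑ d, I.reward d = ∑ d ∈ Finset.range n, s 6 d 0 0 := by
    rw [Finset.sum_range]
    exact Finset.sum_congr rfl fun d _ => (h.reward d).symm
  rw [hsum, sumRewards, exec_seq, exec_setVar, eval_const]
  refine exec_forTo (m := n) (fun j t => t varBig 0 0 0 = 1 + ∑ d ∈ Finset.range j, s 6 d 0 0)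
    (fun _ _ _ h => h) (by decide) h'.set.dimN (by simp [Store.set_apply])
    fun j t _ ht hi hJ => ?_
  have h6 : t 6 = s 6 := (ht 6 (by decide)).trans (Store.set_of_ne _ _ _ _ _ (by decide))
  simp [Store.set_apply, hi, hJ, h6, Finset.sum_range_succ, add_assoc]

/-! ## The cost matrix -/

/-- The order in which the program processes the types. -/
def Instance.Before (I : Instance n k p) (s₀ : Fin p) (q r : Fin k) : Prop :=
  I.count q s₀ < I.count r s₀ ∨ (I.count q s₀ = I.count r s₀ ∧ q < r)

open Classical in
/-- The demands of the subproblem of type `r`, when the program is run. -/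
noncomputable def Instance.part (I : Instance n k p) (s₀ : Fin p) (r : Fin k) : Finset (Fin n) :=
  Finset.univ.filter fun d => r ∈ I.req d ∧ ∀ q, I.Before s₀ q r → q ∉ I.req d

variable {r : Fin k} {d : Fin n}

theorem mem_part : d ∈ I.part s₀ r ↔ r ∈ I.req d ∧ ∀ q, I.Before s₀ q r → q ∉ I.req d := by
  simp [Instance.part]

open Classical in
theorem exec_ifBefore (h : Ctx I s₀ s) {e₁ e₂ : Expr} {q : Fin k} (hq : e₁.eval s = (q : ℕ))
    (hr : e₂.eval s = (r : ℕ)) (c₁ c₂ : Prog) :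
    exec (ifBefore e₁ e₂ c₁ c₂) s = if I.Before s₀ q r then exec c₁ s else exec c₂ s := by
  simp only [ifBefore, exec_ifLt, exec_ifEq, eval_mat, eval_var, hq, hr, h.start,
    Int.toNat_natCast, h.input.count, Instance.Before, Fin.lt_def]
  split_ifs <;> first | rfl | omega

open Classical in
theorem exec_excludeEarlier (h : Ctx I s₀ s) (hd : s idxI 0 0 0 = (d : ℕ))
    (hr : s idxR 0 0 0 = (r : ℕ)) : exec excludeEarlier s varOk 0 0 0 =
      if ∃ q, I.Before s₀ q r ∧ q ∈ I.req d then 0 else s varOk 0 0 0 := by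
  have hloop := exec_forTo_apply (a := varOk) (i := idxQ) (e := dimK) (s := s) (m := k)
    (c := ifLe (const 1) (mat 3 (var idxI) (var idxQ))
      (ifBefore (var idxQ) (var idxR) (setVar varOk (const 0)) skip) skip)
    (fun j x y z => (∃ q : Fin k, (q : ℕ) = j ∧ I.Before s₀ q r ∧ q ∈ I.req d) ∧
      x = 0 ∧ y = 0 ∧ z = 0) (fun _ _ _ => 0) (by decide) (by decide) h.set.input.dimK
    (fun j t hj ht hq _ x y z => ?_) 0 0 0
  · rw [excludeEarlier, hloop]
    congr 1
    simp only [and_true, eq_iff_iff]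
    exact ⟨fun ⟨_, _, q, _, hq⟩ => ⟨q, hq⟩, fun ⟨q, hq⟩ => ⟨q, q.2, q, rfl, hq⟩⟩
  · lift j to Fin k using hj
    have h' : Ctx I s₀ t := h.of_frame ht
    rw [← ht idxI (by decide)] at hd
    rw [← ht idxR (by decide)] at hr
    rw [exec_ifLe, exec_ifBefore h' (q := j) (r := r) (by rw [eval_var, hq]) (by rw [eval_var, hr])]
    by_cases h1 : I.Before s₀ j r <;> by_cases h2 : j ∈ I.req d <;>
      simp [hd, hq, h'.input.one_le_req, h1, h2, Store.set_apply, Fin.val_inj]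

theorem one_le_exec_markDemand (h : Ctx I s₀ s) (hd : s idxI 0 0 0 = (d : ℕ))
    (hr : s idxR 0 0 0 = (r : ℕ)) :
    1 ≤ exec markDemand s varOk 0 0 0 ↔ d ∈ I.part s₀ r ∧ I.Reach s₀ d := by
  have hexclude : 1 ≤ exec excludeEarlier (s.set varOk 0 0 0 1) varOk 0 0 0 ↔
      ∀ q, I.Before s₀ q r → q ∉ I.req d := by
    rw [exec_excludeEarlier (d := d) (r := r) h.set
      (by simpa [Store.set_apply] using hd) (by simpa [Store.set_apply] using hr)]
    split_ifs with hex
    · simpa using hex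
    · simpa [Store.set_apply] using hex
  have hreach : s 7 s₀ d 0 ≤ s 4 d 0 0 ↔ I.Reach s₀ d := by
    rw [h.input.travel_start, h.input.time]
    rfl
  by_cases h1 : r ∈ I.req d <;> by_cases h2 : I.Reach s₀ d <;>
    simp [markDemand, h.start, hd, hr, h.input.one_le_req, hreach, mem_part, hexclude, h1, h2]

theorem exec_fillEntry (h : Ctx I s₀ s) (hr : s idxR 0 0 0 = (r : ℕ)) {x y : Fin n ⊕ Fin n}
    (hok : ∀ d, x = Sum.inl d →
      (1 ≤ s varOk 0 0 0 ↔ d ∈ I.part s₀ r ∧ I.Reach s₀ d))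
    (hx : s idxI 0 0 0 = (code x : ℕ)) (hy : s idxJ 0 0 0 = (code y : ℕ)) :
    exec fillEntry s = s.set arrA (code x) (code y) 0
      (I.entry s₀ (I.part s₀ r) (I.count r s₀) (1 + ∑ d, I.reward d) x y) := by
  simp only [fillEntry, setEntry, exec_ifLt, exec_ifEq, exec_ifLe, exec_setMat, eval_var,
    eval_const, eval_vec, eval_mat, eval_add, eval_sub, h.input.dimN, hx, hy, hr, h.start, h.big,
    Int.toNat_natCast, h.input.count]
  rcases x with e | b
  · simp only [code_inl, h.input.reward, h.input.time, Nat.cast_lt, e.2, if_true, hok e rfl]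
    rcases y with d | a
    · simp only [code_inl, h.input.time, h.input.dur, h.input.travel, Instance.entry,
        Nat.cast_inj, Fin.val_inj, d.2, if_true, Instance.Prec]
      by_cases hde : d = e
      · simp only [hde, if_true]
      · by_cases h1 : e ∈ I.part s₀ r ∧ I.Reach s₀ e <;>
          by_cases h2 : I.time d + I.dur d + I.travel (Sum.inr d) e ≤ I.time e <;>
          simp [hok e rfl, hde, h1, h2]
    · have he : ((n + a : ℕ) : ℤ) ≠ (e : ℕ) := by have := e.2; omega
      have ha : ((n + a : ℕ) : ℤ) - n = (a : ℕ) := by push_cast; ring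
      simp only [code_inr, he, if_false, ha, Nat.cast_lt, Instance.entry,
        Nat.not_lt.2 (Nat.le_add_right n a)]
      by_cases h1 : e ∈ I.part s₀ r ∧ I.Reach s₀ e <;> by_cases h2 : (a : ℕ) < I.count r s₀ <;>
        simp [hok e rfl, h1, h2]
  · simp [code_inr, Instance.entry]

theorem exec_fillRow (h : Ctx I s₀ s) (hr : s idxR 0 0 0 = (r : ℕ)) {x : Fin n ⊕ Fin n}
    (hx : s idxI 0 0 0 = (code x : ℕ)) :
    (∀ y, exec fillRow s arrA (code x) (code y) 0 =
      I.entry s₀ (I.part s₀ r) (I.count r s₀) (1 + ∑ d, I.reward d) x y) ∧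
    ∀ i ≠ code x, exec fillRow s arrA i = s arrA i := by
  set a := I.entry s₀ (I.part s₀ r) (I.count r s₀) (1 + ∑ d, I.reward d)
  set s' := exec markDemand s with hs'
  have hframe (b : ℕ) (hb : b ∉ markDemand.writes) : s' b = s b := exec_of_notMem_writes hb s
  have h' : Ctx I s₀ s' := h.of_frame hframe
  have hok (d : Fin n) (hd : x = Sum.inl d) :
      1 ≤ s' varOk 0 0 0 ↔ d ∈ I.part s₀ r ∧ I.Reach s₀ d :=
    one_le_exec_markDemand h (by rw [hx, hd, code_inl]) hr
  rw [← hframe idxR (by decide)] at hr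
  rw [← hframe idxI (by decide)] at hx
  have hloop := exec_forTo (m := n + n) (i := idxJ) (e := dimNN) (c := fillEntry) (s := s')
    (fun j t => (∀ y, code y < j → t arrA (code x) (code y) 0 = a x y) ∧
      ∀ i ≠ code x, t arrA i = s arrA i)
    (fun _ _ _ h => h) (by decide) h'.set.input.dimNN
    ⟨fun _ h => absurd h (Nat.not_lt_zero _), fun i _ => by rw [hframe arrA (by decide)]⟩
    fun j t hj ht hy hJ => ?_
  · exact ⟨fun y => hloop.1 y (code_lt y), hloop.2⟩
  · obtain ⟨y, rfl⟩ := exists_code_eq hj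
    rw [exec_fillEntry (h'.of_frame ht) ((congrFun₃ (ht idxR (by decide)) 0 0 0).trans hr)
      (by rwa [ht varOk (by decide)]) ((congrFun₃ (ht idxI (by decide)) 0 0 0).trans hx) hy]
    refine ⟨fun y' hy' => ?_, fun i hi => ?_⟩
    · by_cases hyy : code y' = code y
      · simp [Store.set_apply, code_injective hyy, a]
      · simpa [Store.set_apply, hyy] using hJ.1 y' (by omega)
    · rw [← hJ.2 i hi]
      funext j l
      simp [Store.set_apply, hi]

theorem exec_fillMatrix (h : Ctx I s₀ s) (hr : s idxR 0 0 0 = (r : ℕ)) (x y : Fin n ⊕ Fin n) :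
    exec fillMatrix s arrA (code x) (code y) 0 =
      I.entry s₀ (I.part s₀ r) (I.count r s₀) (1 + ∑ d, I.reward d) x y := by
  set a := I.entry s₀ (I.part s₀ r) (I.count r s₀) (1 + ∑ d, I.reward d)
  suffices hloop : ∀ x y, code x < n + n → exec fillMatrix s arrA (code x) (code y) 0 = a x y from
    hloop x y (code_lt x)
  refine exec_forTo (m := n + n)
    (fun i t => ∀ x y : Fin n ⊕ Fin n, code x < i → t arrA (code x) (code y) 0 = a x y)
    (fun _ _ _ h => h) (by decide) h.set.input.dimNN (fun _ _ h => absurd h (Nat.not_lt_zero _))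
    fun i t hi ht hx hJ x' y hx' => ?_
  obtain ⟨x, rfl⟩ := exists_code_eq hi
  obtain ⟨hrow, hother⟩ := exec_fillRow (h.of_frame ht)
    ((congrFun₃ (ht idxR (by decide)) 0 0 0).trans hr) hx
  by_cases hxx : code x' = code x
  · rw [code_injective hxx, hrow]
  · rw [hother _ hxx, hJ x' y (by omega)]

/-! ## The subproblems -/

theorem exists_perm_exec_hungarian (h : HoldsInput I s) {a : Fin n ⊕ Fin n → Fin n ⊕ Fin n → ℤ}
    (hA : ∀ x y, s arrA (code x) (code y) 0 = a x y) (ha : ∀ x y, 0 ≤ a x y) :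
    ∃ π : Equiv.Perm (Fin n ⊕ Fin n),
      (∀ x, exec hungarian s arrP (code x) 0 0 = (code (π x) : ℕ)) ∧
      ∀ ρ : Equiv.Perm (Fin n ⊕ Fin n), ∑ x, a (π x) x ≤ ∑ x, a (ρ x) x := by
  have hassign : HasAssignment (n + n) (n + n) (exec hungarian s) := by
    refine hasAssignment_hungarian h.dimNN fun i hi j hj => ?_
    obtain ⟨x, rfl⟩ := exists_code_eq hi
    obtain ⟨y, rfl⟩ := exists_code_eq hj
    exact (hA x y).symm ▸ ha x y
  obtain ⟨f, hf⟩ := hassign.exists_perm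
  have hsum (ρ : Equiv.Perm (Fin (n + n))) :
      ∑ c, s arrA (ρ c) c 0 = ∑ x, a (finSumFinEquiv.symm (ρ (finSumFinEquiv x))) x := by
    rw [← Equiv.sum_comp finSumFinEquiv]
    exact Finset.sum_congr rfl fun x _ => by simp [← hA, code]
  refine ⟨(finSumFinEquiv.trans f).trans finSumFinEquiv.symm, fun x => ?_, fun ρ => ?_⟩
  · simpa [code] using hf (finSumFinEquiv x)
  · have hopt := hassign.sum_le_sum hf ((finSumFinEquiv.symm.trans ρ).trans finSumFinEquiv)
    rw [exec_of_notMem_writes (show arrA ∉ hungarian.writes by decide), hsum, hsum] at hopt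
    simpa using hopt

/-- The memory holds an optimal solution of the subproblem of type `r`. -/
def Solved (I : Instance n k p) (s₀ : Fin p) (r : Fin k) (s : Store) : Prop :=
  ∃ π : Equiv.Perm (Fin n ⊕ Fin n), I.Routing s₀ (I.part s₀ r) (I.count r s₀) π ∧
    I.RoutesOptimal r (I.part s₀ r) (routesOf s₀ π) ∧
    (∀ x, s arrNext r (code x) 0 = (code (π x) : ℕ)) ∧
    s arrCost r 0 0 = ∑ d, I.reward d - I.routesValue (routesOf s₀ π)

theorem Solved.congr (h : Solved I s₀ r s) (hnext : t arrNext r = s arrNext r)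
    (hcost : t arrCost r = s arrCost r) : Solved I s₀ r t := by
  simpa only [Solved, hnext, hcost] using h

theorem exec_storeNext (h : HoldsInput I s) (hr : s idxR 0 0 0 = (r : ℕ)) :
    (∀ x : Fin n ⊕ Fin n, exec storeNext s arrNext r (code x) 0 = s arrP (code x) 0 0) ∧
    ∀ i ≠ (r : ℕ), exec storeNext s arrNext i = s arrNext i := by
  have hloop := exec_forTo_apply (a := arrNext) (i := idxI) (e := dimNN) (s := s) (m := n + n)
    (c := setMat arrNext (var idxR) (var idxI) (vec arrP (var idxI)))
    (fun j x y z => x = r ∧ y = j ∧ z = 0) (fun _ y _ => s arrP y 0 0) (by decide) (by decide)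
    h.set.dimNN fun j t hj ht hi _ x y z => ?_
  · refine ⟨fun x => ?_, fun i hi => ?_⟩
    · rw [storeNext, hloop, if_pos ⟨code x, code_lt x, rfl, rfl, rfl⟩]
    · funext y z
      rw [storeNext, hloop, if_neg fun ⟨_, _, hir, _⟩ => hi hir]
  · rw [← ht idxR (by decide)] at hr
    rw [← ht arrP (by decide)]
    simp only [exec_setMat, eval_var, eval_vec, hi, hr, Int.toNat_natCast, Store.set_apply,
      true_and]
    split_ifs with hxy
    · rw [hxy.2.1]
    · rfl

theorem exec_storeCost (h : HoldsInput I s) (hr : s idxR 0 0 0 = (r : ℕ)) :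
    exec storeCost s arrCost r 0 0 =
      (∑ d : Fin n, if s arrP d 0 0 = (d : ℕ) then I.reward d else 0) ∧
    ∀ i ≠ (r : ℕ), exec storeCost s arrCost i = s arrCost i := by
  set s' := s.set arrCost r 0 0 0 with hs'
  have hset : exec (setVec arrCost (var idxR) (const 0)) s = s' := by simp [hr, hs']
  have h' : HoldsInput I s' := h.set
  have hsum : (∑ d : Fin n, if s arrP d 0 0 = (d : ℕ) then I.reward d else 0) =
      ∑ d ∈ Finset.range n, if s arrP d 0 0 = (d : ℕ) then s 6 d 0 0 else 0 := by
    simp only [Finset.sum_range, h.reward]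
  rw [storeCost, exec_seq, hset, hsum]
  refine exec_forTo (m := n) (fun j t => t arrCost r 0 0 = (∑ d ∈ Finset.range j,
      if s arrP d 0 0 = (d : ℕ) then s 6 d 0 0 else 0) ∧ ∀ i ≠ (r : ℕ), t arrCost i = s arrCost i)
    (fun _ _ _ h => h) (by decide) h'.set.dimN
    ⟨by simp [hs', Store.set_apply], fun i hi => by funext y z; simp [hs', Store.set_apply, hi]⟩
    fun j t hj ht hi hJ => ?_
  have hframe (b : ℕ) (hb : b ∉ storeCost.writes := by decide) : t b = s b :=
    (ht b fun hm => hb (List.mem_append_right _ hm)).trans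
      (Store.set_of_ne _ _ _ _ _ fun e => hb (e ▸ by decide))
  rw [← hframe idxR] at hr
  simp only [exec_ifEq, exec_setVec, exec_skip, eval_vec, eval_var, eval_add, hi, hr,
    hframe arrP, hframe 6, Int.toNat_natCast, Finset.sum_range_succ]
  split_ifs with hj
  · refine ⟨by simp [Store.set_apply, hJ.1], fun i hi => ?_⟩
    rw [← hJ.2 i hi]
    funext y z
    simp [Store.set_apply, hi]
  · simpa using hJ

end Context

section Correctness

variable {I : Instance n k p} {s₀ : Fin p} {s t : Store} {r : Fin k}

theorem solved_exec_solveType (hI : I.Standing) (hs : I.startSet r = {s₀})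
    (hw : ∀ d, 0 ≤ I.reward d) (h : Ctx I s₀ s) (hr : s idxR 0 0 0 = (r : ℕ)) :
    Solved I s₀ r (exec solveType s) := by
  classical
  have h₁ : Ctx I s₀ (exec fillMatrix s) := h.exec _
  have h₂ : Ctx I s₀ (exec hungarian (exec fillMatrix s)) := h₁.exec _
  have hr₂ : exec hungarian (exec fillMatrix s) idxR 0 0 0 = (r : ℕ) := by
    rwa [exec_of_notMem_writes (by decide), exec_of_notMem_writes (by decide)]
  have hr₃ : exec storeNext (exec hungarian (exec fillMatrix s)) idxR 0 0 0 = (r : ℕ) := by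
    rwa [exec_of_notMem_writes (by decide)]
  have hM : ∑ d, I.reward d < 1 + ∑ d, I.reward d := lt_one_add _
  obtain ⟨π, hP, hopt⟩ := exists_perm_exec_hungarian h₁.input (exec_fillMatrix h hr)
    (entry_nonneg hw ((Finset.sum_nonneg fun d _ => hw d).trans hM.le))
  have hπ := Instance.Routing.of_optimal hw hM hopt
  refine ⟨π, hπ, routesOptimal_routesOf hI hw hs (fun d hd => (mem_part.1 hd).1) hM hopt,
    fun x => ?_, ?_⟩ <;> simp only [solveType, exec_seq]
  · rw [exec_of_notMem_writes (c := storeCost) (by decide), (exec_storeNext h₂.input hr₂).1, hP]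
  · have hloop (d : Fin n) : exec storeNext (exec hungarian (exec fillMatrix s)) arrP d 0 0 =
        (d : ℕ) ↔ π (Sum.inl d) = Sum.inl d := by
      rw [exec_of_notMem_writes (by decide), ← code_inl, hP, Nat.cast_inj, code_injective.eq_iff]
    rw [(exec_storeCost (h₂.exec _).input hr₃).1, hπ.routesValue_routesOf hI,
      ← Finset.sum_filter, eq_sub_iff_add_eq]
    simp only [hloop, ne_eq, Finset.sum_filter_add_sum_filter_not]

theorem exec_solveType_of_ne (h : Ctx I s₀ s) (hr : s idxR 0 0 0 = (r : ℕ)) {i : ℕ}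
    (hi : i ≠ r) :
    exec solveType s arrNext i = s arrNext i ∧ exec solveType s arrCost i = s arrCost i := by
  have h₂ : Ctx I s₀ (exec hungarian (exec fillMatrix s)) := (h.exec _).exec _
  have hr₂ : exec hungarian (exec fillMatrix s) idxR 0 0 0 = (r : ℕ) := by
    rwa [exec_of_notMem_writes (by decide), exec_of_notMem_writes (by decide)]
  have hr₃ : exec storeNext (exec hungarian (exec fillMatrix s)) idxR 0 0 0 = (r : ℕ) := by
    rwa [exec_of_notMem_writes (by decide)]
  simp only [solveType, exec_seq]
  constructor
  · rw [exec_of_notMem_writes (c := storeCost) (by decide), (exec_storeNext h₂.input hr₂).2 i hi,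
      exec_of_notMem_writes (by decide), exec_of_notMem_writes (by decide)]
  · rw [(exec_storeCost (h₂.exec _).input hr₃).2 i hi, exec_of_notMem_writes (by decide),
      exec_of_notMem_writes (by decide), exec_of_notMem_writes (by decide)]

theorem solved_exec_forTo_solveType (hI : I.Standing) (hs : ∀ r, I.startSet r = {s₀})
    (hw : ∀ d, 0 ≤ I.reward d) (h : Ctx I s₀ s) (r : Fin k) :
    Solved I s₀ r (exec (forTo idxR dimK solveType) s) := by
  suffices hloop : ∀ r : Fin k, (r : ℕ) < k → Solved I s₀ r (exec (forTo idxR dimK solveType) s)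
    from hloop r r.2
  refine exec_forTo (fun j t => ∀ r : Fin k, (r : ℕ) < j → Solved I s₀ r t)
    (fun _ _ _ hJ r hr => (hJ r hr).congr (by rw [Store.set_of_ne _ _ _ _ _ (by decide)])
      (by rw [Store.set_of_ne _ _ _ _ _ (by decide)])) (by decide) h.set.input.dimK
    (fun _ hr => absurd hr (Nat.not_lt_zero _)) fun j t hj ht hR hJ r hr => ?_
  lift j to Fin k using hj
  have h' : Ctx I s₀ t := h.of_frame ht
  rcases (Nat.lt_succ_iff.1 hr).lt_or_eq with hrj | hrj
  · obtain ⟨hnext, hcost⟩ := exec_solveType_of_ne h' hR hrj.ne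
    exact (hJ r hrj).congr hnext hcost
  · obtain rfl := Fin.ext hrj
    exact solved_exec_solveType hI (hs r) hw h' hR

theorem exec_chooseBest (hk : 0 < k) (h : Ctx I s₀ s) : ∃ b : Fin k,
    exec chooseBest s varBest 0 0 0 = (b : ℕ) ∧ ∀ r : Fin k, s arrCost b 0 0 ≤ s arrCost r 0 0 ∧
      (I.Before s₀ b r → s arrCost b 0 0 < s arrCost r 0 0) := by
  classical
  suffices hloop : ∃ b : Fin k, exec chooseBest s varBest 0 0 0 = (b : ℕ) ∧
      ∀ r : Fin k, (r : ℕ) < k → s arrCost b 0 0 ≤ s arrCost r 0 0 ∧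
        (I.Before s₀ b r → s arrCost b 0 0 < s arrCost r 0 0) from
    hloop.imp fun _ hb => ⟨hb.1, fun r => hb.2 r r.2⟩
  rw [chooseBest, exec_seq, exec_setVar, eval_const]
  have h' : Ctx I s₀ (s.set varBest 0 0 0 0) := h.set
  refine exec_forTo (fun j t => ∃ b : Fin k, t varBest 0 0 0 = (b : ℕ) ∧
      ∀ r : Fin k, (r : ℕ) < j → s arrCost b 0 0 ≤ s arrCost r 0 0 ∧
        (I.Before s₀ b r → s arrCost b 0 0 < s arrCost r 0 0))
    (fun _ _ _ hJ => hJ) (by decide) h'.set.input.dimK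
    ⟨⟨0, hk⟩, by simp, fun _ hr => absurd hr (Nat.not_lt_zero _)⟩
    fun j t hj ht hR ⟨b, hb, hJ⟩ => ?_
  lift j to Fin k using hj
  have hcost : t arrCost = s arrCost :=
    (ht _ (by decide)).trans (Store.set_of_ne _ _ _ _ _ (by decide))
  rw [exec_ifLt, exec_ifEq, exec_ifBefore (h'.of_frame ht) (q := b) (r := j)
    (by rw [eval_var, hb]) (by rw [eval_var, hR])]
  simp only [eval_vec, eval_var, hb, hR, hcost, Int.toNat_natCast, exec_setVar, exec_skip]
  have hset : t.set varBest 0 0 0 (j : ℕ) varBest 0 0 0 = (j : ℕ) := by simp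
  have hlt (r : Fin k) (hr : (r : ℕ) < j + 1) : (r : ℕ) < j ∨ r = j :=
    (Nat.lt_succ_iff.1 hr).lt_or_eq.imp_right Fin.ext
  simp only [Instance.Before, Fin.lt_def] at hJ ⊢
  split_ifs with h1 h2 h3
  · exact ⟨j, hset, by grind⟩
  · exact ⟨j, hset, by grind⟩
  · exact ⟨b, hb, by grind⟩
  · exact ⟨b, hb, by grind⟩

/-! ## The output -/

/-- The array entry in which the program outputs the arc of a resource of type `q` from `x` to its
next stop `y`, if any. Here `x` is a demand or, if the route starts with this arc, a terminal. -/
def Instance.arcCell (I : Instance n k p) (s₀ : Fin p) (π : Equiv.Perm (Fin n ⊕ Fin n))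
    (q : Fin k) : Fin n ⊕ Fin n → Fin n ⊕ Fin n → Option (ℕ × ℕ × ℕ × ℕ)
  | Sum.inl i, Sum.inl j =>
    if π (Sum.inl i) ≠ Sum.inl i ∧ q ∈ I.req i then some (13, q, i, j) else none
  | Sum.inl i, Sum.inr _ =>
    if π (Sum.inl i) ≠ Sum.inl i ∧ q ∈ I.req i then some (14, q, i, 0) else none
  | Sum.inr _, Sum.inl j => some (12, q, s₀, j)
  | Sum.inr _, Sum.inr _ => none

/-- The arrays which the output depends on. -/
def routingArrays : List ℕ := [varBest, arrNext] ++ ctxArrays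

/-- The memory is ready for the output of the routes that `π` describes. -/
structure HoldsRouting (I : Instance n k p) (s₀ : Fin p) (π : Equiv.Perm (Fin n ⊕ Fin n))
    (s : Store) : Prop extends Ctx I s₀ s where
  next : ∀ x, s arrNext (s varBest 0 0 0).toNat (code x) 0 = (code (π x) : ℕ)

section HoldsRouting

variable {π : Equiv.Perm (Fin n ⊕ Fin n)} {q : Fin k} {x y : Fin n ⊕ Fin n}

theorem HoldsRouting.of_frame (h : HoldsRouting I s₀ π s) {c : Prog}
    (ht : ∀ b ∉ c.writes, t b = s b) (hc : ∀ b ∈ routingArrays, b ∉ c.writes := by decide) :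
    HoldsRouting I s₀ π t where
  toCtx := h.toCtx.of_frame ht fun b hb => hc b (List.mem_append_right _ hb)
  next := by
    rw [ht _ (hc _ (by decide)), ht _ (hc _ (by decide))]
    exact h.next

theorem HoldsRouting.set (h : HoldsRouting I s₀ π s) {b i j l : ℕ} {v : ℤ}
    (hb : b ∉ routingArrays := by decide) : HoldsRouting I s₀ π (s.set b i j l v) :=
  h.of_frame (c := .assign b (const 0) (const 0) (const 0) (const 0))
    (fun _ hb' => Store.set_of_ne _ _ _ _ _ (List.ne_of_not_mem_cons hb'))
    fun _ hb' hm => hb (List.mem_singleton.1 hm ▸ hb')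

theorem HoldsRouting.exec (h : HoldsRouting I s₀ π s) (c : Prog)
    (hc : ∀ b ∈ routingArrays, b ∉ c.writes := by decide) : HoldsRouting I s₀ π (exec c s) :=
  h.of_frame (fun _ hb => exec_of_notMem_writes hb s) hc

theorem HoldsRouting.next_eq_iff (h : HoldsRouting I s₀ π s) (d : Fin n) :
    s arrNext (s varBest 0 0 0).toNat d 0 = (d : ℕ) ↔ π (Sum.inl d) = Sum.inl d := by
  rw [← code_inl, h.next, Nat.cast_inj, code_injective.eq_iff]

theorem exec_chaseStep (h : HoldsRouting I s₀ π s) (hq : s idxQ 0 0 0 = (q : ℕ))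
    (hx : s varCur 0 0 0 = (code x : ℕ)) :
    exec chaseStep s varCur 0 0 0 = (code (I.chase q π x) : ℕ) := by
  rcases x with d | a
  · have hnext := h.next (Sum.inl d)
    rw [code_inl] at hx hnext
    by_cases hd : q ∈ I.req d <;>
      simp [chaseStep, h.input.dimN, hx, hq, h.input.one_le_req, hd, Instance.chase, code_inl,
        hnext]
  · simp [chaseStep, h.input.dimN, hx, code_inr, Instance.chase, (Int.natCast_nonneg _).not_gt]

theorem exec_chaseNext (h : HoldsRouting I s₀ π s) (hq : s idxQ 0 0 0 = (q : ℕ))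
    (hx : s idxI 0 0 0 = (code x : ℕ)) :
    exec chaseNext s varCur 0 0 0 = (code ((I.chase q π)^[n] (π x)) : ℕ) := by
  set s' := s.set varCur 0 0 0 (code (π x) : ℕ) with hs'
  have h' : HoldsRouting I s₀ π s' := h.set
  have hset : exec (setVar varCur (mat arrNext (var varBest) (var idxI))) s = s' := by
    simp [hx, h.next, hs']
  rw [chaseNext, exec_seq, hset, exec_loop, h'.input.dimN, Int.toNat_natCast]
  have hframe (m : ℕ) : ∀ b ∉ chaseStep.writes, (exec chaseStep)^[m] s' b = s' b :=
    fun b hb => iterate_exec_of_forall (exec_of_notMem_writes hb) m s'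
  suffices hchase : ∀ m, (exec chaseStep)^[m] s' varCur 0 0 0 =
      (code ((I.chase q π)^[m] (π x)) : ℕ) from hchase n
  intro m
  induction m with
  | zero => simp [hs']
  | succ m ih =>
    rw [Function.iterate_succ_apply', Function.iterate_succ_apply']
    exact exec_chaseStep (h'.of_frame (hframe m)) (by rwa [hframe m _ (by decide)]) ih

theorem exec_writeArc (h : HoldsRouting I s₀ π s) (hq : s idxQ 0 0 0 = (q : ℕ))
    (hx : s idxI 0 0 0 = (code x : ℕ)) (hy : s varCur 0 0 0 = (code y : ℕ)) (a u v w : ℕ) :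
    exec writeArc s a u v w =
      if some (a, u, v, w) = I.arcCell s₀ π q x y then 1 else s a u v w := by
  have hlt : ((code y : ℕ) : ℤ) < n ↔ ∃ j, y = Sum.inl j := by
    rcases y with j | b <;> simp [code_inl, code_inr, (Int.natCast_nonneg _).not_gt]
  simp only [writeArc, exec_ifLt, exec_ifEq, exec_ifLe, exec_setMat, exec_assign, exec_skip,
    eval_var, eval_mat, eval_const, h.input.dimN, h.start, hq, hx, hy, hlt, Int.toNat_natCast]
  rcases x with i | b
  · by_cases hi : π (Sum.inl i) = Sum.inl i
    · rcases y with j | b <;> simp [code_inl, h.next_eq_iff, hi, Instance.arcCell]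
    · rcases y with j | b <;> by_cases hr : q ∈ I.req i <;>
        simp [code_inl, h.next_eq_iff, h.input.one_le_req, hi, hr, Instance.arcCell,
          Store.set_apply]
  · rcases y with j | b' <;>
      simp [code_inl, code_inr, (Int.natCast_nonneg _).not_gt, Instance.arcCell, Store.set_apply]

open Classical in
theorem exec_outputRow (h : HoldsRouting I s₀ π s) {a : ℕ} (ha : a ∈ [12, 13, 14])
    (hq : s idxQ 0 0 0 = (q : ℕ)) (u v w : ℕ) :
    exec (forTo idxI dimNN (seq chaseNext writeArc)) s a u v w =
      if ∃ x, some (a, u, v, w) = I.arcCell s₀ π q x ((I.chase q π)^[n] (π x)) then 1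
      else s a u v w := by
  obtain ⟨hai, hac⟩ : a ≠ idxI ∧ a ∉ chaseNext.writes := by revert a; decide
  have hloop := exec_forTo_apply (a := a) (i := idxI) (e := dimNN) (s := s) (m := n + n)
    (c := seq chaseNext writeArc) (fun j u v w => ∃ x, code x = j ∧
      some (a, u, v, w) = I.arcCell s₀ π q x ((I.chase q π)^[n] (π x))) (fun _ _ _ => 1) hai
    (by decide) h.set.input.dimNN (fun j t hj ht hi _ u v w => ?_) u v w
  · exact hloop.trans <| ite_congr (propext ⟨fun ⟨_, _, x, _, hx⟩ => ⟨x, hx⟩, fun ⟨x, hx⟩ =>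
      ⟨code x, code_lt x, x, rfl, hx⟩⟩)
      (fun _ => rfl) fun _ => rfl
  · obtain ⟨x, rfl⟩ := exists_code_eq hj
    have h' : HoldsRouting I s₀ π t := h.of_frame ht
    rw [← ht idxQ (by decide)] at hq
    rw [exec_seq, exec_writeArc (h'.exec chaseNext) (by rwa [exec_of_notMem_writes (by decide)])
      (by rwa [exec_of_notMem_writes (by decide)]) (exec_chaseNext h' hq hi),
      exec_of_notMem_writes hac]
    simp only [code_injective.eq_iff, exists_eq_left]

open Classical in
theorem exec_outputArcs (h : HoldsRouting I s₀ π s) {a : ℕ} (ha : a ∈ [12, 13, 14]) (u v w : ℕ) :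
    exec outputArcs s a u v w =
      if ∃ q x, some (a, u, v, w) = I.arcCell s₀ π q x ((I.chase q π)^[n] (π x)) then 1
      else s a u v w := by
  have hai : a ≠ idxQ := by revert a; decide
  have hloop := exec_forTo_apply (a := a) (i := idxQ) (e := dimK) (s := s) (m := k)
    (c := forTo idxI dimNN (seq chaseNext writeArc)) (fun j u v w => ∃ q : Fin k, (q : ℕ) = j ∧
      ∃ x, some (a, u, v, w) = I.arcCell s₀ π q x ((I.chase q π)^[n] (π x))) (fun _ _ _ => 1) hai
    (by decide) h.set.input.dimK (fun j t hj ht hq _ u v w => ?_) u v w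
  · exact hloop.trans <| ite_congr (propext ⟨fun ⟨_, _, q, _, hq⟩ => ⟨q, hq⟩, fun ⟨q, hq⟩ =>
      ⟨q, q.2, q, rfl, hq⟩⟩)
      (fun _ => rfl) fun _ => rfl
  · lift j to Fin k using hj
    rw [exec_outputRow (h.of_frame ht) ha hq]
    simp only [Fin.val_inj, exists_eq_left]

theorem exec_outputServed (h : HoldsRouting I s₀ π s) (d : Fin n) :
    exec outputServed s 11 d 0 0 = if π (Sum.inl d) ≠ Sum.inl d then 1 else s 11 d 0 0 := by
  have hloop := exec_forTo_apply (a := 11) (i := idxI) (e := dimN) (s := s) (m := n)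
    (c := ifEq (mat arrNext (var varBest) (var idxI)) (var idxI) skip
      (setVec 11 (var idxI) (const 1)))
    (fun j x y z => (∃ d : Fin n, (d : ℕ) = j ∧ π (Sum.inl d) ≠ Sum.inl d) ∧
      x = j ∧ y = 0 ∧ z = 0) (fun _ _ _ => 1) (by decide) (by decide) h.set.input.dimN
    (fun j t hj ht hi _ x y z => ?_) d 0 0
  · exact hloop.trans <| ite_congr (propext
      ⟨by rintro ⟨_, _, ⟨e, rfl, he⟩, hde, -⟩; exact Fin.ext hde ▸ he,
        fun hd => ⟨d, d.2, ⟨d, rfl, hd⟩, rfl, rfl, rfl⟩⟩)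
      (fun _ => rfl) fun _ => rfl
  · lift j to Fin n using hj
    by_cases hj : π (Sum.inl j) = Sum.inl j <;>
      simp [hi, (h.of_frame ht).next_eq_iff, hj, Fin.val_inj, Store.set_apply]

end HoldsRouting

section ArcCell

variable {π : Equiv.Perm (Fin n ⊕ Fin n)} {F : Fin k → Fin n ⊕ Fin n → Fin n ⊕ Fin n} {q : Fin k}

theorem exists_some_start_eq_arcCell {s' : Fin p} {d : Fin n} :
    (∃ q' x, some (12, (q : ℕ), (s' : ℕ), (d : ℕ)) = I.arcCell s₀ π q' x (F q' x)) ↔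
      s' = s₀ ∧ ∃ a, F q (Sum.inr a) = Sum.inl d := by
  constructor
  · rintro ⟨q', i | a, hx⟩
    · rcases hy : F q' (Sum.inl i) with j | b <;> simp [hy, Instance.arcCell] at hx
    · rcases hy : F q' (Sum.inr a) with j | b
      · simp only [hy, Instance.arcCell, Option.some.injEq, Prod.mk.injEq, Fin.val_inj,
          true_and] at hx
        obtain ⟨rfl, rfl, rfl⟩ := hx
        exact ⟨rfl, a, hy⟩
      · simp [hy, Instance.arcCell] at hx
  · rintro ⟨rfl, a, ha⟩
    exact ⟨q, Sum.inr a, by rw [ha, Instance.arcCell]⟩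

theorem exists_some_arc_eq_arcCell {i j : Fin n} :
    (∃ q' x, some (13, (q : ℕ), (i : ℕ), (j : ℕ)) = I.arcCell s₀ π q' x (F q' x)) ↔
      (π (Sum.inl i) ≠ Sum.inl i ∧ q ∈ I.req i) ∧ F q (Sum.inl i) = Sum.inl j := by
  constructor
  · rintro ⟨q', i' | a, hx⟩
    · rcases hy : F q' (Sum.inl i') with j' | b
      · simp only [hy, Instance.arcCell, Option.some_eq_ite_none_right, Option.some.injEq,
          Prod.mk.injEq, Fin.val_inj, true_and] at hx
        obtain ⟨hi, rfl, rfl, rfl⟩ := hx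
        exact ⟨hi, hy⟩
      · simp [hy, Instance.arcCell] at hx
    · rcases hy : F q' (Sum.inr a) with j' | b <;> simp [hy, Instance.arcCell] at hx
  · rintro ⟨hi, hj⟩
    exact ⟨q, Sum.inl i, by rw [hj, Instance.arcCell, if_pos hi]⟩

theorem exists_some_last_eq_arcCell {i : Fin n} :
    (∃ q' x, some (14, (q : ℕ), (i : ℕ), 0) = I.arcCell s₀ π q' x (F q' x)) ↔
      (π (Sum.inl i) ≠ Sum.inl i ∧ q ∈ I.req i) ∧ (F q (Sum.inl i)).isRight := by
  constructor
  · rintro ⟨q', i' | a, hx⟩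
    · rcases hy : F q' (Sum.inl i') with j' | b
      · simp [hy, Instance.arcCell] at hx
      · simp only [hy, Instance.arcCell, Option.some_eq_ite_none_right, Option.some.injEq,
          Prod.mk.injEq, Fin.val_inj, true_and, and_true] at hx
        obtain ⟨hi, rfl, rfl⟩ := hx
        exact ⟨hi, by rw [hy, Sum.isRight_inr]⟩
    · rcases hy : F q' (Sum.inr a) with j' | b <;> simp [hy, Instance.arcCell] at hx
  · rintro ⟨hi, hj⟩
    obtain ⟨b, hb⟩ := Sum.isRight_iff.1 hj
    exact ⟨q, Sum.inl i, by rw [hb, Instance.arcCell, if_pos hi]⟩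

end ArcCell

theorem readSolution_exec_output (hI : I.Standing) {E : Finset (Fin n)} {c : ℕ}
    {π : Equiv.Perm (Fin n ⊕ Fin n)} (h : HoldsRouting I s₀ π s) (hπ : I.Routing s₀ E c π)
    (h0 : ∀ b ∈ [11, 12, 13, 14], s b = fun _ _ _ => 0) :
    readSolution n k p (exec output s) = I.follow (routesOf s₀ π) := by
  have h' : HoldsRouting I s₀ π (exec outputServed s) := h.exec _
  have h0' : ∀ b ∈ [12, 13, 14], exec outputServed s b = fun _ _ _ => 0 := fun b hb => by
    rw [exec_of_notMem_writes (by revert b; decide), h0 b (List.mem_cons_of_mem _ hb)]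
  rw [readSolution, output, exec_seq, Solution.mk.injEq]
  refine ⟨?_, ?_, ?_, ?_⟩
  · funext d
    rw [exec_of_notMem_writes (by decide), exec_outputServed h, hπ.follow_y_routesOf hI,
      h0 11 (by decide)]
  · funext q s' d
    rw [exec_outputArcs h' (by decide), hπ.follow_xs_routesOf hI, h0' 12 (by decide)]
    exact if_congr exists_some_start_eq_arcCell rfl rfl
  · funext q i j
    rw [exec_outputArcs h' (by decide), hπ.follow_x_routesOf hI, h0' 13 (by decide)]
    exact if_congr exists_some_arc_eq_arcCell rfl rfl
  · funext q i
    rw [exec_outputArcs h' (by decide), hπ.follow_xt_routesOf hI, h0' 14 (by decide)]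
    exact if_congr exists_some_last_eq_arcCell rfl rfl

/-! ## Correctness and running time -/

theorem before_sort_iff (I : Instance n k p) (s₀ : Fin p) (i j : Fin k) :
    I.Before s₀ (Tuple.sort (fun r => I.count r s₀) i) (Tuple.sort (fun r => I.count r s₀) j) ↔
      i < j := by
  have hlt {i j : Fin k} (hij : i < j) : I.Before s₀ (Tuple.sort (fun r => I.count r s₀) i)
      (Tuple.sort (fun r => I.count r s₀) j) := by
    obtain ⟨hmono, htie⟩ := Tuple.eq_sort_iff.1 (rfl : Tuple.sort (fun r => I.count r s₀) = _)
    exact (hmono hij.le).lt_or_eq.imp_right fun h => ⟨h, htie i j hij h⟩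
  refine ⟨fun h => ?_, hlt⟩
  by_contra! hji
  obtain hji | rfl := hji.lt_or_eq
  · have := hlt hji
    grind [Instance.Before]
  · grind [Instance.Before]

theorem remaining_sort (I : Instance n k p) (s₀ : Fin p) (i : Fin k) :
    I.remaining (Tuple.sort fun r => I.count r s₀) i =
      I.part s₀ (Tuple.sort (fun r => I.count r s₀) i) := by
  ext d
  rw [mem_remaining, mem_part]
  refine and_congr_right fun _ => Iff.trans ?_
    (Tuple.sort fun r => I.count r s₀).surjective.forall.symm
  simp only [before_sort_iff]

theorem algorithmA_follow (hs : ∀ r, I.startSet r = {s₀}) {W : Fin k → List (Route n p)}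
    {b : Fin k} (hopt : ∀ r, I.RoutesOptimal r (I.part s₀ r) (W r))
    (hbest : ∀ r, I.routesValue (W r) ≤ I.routesValue (W b) ∧
      (I.Before s₀ b r → I.routesValue (W r) < I.routesValue (W b))) :
    I.AlgorithmA (I.follow (W b)) := by
  set σ : Equiv.Perm (Fin k) := Tuple.sort fun r => I.count r s₀ with hσ
  refine ⟨σ, fun i => W (σ i), σ.symm b, ?_, fun i => ?_, fun i => ?_, fun i hi => ?_, ?_⟩
  · simp only [numResources_eq_of_startSet (hs _)]
    exact Tuple.monotone_sort fun r => I.count r s₀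
  · exact remaining_sort I s₀ i ▸ hopt (σ i)
  · simpa only [Equiv.apply_symm_apply] using (hbest (σ i)).1
  · simp only [Equiv.apply_symm_apply]
    refine (hbest (σ i)).2 ?_
    rwa [← before_sort_iff I s₀, ← hσ, Equiv.apply_symm_apply] at hi
  · simp only [Equiv.apply_symm_apply]

theorem ctx_exec_sumRewards (hI : I.Standing) (hs : ∀ r, I.startSet r = {s₀}) :
    Ctx I s₀ (exec sumRewards (exec findStart I.encode)) := by
  have hinput : HoldsInput I I.encode := fun _ _ => rfl
  have hfind : HoldsInput I (exec findStart I.encode) :=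
    hinput.of_frame fun b hb => exec_of_notMem_writes hb _
  refine ⟨hfind.of_frame fun b hb => exec_of_notMem_writes hb _, ?_, exec_sumRewards hfind⟩
  rw [exec_of_notMem_writes (by decide), exec_findStart hs hI.types_pos hinput]

theorem algorithm_spec (hI : I.Standing) (hs : ∀ r, I.startSet r = {s₀})
    (hw : ∀ d, 0 ≤ I.reward d) :
    I.AlgorithmA (readSolution n k p (exec algorithm I.encode)) := by
  set t := exec (forTo idxR dimK solveType) (exec sumRewards (exec findStart I.encode)) with ht
  have hctx : Ctx I s₀ t := (ctx_exec_sumRewards hI hs).exec _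
  choose π hπ hopt hnext hcost using
    solved_exec_forTo_solveType hI hs hw (ctx_exec_sumRewards hI hs)
  obtain ⟨b, hb, hbest⟩ := exec_chooseBest hI.types_pos hctx
  have hrouting : HoldsRouting I s₀ (π b) (exec chooseBest t) :=
    { hctx.exec chooseBest with
      next := fun x => by
        rw [hb, Int.toNat_natCast, exec_of_notMem_writes (by decide), ht, hnext] }
  have hzero : ∀ a ∈ [11, 12, 13, 14], exec chooseBest t a = fun _ _ _ => 0 := fun a ha => by
    rw [exec_of_notMem_writes (by revert a; decide), ht,
      exec_of_notMem_writes (by revert a; decide), exec_of_notMem_writes (by revert a; decide),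
      exec_of_notMem_writes (by revert a; decide)]
    fin_cases ha <;> rfl
  have hrun : exec algorithm I.encode = exec output (exec chooseBest t) := by
    simp only [algorithm, exec_seq, ht]
  rw [hrun, readSolution_exec_output hI hrouting (hπ b) hzero]
  refine algorithmA_follow hs (W := fun r => routesOf s₀ (π r)) hopt fun r => ?_
  simpa only [ht, hcost, sub_le_sub_iff_left, sub_lt_sub_iff_left] using hbest r

theorem algorithm_steps_le (I : Instance n k p) :
    (algorithm.run I.encode).2 ≤ algorithm.timeBound.eval I.size := by
  refine Prog.steps_le_eval_timeBound (by decide) (by decide) fun i j l => ?_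
  have hsize : n + k + p ≤ I.size := by
    simp only [Instance.size]
    omega
  simp only [Instance.encode, vecArray]
  split_ifs with h
  · obtain ⟨hi, -, -⟩ := h
    interval_cases i <;> simp <;> omega
  · exact Int.natCast_nonneg _

end Correctness

end MRMD

theorem mainTheorem12 :
    MRMD.IsApproxAlgorithm
      (fun I => I.Standing ∧ I.SameStart ∧ I.SmallCosts)
      (fun I z => I.AlgorithmA z)
      (fun k => 2 * k) := by
  refine ⟨fun I hI z hz => hz.feasible_and_objective_le hI.1 hI.2.1 hI.2.2, MRMD.algorithm,
    MRMD.algorithm.timeBound, fun I hI => ⟨?_, MRMD.algorithm_steps_le I⟩⟩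
  obtain ⟨hI, ⟨s, hs⟩, hC⟩ := hI
  exact MRMD.algorithm_spec hI hs (hC.reward_nonneg hI.types_pos)
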